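/- Let $\Gamma\subset \mathrm{PSL}_2(\mathbb R)$ be a discrete subgroup acting freely on the upper half plane $\mathbb H$ with compact quotient, so that $X=\Gamma\backslash\mathbb H$ is a smooth compact hyperbolic surface. Assume that the diagonal subgroup $\Gamma_0$ of $\Gamma$ is generated by $\pm\begin{pmatrix} m&0\\0&m^{-1}\end{pmatrix}$ with $m>1$, so that $i\mathbb R^+$ projects onto a primitive closed geodesic $C=\Gamma_0\backslash i\mathbb R^+$ of $X$, of length $\mathrm{len}(C)=2\log m$. Let $\{\varphi_n\}_{n\ge 0}$ be an orthonormal basis of $L^2(X)$ (with respect to the hyperbolic area) consisting of eigenfunctions of $\Delta=-y^2(\partial_x^2+\partial_y^2)$ with eigenvalues $\lambda_n=\frac14+r_n^2$, $r_n\in\mathbb C$, and let $P(\varphi_n)=\int_C\varphi_n\,ds$ be their periods with respect to arc length. For $x>0$ let $K_\nu(x)=\frac12\int_{\mathbb R}e^{-x\cosh u+\nu u}\,du$ be the $K$-Bessel function. For $\gamma=\pm\begin{pmatrix}a&b\\c&d\end{pmatrix}\in\Gamma$ put $\delta(\gamma)=2|ad+bc|$; it depends only on the double coset $\Gamma_0\gamma\Gamma_0$.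 Then $\sum_{n\ge0} K_{ir_n}(t)|P(\varphi_n)|^2$ converges absolutely for every $t>0$, only finitely many double cosets in $\Gamma_0\backslash\Gamma/\Gamma_0$ have $\delta<2$, and, as $t\to\infty$, $$2e^{2t}\sqrt{\frac{\pi}{t}}\,\sum_{n=0}^\infty K_{ir_n}(2t)\,|P(\varphi_n)|^2=\mathrm{len}(C)\sqrt{\frac{\pi}{t}}+\Bigl(\sum_{\delta<2}\frac{2}{\sqrt{4-\delta^2}}\Bigr)\frac{\pi}{t}+O\Bigl(\frac1{t\sqrt t}\Bigr),$$ where the sum over $\delta<2$ runs over the double cosets in $\Gamma_0\backslash\Gamma/\Gamma_0$ with $\delta=\delta(\gamma)<2$. In particular, $$\lim_{t\to\infty}e^t\sum_{n=1}^\infty K_{ir_n}(t)\,|P(\varphi_n)|^2=\frac{\mathrm{len}(C)}2,$$ and the same limit holds for the sum over $n\ge0$. -/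

import Mathlib

open scoped MatrixGroups UpperHalfPlane InnerProductSpace

noncomputable section

namespace GeodesicPeriods

/-- Cocompact, torsion-free Fuchsian groups. A subgroup of `PSL(2, ℝ)` is given by its full
preimage `Γ` in `SL(2, ℝ)`, i.e. by a subgroup of `SL(2, ℝ)` containing `-1`. -/
structure IsSurfaceGroup (Γ : Subgroup SL(2, ℝ)) : Prop where
  neg_one_mem : (-1 : SL(2, ℝ)) ∈ Γ
  discrete : DiscreteTopology Γ
  free : ∀ g ∈ Γ, ∀ z : ℍ, g • z = z → g = 1 ∨ g = -1
  cocompact : CompactSpace (Quotient (MulAction.orbitRel Γ ℍ))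

/-- The hyperbolic surface `X = Γ \ ℍ`. -/
abbrev Surface (Γ : Subgroup SL(2, ℝ)) : Type := Quotient (MulAction.orbitRel Γ ℍ)

/-- The projection `ℍ → X`. -/
def proj (Γ : Subgroup SL(2, ℝ)) (z : ℍ) : Surface Γ := Quotient.mk (MulAction.orbitRel Γ ℍ) z

/-- A Borel set of representatives for the action of `Γ` on `ℍ`. -/
structure IsFundamentalSet (Γ : Subgroup SL(2, ℝ)) (F : Set ℍ) : Prop where
  measurableSet : MeasurableSet F
  existsUnique : ∀ z : ℍ, ∃! w : ℍ, w ∈ F ∧ w ∈ MulAction.orbit Γ z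

/-- The hyperbolic area measure of `X`: the push-forward of the restriction of `dx dy / y ^ 2`
to a fundamental set (it does not depend on the fundamental set). -/
def surfaceArea (Γ : Subgroup SL(2, ℝ)) (F : Set ℍ) : MeasureTheory.Measure (Surface Γ) :=
  ((MeasureTheory.volume : MeasureTheory.Measure ℍ).restrict F).map (proj Γ)

/-- A function on `X`, read as a function on the open upper half of `ℂ`. (The values of
`UpperHalfPlane.ofComplex` off the upper half plane are never used.) -/
def lift (Γ : Subgroup SL(2, ℝ)) (f : Surface Γ → ℂ) : ℂ → ℂ :=
  fun z => f (proj Γ (UpperHalfPlane.ofComplex z))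

/-- `f` is twice continuously differentiable and `Δ f = lam * f` on `X`, for the hyperbolic
Laplacian `Δ = - y ^ 2 (∂² / ∂x² + ∂² / ∂y²)`. -/
structure IsEigenfunction (Γ : Subgroup SL(2, ℝ)) (f : Surface Γ → ℂ) (lam : ℝ) : Prop where
  contDiffOn : ContDiffOn ℝ 2 (lift Γ f) {z : ℂ | 0 < z.im}
  eigen : ∀ z : ℍ, -((z.im : ℂ) ^ 2) * (Laplacian.laplacian (lift Γ f) : ℂ → ℂ) (z : ℂ)
    = (lam : ℂ) * f (proj Γ z)

/-- The diagonal matrices in `Γ` are exactly the `± diag (m ^ k, m ^ (-k))`, `k ∈ ℤ`, where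
`m > 1`. Then the imaginary half-axis projects onto a primitive closed geodesic
`C = Γ₀ \ iℝ⁺` of `X`, and `iy ↦ i m ^ 2 y` generates the stabilizer of the half-axis. -/
structure DiagonalGenerator (Γ : Subgroup SL(2, ℝ)) (m : ℝ) : Prop where
  one_lt : 1 < m
  mem_iff : ∀ g : SL(2, ℝ), g 0 1 = 0 → g 1 0 = 0 → (g ∈ Γ ↔ ∃ k : ℤ, |g 0 0| = m ^ k)

/-- The length of `C`, which is the hyperbolic distance from `i` to `i m ^ 2`. -/
def geodesicLength (m : ℝ) : ℝ := 2 * Real.log m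

/-- The point `i e ^ u`; `u ↦ i e ^ u` is the unit speed parametrization of the half-axis. -/
def axisPoint (u : ℝ) : ℍ :=
  ⟨(Real.exp u : ℂ) * Complex.I, by simpa [-Complex.ofReal_exp] using Real.exp_pos u⟩

/-- The period `P(f) = ∫_C f`, with respect to arc length. -/
def period (Γ : Subgroup SL(2, ℝ)) (m : ℝ) (f : Surface Γ → ℂ) : ℂ :=
  ∫ u in (0 : ℝ)..geodesicLength m, f (proj Γ (axisPoint u))

/-- The `K`-Bessel function `K_ν(x) = (1/2) ∫_ℝ exp (- x cosh u) exp (ν u) du`, for `x > 0`. -/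
def besselK (ν : ℂ) (x : ℝ) : ℂ :=
  (1 / 2 : ℂ) * ∫ u : ℝ, Complex.exp (-(x * Real.cosh u : ℝ)) * Complex.exp (ν * (u : ℂ))

/-- The diagonal subgroup `Γ₀` of `Γ`. -/
def diagonalSubgroup (Γ : Subgroup SL(2, ℝ)) : Subgroup Γ where
  carrier := {g | (g : SL(2, ℝ)) 0 1 = 0 ∧ (g : SL(2, ℝ)) 1 0 = 0}
  one_mem' := by simp
  mul_mem' := by
    rintro a b ⟨ha, ha'⟩ ⟨hb, hb'⟩
    simp [Matrix.mul_apply, Fin.sum_univ_two, ha, ha', hb, hb']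
  inv_mem' := by
    rintro a ⟨ha, ha'⟩
    simp [Matrix.SpecialLinearGroup.coe_inv, Matrix.adjugate_fin_two, ha, ha']

/-- The set `Γ₀ \ Γ / Γ₀` of double cosets (as `-1 ∈ Γ₀`, it is the same set for `Γ` and for its
image in `PSL(2, ℝ)`). -/
abbrev DoubleCosets (Γ : Subgroup SL(2, ℝ)) : Type :=
  DoubleCoset.Quotient (diagonalSubgroup Γ : Set Γ) (diagonalSubgroup Γ : Set Γ)

/-- `δ(γ) = 2 |a d + b c|` for a matrix `γ` with rows `(a, b)` and `(c, d)`. -/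
def matrixDelta (g : SL(2, ℝ)) : ℝ := 2 * |g 0 0 * g 1 1 + g 0 1 * g 1 0|

theorem matrixDelta_eq {Γ : Subgroup SL(2, ℝ)} {x y : Γ}
    (h : DoubleCoset.setoid (diagonalSubgroup Γ : Set Γ) (diagonalSubgroup Γ : Set Γ) x y) :
    matrixDelta (x : SL(2, ℝ)) = matrixDelta (y : SL(2, ℝ)) := by
  obtain ⟨a, ⟨ha, ha'⟩, b, ⟨hb, hb'⟩, rfl⟩ := DoubleCoset.rel_iff.mp h
  have da := Matrix.det_fin_two (a : SL(2, ℝ)).1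
  have db := Matrix.det_fin_two (b : SL(2, ℝ)).1
  rw [(a : SL(2, ℝ)).2] at da
  rw [(b : SL(2, ℝ)).2] at db
  simp only [matrixDelta, Subgroup.coe_mul, Matrix.SpecialLinearGroup.coe_mul, Matrix.mul_apply,
    Fin.sum_univ_two]
  congr 2
  rw [ha, ha', hb, hb']
  rw [ha] at da
  rw [hb] at db
  simp only [zero_mul, sub_zero] at da db
  linear_combination (exp := 1) ((x : SL(2, ℝ)) 0 0 * (x : SL(2, ℝ)) 1 1
    + (x : SL(2, ℝ)) 0 1 * (x : SL(2, ℝ)) 1 0) * (da + (a : SL(2, ℝ)) 0 0 * (a : SL(2, ℝ)) 1 1 * db)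

/-- `δ` as a function on double cosets. The trivial double coset `Γ₀` has `δ = 2`. -/
def delta (Γ : Subgroup SL(2, ℝ)) : DoubleCosets Γ → ℝ :=
  Quotient.lift (fun g : Γ => matrixDelta (g : SL(2, ℝ))) fun _ _ h => matrixDelta_eq h

end GeodesicPeriods

end

/-! The limit and the expansion come from a relative trace formula along `C` for the point-pair
invariant `k_s(z, w) = exp (- s cosh d(z, w))`, whose total mass over the half plane is `M(s) = (2π
/ s) exp (- s)`.

Spectral side. By Selberg's principle, convolution with `k_s` multiplies an eigenfunction by `h_n(s)
= 2 √(2π / s) K_{i r_n}(s)` (`integral_exp_neg_mul_coshDist_mul_eigen`). As functions of `s`, both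
the convolution and `s^(-1/2) K_{ir}(s)` solve one second order equation and decay at infinity, so
their Wronskian vanishes and they are proportional; the constant is read off as `s → ∞`, where `k_s
/ M(s)` concentrates at `z`. Integrating the automorphic sum of `k_s` over `C` gives a continuous
function on `X` whose coefficients are `h_n(s) P(φ_n)`. Parseval for two parameters `s, t`, divided
by `M(s)`, yields as `s → ∞` the formula `∑ h_n(t) |P(φ_n)|² = ∫_C geodesicKernel`
(`IsEigenbasis.tsum_besselK_mul`), because `|h_n(s)| ≤ M(s)` and `h_n(s) / M(s) → 1`. The passage to
the limit needs absolute convergence at the fixed `t`. It follows from the rapid decay of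
`K_{ir}(t)` in `r` together with polynomial growth of the periods in mean square, which Bessel's
inequality provides at parameters `s` comparable with `r²`, where `K_{ir}(s) ≥ K_0(s) / 2`
(`IsEigenbasis.summable_besselK_mul`).

Geometric side. For `γ` with entries `a, b, c, d`, `cosh d(i e^u, γ i e^v)` is a function of `u - v`
plus a function of `u + v` (`cosh_dist_axisPoint_smul`). Elements outside `Γ₀` have no zero entry,
so a nontrivial double coset is, up to sign, a free orbit of `Γ₀ × Γ₀` and unfolds `C × C` to the
plane; it contributes `2 K_0(t |ad|) K_0(t |bc|)`. The trivial double coset contributes `2 len(C)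
K_0(t)` (`IsSurfaceGroup.hasSum_doubleCosetTerm`).

Asymptotics. From `ad - bc = 1` it follows that `|ad| + |bc|` is `1` if `δ < 2` and `δ / 2` if `δ >
2`. With `K_0(x) = √(π / (2x)) exp (- x) (1 + O(1 / x))`, the trivial coset gives the leading term,
the finitely many cosets with `δ < 2` give the second one, and the others are exponentially smaller,
since the values `δ > 2` stay away from `2`. The expansion is obtained in `s` and then evaluated at
`s = 2t`. -/

open scoped MatrixGroups UpperHalfPlane InnerProductSpace

noncomputable section

namespace GeodesicPeriods

open MeasureTheory Filter Topology Set
section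

/-! ### Laplace transforms of measures -/

section Laplace

variable {α : Type*} [MeasurableSpace α] {μ : Measure α} {c : α → ℝ} {f : α → ℂ}

/-- The moments `∫ c ^ j exp (- s c) f dμ`. -/
def laplaceMoment (μ : Measure α) (c : α → ℝ) (f : α → ℂ) (j : ℕ) (s : ℝ) : ℂ :=
  ∫ a, (((c a) ^ j * Real.exp (-(s * c a)) : ℝ) : ℂ) * f a ∂μ

/-- Half of the exponent absorbs the power, by `y ^ j / j! ≤ exp y` at `y = s x / 2`. Hence all
moments are controlled by integrability of the plain exponentials. -/
theorem pow_mul_exp_neg_le (j : ℕ) {x s : ℝ} (hx : 0 ≤ x) (hs : 0 < s) :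
    x ^ j * Real.exp (-(s * x)) ≤ (j.factorial / (s / 2) ^ j) * Real.exp (-(s / 2 * x)) := by
  have h := Real.pow_div_factorial_le_exp (x := s / 2 * x) (by positivity) j
  have hj : (0 : ℝ) < j.factorial := by positivity
  have h2 : x ^ j ≤ j.factorial / (s / 2) ^ j * Real.exp (s / 2 * x) := by
    rw [div_le_iff₀ hj, mul_pow] at h
    rw [div_mul_eq_mul_div, le_div_iff₀ (by positivity)]
    linarith
  calc x ^ j * Real.exp (-(s * x))
      ≤ (j.factorial / (s / 2) ^ j * Real.exp (s / 2 * x)) * Real.exp (-(s * x)) := by gcongr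
    _ = _ := by
      rw [mul_assoc, ← Real.exp_add]
      congr 2
      ring

/-- Splitting `s = (s - 1) + 1` leaves the fixed parameter `1` for convergence and extracts uniform
decay in `s` wherever the exponent is at least `δ`. -/
theorem exp_neg_mul_le_of_one_le {s δ x : ℝ} (hs : 1 ≤ s) (hx : δ ≤ x) :
    Real.exp (-(s * x)) ≤ Real.exp (-((s - 1) * δ)) * Real.exp (-(1 * x)) := by
  rw [← Real.exp_add]
  apply Real.exp_le_exp.mpr
  nlinarith

variable (hcm : Measurable c) (hc : ∀ a, 1 ≤ c a)
  (hf : ∀ s : ℝ, 0 < s → Integrable (fun a => ((Real.exp (-(s * c a)) : ℝ) : ℂ) * f a) μ)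

-- The positive weight `exp (- c)` can be divided out of the integrand at `s = 1`.
include hcm hf in
theorem aestronglyMeasurable_of_laplace : AEStronglyMeasurable f μ := by
  have h := (hf 1 one_pos).aestronglyMeasurable
  have h2 : AEStronglyMeasurable (fun a => ((Real.exp (1 * c a) : ℝ) : ℂ)) μ := by
    have : Measurable fun a => ((Real.exp (1 * c a) : ℝ) : ℂ) := by fun_prop
    exact this.aestronglyMeasurable
  refine (h2.mul h).congr (Eventually.of_forall fun a => ?_)
  simp only [Pi.mul_apply]
  rw [← mul_assoc, ← Complex.ofReal_mul, ← Real.exp_add]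
  simp

include hcm hc hf in
theorem integrable_laplaceMoment (j : ℕ) {s : ℝ} (hs : 0 < s) :
    Integrable (fun a => (((c a) ^ j * Real.exp (-(s * c a)) : ℝ) : ℂ) * f a) μ := by
  have hfm := aestronglyMeasurable_of_laplace hcm hf
  refine Integrable.mono' ((hf (s / 2) (by positivity)).norm.const_mul
    (j.factorial / (s / 2) ^ j : ℝ)) ?_ (Eventually.of_forall fun a => ?_)
  · have : Measurable fun a => (((c a) ^ j * Real.exp (-(s * c a)) : ℝ) : ℂ) := by fun_prop
    exact this.aestronglyMeasurable.mul hfm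
  · have h0 : 0 ≤ c a := by linarith [hc a]
    rw [norm_mul, norm_mul, Complex.norm_real, Complex.norm_real, Real.norm_of_nonneg (by positivity),
      Real.norm_of_nonneg (by positivity), ← mul_assoc]
    exact mul_le_mul_of_nonneg_right (pow_mul_exp_neg_le j h0 hs) (norm_nonneg _)

include hcm hc hf in
theorem hasDerivAt_laplaceMoment (j : ℕ) {s : ℝ} (hs : 0 < s) :
    HasDerivAt (laplaceMoment μ c f j) (-laplaceMoment μ c f (j + 1) s) s := by
  have hfm := aestronglyMeasurable_of_laplace hcm hf
  have hm : ∀ (j : ℕ) (s : ℝ),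
      AEStronglyMeasurable (fun a => (((c a) ^ j * Real.exp (-(s * c a)) : ℝ) : ℂ) * f a) μ := by
    intro j s
    have : Measurable fun a => (((c a) ^ j * Real.exp (-(s * c a)) : ℝ) : ℂ) := by fun_prop
    exact this.aestronglyMeasurable.mul hfm
  -- On the neighbourhood `(s / 2, ∞)` of `s` the derivative is dominated by the next moment at `s /
  -- 2`.
  have key := hasDerivAt_integral_of_dominated_loc_of_deriv_le (μ := μ) (x₀ := s)
    (s := Ioi (s / 2)) (F := fun (s : ℝ) a => (((c a) ^ j * Real.exp (-(s * c a)) : ℝ) : ℂ) * f a)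
    (F' := fun (s : ℝ) a => -((((c a) ^ (j + 1) * Real.exp (-(s * c a)) : ℝ) : ℂ) * f a))
    (bound := fun a => ‖(((c a) ^ (j + 1) * Real.exp (-(s / 2 * c a)) : ℝ) : ℂ) * f a‖)
    (Ioi_mem_nhds (by linarith)) (Eventually.of_forall fun s => hm j s)
    (integrable_laplaceMoment hcm hc hf j hs) (hm (j + 1) s).neg
    (Eventually.of_forall fun a x hx => ?_)
    (integrable_laplaceMoment hcm hc hf (j + 1) (by positivity)).norm
    (Eventually.of_forall fun a x hx => ?_)
  · have := key.2
    rw [integral_neg] at this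
    exact this
  · have h0 : 0 ≤ c a := by linarith [hc a]
    have hx' : s / 2 < x := hx
    rw [norm_neg, norm_mul, norm_mul, Complex.norm_real, Complex.norm_real,
      Real.norm_of_nonneg (by positivity), Real.norm_of_nonneg (by positivity)]
    gcongr
  · have h1 : HasDerivAt (fun x : ℝ => (c a) ^ j * Real.exp (-(x * c a)))
        (-((c a) ^ (j + 1) * Real.exp (-(x * c a)))) x := by
      have := (((hasDerivAt_id x).mul_const (c a)).neg.exp).const_mul ((c a) ^ j)
      convert! this using 1
      simp only [id, Pi.neg_apply]
      ring
    have := h1.ofReal_comp.mul_const (f a)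
    convert! this using 1
    push_cast
    ring

-- Since `c ≥ 1`, passing from parameter `1` to `s` gains the factor `exp (1 - s)`.
include hcm hc hf in
theorem norm_laplaceMoment_le (j : ℕ) :
    ∃ C : ℝ, 0 ≤ C ∧ ∀ s : ℝ, 1 ≤ s → ‖laplaceMoment μ c f j s‖ ≤ C * Real.exp (-s) := by
  refine ⟨Real.exp 1 * ∫ a, ‖(((c a) ^ j * Real.exp (-(1 * c a)) : ℝ) : ℂ) * f a‖ ∂μ,
    by positivity, fun s hs => ?_⟩
  have hi := integrable_laplaceMoment hcm hc hf j one_pos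
  calc ‖laplaceMoment μ c f j s‖
      ≤ ∫ a, Real.exp (1 - s) * ‖(((c a) ^ j * Real.exp (-(1 * c a)) : ℝ) : ℂ) * f a‖ ∂μ := by
        refine norm_integral_le_of_norm_le (hi.norm.const_mul _)
          (Eventually.of_forall fun a => ?_)
        have h0 : 0 ≤ c a := by linarith [hc a]
        rw [norm_mul, norm_mul, Complex.norm_real, Complex.norm_real,
          Real.norm_of_nonneg (by positivity), Real.norm_of_nonneg (by positivity)]
        have := exp_neg_mul_le_of_one_le hs (hc a)
        rw [show -((s - 1) * 1) = 1 - s by ring] at this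
        calc c a ^ j * Real.exp (-(s * c a)) * ‖f a‖
            ≤ c a ^ j * (Real.exp (1 - s) * Real.exp (-(1 * c a))) * ‖f a‖ := by gcongr
          _ = _ := by ring
    _ = _ := by
        rw [integral_const_mul, sub_eq_add_neg, Real.exp_add]
        ring

/-- Concentration of the measures `exp (- s c) dμ` on the set where `c` is close to `1`. -/
theorem tendsto_laplaceMoment_div
    (hf : ∀ s : ℝ, 0 < s → Integrable (fun a => ((Real.exp (-(s * c a)) : ℝ) : ℂ) * f a) μ)
    (h1 : ∀ s : ℝ, 0 < s → Integrable (fun a => Real.exp (-(s * c a))) μ)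
    {κ : ℝ} (hκ : 0 < κ)
    (hM : ∀ s : ℝ, 1 ≤ s → κ / s * Real.exp (-s) ≤ ∫ a, Real.exp (-(s * c a)) ∂μ) {f₀ : ℂ}
    (hf₀ : ∀ ε : ℝ, 0 < ε → ∃ δ : ℝ, 0 < δ ∧ ∀ a, c a < 1 + δ → ‖f a - f₀‖ ≤ ε) :
    Tendsto (fun s => laplaceMoment μ c f 0 s / ((∫ a, Real.exp (-(s * c a)) ∂μ : ℝ) : ℂ))
      atTop (𝓝 f₀) := by
  set M : ℝ → ℝ := fun s => ∫ a, Real.exp (-(s * c a)) ∂μ with hMdef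
  have h1c : ∀ s : ℝ, 0 < s → Integrable (fun a => ((Real.exp (-(s * c a)) : ℝ) : ℂ)) μ :=
    fun s hs => (h1 s hs).ofReal
  have hg : ∀ s : ℝ, 0 < s →
      Integrable (fun a => ((Real.exp (-(s * c a)) : ℝ) : ℂ) * (f a - f₀)) μ := by
    intro s hs
    have := (hf s hs).sub ((h1c s hs).mul_const f₀)
    refine this.congr (Eventually.of_forall fun a => ?_)
    simp only [Pi.sub_apply]
    ring
  have hdiff : ∀ s : ℝ, 0 < s → laplaceMoment μ c f 0 s - f₀ * M s
      = ∫ a, ((Real.exp (-(s * c a)) : ℝ) : ℂ) * (f a - f₀) ∂μ := by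
    intro s hs
    have e1 : laplaceMoment μ c f 0 s = ∫ a, ((Real.exp (-(s * c a)) : ℝ) : ℂ) * f a ∂μ := by
      simp [laplaceMoment]
    have e2 : f₀ * M s = ∫ a, ((Real.exp (-(s * c a)) : ℝ) : ℂ) * f₀ ∂μ := by
      rw [integral_mul_const, integral_complex_ofReal, mul_comm]
    rw [e1, e2, ← integral_sub (hf s hs) ((h1c s hs).mul_const f₀)]
    simp only [mul_sub]
  rw [Metric.tendsto_atTop]
  intro ε hε
  obtain ⟨δ, hδ, hδ'⟩ := hf₀ (ε / 2) (by positivity)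
  set B : ℝ := ∫ a, ‖((Real.exp (-(1 * c a)) : ℝ) : ℂ) * (f a - f₀)‖ ∂μ with hB
  have hB0 : 0 ≤ B := by positivity
  -- The region `c ≥ 1 + δ` contributes at most `B exp (- (s - 1)(1 + δ))`; relative to the lower
  -- bound `(κ / s) exp (- s)` of the mass this is a constant times `s exp (- δ s)`.
  have hlim : Tendsto (fun s : ℝ => (Real.exp (1 + δ) * B / κ) * (s * Real.exp (-δ * s)))
      atTop (𝓝 0) := by
    have := (Real.tendsto_pow_mul_exp_neg_atTop_nhds_zero 1).comp
      (tendsto_id.const_mul_atTop hδ)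
    have h2 := this.const_mul (Real.exp (1 + δ) * B / κ * δ⁻¹)
    rw [mul_zero] at h2
    refine h2.congr fun s => ?_
    simp only [Function.comp, id, pow_one, neg_mul]
    field_simp
  obtain ⟨S, hS⟩ := (Metric.tendsto_atTop.mp hlim) (ε / 2) (by positivity)
  refine ⟨max S 1, fun s hs => ?_⟩
  have hs1 : 1 ≤ s := le_trans (le_max_right _ _) hs
  have hs0 : 0 < s := by linarith
  have hMs := hM s hs1
  have hMpos : 0 < M s := lt_of_lt_of_le (by positivity) hMs
  have hMc : ((M s : ℝ) : ℂ) ≠ 0 := by exact_mod_cast hMpos.ne'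
  have hnum : ‖laplaceMoment μ c f 0 s - f₀ * M s‖
      ≤ ε / 2 * M s + Real.exp (-((s - 1) * (1 + δ))) * B := by
    rw [hdiff s hs0]
    calc _ ≤ ∫ a, (ε / 2 * Real.exp (-(s * c a)) + Real.exp (-((s - 1) * (1 + δ))) *
            ‖((Real.exp (-(1 * c a)) : ℝ) : ℂ) * (f a - f₀)‖) ∂μ := by
          refine norm_integral_le_of_norm_le (((h1 s hs0).const_mul _).add
            ((hg 1 one_pos).norm.const_mul _)) (Eventually.of_forall fun a => ?_)
          rw [norm_mul, norm_mul, Complex.norm_real, Complex.norm_real,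
            Real.norm_of_nonneg (by positivity), Real.norm_of_nonneg (by positivity)]
          by_cases h : c a < 1 + δ
          · have := hδ' a h
            have h3 : 0 ≤ Real.exp (-((s - 1) * (1 + δ))) *
              (Real.exp (-(1 * c a)) * ‖f a - f₀‖) := by positivity
            have h4 : Real.exp (-(s * c a)) * ‖f a - f₀‖ ≤ Real.exp (-(s * c a)) * (ε / 2) := by
              gcongr
            linarith
          · have := exp_neg_mul_le_of_one_le hs1 (not_lt.mp h)
            have h3 : 0 ≤ ε / 2 * Real.exp (-(s * c a)) := by positivity
            have h4 : Real.exp (-(s * c a)) * ‖f a - f₀‖ ≤ (Real.exp (-((s - 1) * (1 + δ))) *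
              Real.exp (-(1 * c a))) * ‖f a - f₀‖ := by gcongr
            linarith
      _ = _ := by
          rw [integral_add ((h1 s hs0).const_mul _) ((hg 1 one_pos).norm.const_mul _),
            integral_const_mul, integral_const_mul]
  have hS' := hS s (le_trans (le_max_left _ _) hs)
  rw [Real.dist_0_eq_abs] at hS'
  have hS'' := lt_of_le_of_lt (le_abs_self _) hS'
  rw [dist_eq_norm, div_sub' hMc, norm_div, Complex.norm_real, Real.norm_of_nonneg hMpos.le,
    div_lt_iff₀ hMpos, mul_comm ((M s : ℝ) : ℂ)]
  have hlast : Real.exp (-((s - 1) * (1 + δ))) * B < ε / 2 * M s := by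
    have e : Real.exp (-((s - 1) * (1 + δ))) * B
        = (Real.exp (1 + δ) * B / κ * (s * Real.exp (-δ * s))) * (κ / s * Real.exp (-s)) := by
      rw [show -((s - 1) * (1 + δ)) = (1 + δ) + (-δ * s) + (-s) by ring, Real.exp_add, Real.exp_add]
      field_simp
    rw [e]
    calc _ < ε / 2 * (κ / s * Real.exp (-s)) := by
          apply mul_lt_mul_of_pos_right hS''; positivity
      _ ≤ _ := by gcongr
  linarith

end Laplace

end
section

/-! ### The `K`-Bessel function -/

theorem cosh_eq_one_add_two_mul_sinh_sq (u : ℝ) :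
    Real.cosh u = 1 + 2 * Real.sinh (u / 2) ^ 2 := by
  have h := Real.cosh_two_mul (u / 2)
  rw [Real.cosh_sq] at h
  rw [show u = 2 * (u / 2) by ring, h]
  ring_nf

theorem sq_le_sinh_sq (x : ℝ) : x ^ 2 ≤ Real.sinh x ^ 2 := by
  rw [sq_le_sq, Real.abs_sinh]
  exact Real.self_le_sinh_iff.mpr (abs_nonneg x)

theorem one_add_sq_div_two_le_cosh (u : ℝ) : 1 + u ^ 2 / 2 ≤ Real.cosh u := by
  rw [cosh_eq_one_add_two_mul_sinh_sq]
  nlinarith [sq_le_sinh_sq (u / 2)]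

theorem integrable_exp_cosh_mul_exp {s : ℝ} (hs : 0 < s) (σ : ℝ) :
    Integrable fun u : ℝ => Real.exp (-(s * Real.cosh u)) * Real.exp (σ * u) := by
  refine Integrable.mono' ((integrable_exp_neg_mul_sq (b := s / 4) (by positivity)).const_mul
    (Real.exp (σ ^ 2 / s))) (by fun_prop) (Eventually.of_forall fun u => ?_)
  rw [Real.norm_of_nonneg (by positivity), ← Real.exp_add, ← Real.exp_add]
  apply Real.exp_le_exp.mpr
  have h1 := mul_le_mul_of_nonneg_left (one_add_sq_div_two_le_cosh u) hs.le
  -- Completing the square leaves half of the Gaussian `exp (- s u² / 2)` that bounds `exp (- s cosh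
  -- u)`.
  have h2 : σ * u ≤ σ ^ 2 / s + s / 4 * u ^ 2 := by
    have : 0 ≤ (σ - s / 2 * u) ^ 2 / s := by positivity
    have e : (σ - s / 2 * u) ^ 2 / s = σ ^ 2 / s + s / 4 * u ^ 2 - σ * u := by
      field_simp
      ring
    linarith
  nlinarith

theorem integrable_exp_cosh {s : ℝ} (hs : 0 < s) :
    Integrable fun u : ℝ => Real.exp (-(s * Real.cosh u)) := by
  simpa using integrable_exp_cosh_mul_exp hs 0

theorem integrable_exp_cosh_mul_cexp (ν : ℂ) (s : ℝ) (hs : 0 < s) :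
    Integrable fun u : ℝ => ((Real.exp (-(s * Real.cosh u)) : ℝ) : ℂ) * Complex.exp (ν * u) := by
  refine Integrable.mono' (integrable_exp_cosh_mul_exp hs ν.re) ?_
    (Eventually.of_forall fun u => ?_)
  · exact Continuous.aestronglyMeasurable (by fun_prop)
  · rw [norm_mul, Complex.norm_real, Real.norm_of_nonneg (by positivity), Complex.norm_exp]
    simp

theorem besselK_eq_laplaceMoment (ν : ℂ) (x : ℝ) :
    besselK ν x = (1 / 2 : ℂ) * laplaceMoment volume Real.cosh (fun u => Complex.exp (ν * u)) 0 x := by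
  simp [besselK, laplaceMoment]

theorem integrable_besselK_moment (ν : ℂ) (j : ℕ) {s : ℝ} (hs : 0 < s) :
    Integrable fun u : ℝ => (((Real.cosh u) ^ j * Real.exp (-(s * Real.cosh u)) : ℝ) : ℂ) *
      Complex.exp (ν * u) :=
  integrable_laplaceMoment Real.continuous_cosh.measurable Real.one_le_cosh
    (integrable_exp_cosh_mul_cexp ν) j hs

theorem hasDerivAt_besselK_moment (ν : ℂ) (j : ℕ) {s : ℝ} (hs : 0 < s) :
    HasDerivAt (laplaceMoment volume Real.cosh (fun u : ℝ => Complex.exp (ν * u)) j)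
      (-laplaceMoment volume Real.cosh (fun u : ℝ => Complex.exp (ν * u)) (j + 1) s) s :=
  hasDerivAt_laplaceMoment Real.continuous_cosh.measurable Real.one_le_cosh
    (integrable_exp_cosh_mul_cexp ν) j hs

theorem hasDerivAt_exp_cosh_mul_cexp (ν : ℂ) (s u : ℝ) :
    HasDerivAt (fun u : ℝ => ((Real.exp (-(s * Real.cosh u)) : ℝ) : ℂ) * Complex.exp (ν * u))
      ((-s * Real.sinh u + ν) *
        (((Real.exp (-(s * Real.cosh u)) : ℝ) : ℂ) * Complex.exp (ν * u))) u := by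
  have h1 : HasDerivAt (fun u : ℝ => Real.exp (-(s * Real.cosh u)))
      (Real.exp (-(s * Real.cosh u)) * (-(s * Real.sinh u))) u :=
    (((Real.hasDerivAt_cosh u).const_mul s).neg).exp
  have h2 : HasDerivAt (fun u : ℝ => Complex.exp (ν * u)) (Complex.exp (ν * u) * ν) u := by
    have := ((Complex.ofRealCLM.hasDerivAt (x := u)).const_mul ν).cexp
    simpa using this
  convert! h1.ofReal_comp.mul h2 using 1
  push_cast
  ring

theorem abs_sinh_le_cosh (u : ℝ) : |Real.sinh u| ≤ Real.cosh u := by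
  rw [abs_le]
  constructor
  · have := Real.cosh_add_sinh u
    linarith [Real.exp_pos u]
  · have := Real.cosh_sub_sinh u
    linarith [Real.exp_pos (-u)]

theorem integrable_sinh_mul (ν : ℂ) {s : ℝ} (hs : 0 < s) :
    Integrable fun u : ℝ => ((Real.sinh u : ℝ) : ℂ) *
      (((Real.exp (-(s * Real.cosh u)) : ℝ) : ℂ) * Complex.exp (ν * u)) := by
  refine Integrable.mono (integrable_besselK_moment ν 1 hs)
    (Continuous.aestronglyMeasurable (by fun_prop)) (Eventually.of_forall fun u => ?_)
  rw [← mul_assoc, norm_mul, norm_mul (_ : ℂ) (Complex.exp _), ← Complex.ofReal_mul,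
    Complex.norm_real, Complex.norm_real, norm_mul, norm_mul, pow_one]
  gcongr
  rw [Real.norm_eq_abs, Real.norm_eq_abs]
  exact (abs_sinh_le_cosh u).trans (le_abs_self _)

/-- The Bessel equation `s² K'' + s K' = (s² + ν²) K`, in terms of moments. -/
theorem besselK_moment_equation (ν : ℂ) {s : ℝ} (hs : 0 < s) :
    (s : ℂ) ^ 2 * laplaceMoment volume Real.cosh (fun u : ℝ => Complex.exp (ν * u)) 2 s
      - s * laplaceMoment volume Real.cosh (fun u : ℝ => Complex.exp (ν * u)) 1 s
      = (s ^ 2 + ν ^ 2) * laplaceMoment volume Real.cosh (fun u : ℝ => Complex.exp (ν * u)) 0 s := by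
  set E : ℝ → ℂ := fun u =>
    ((Real.exp (-(s * Real.cosh u)) : ℝ) : ℂ) * Complex.exp (ν * u) with hE
  have hi0 := integrable_besselK_moment ν 0 hs
  have hi1 := integrable_besselK_moment ν 1 hs
  have hi2 := integrable_besselK_moment ν 2 hs
  -- The difference of the two sides is the integral of a total derivative, because `(- s sinh u -
  -- ν)(- s sinh u + ν) = s² cosh² u - s² - ν²`.
  have hderiv : ∀ u : ℝ, HasDerivAt (fun u : ℝ => (-s * Real.sinh u - ν) * E u)
      ((s : ℂ) ^ 2 * ((((Real.cosh u) ^ 2 * Real.exp (-(s * Real.cosh u)) : ℝ) : ℂ) *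
        Complex.exp (ν * u)) - s * ((((Real.cosh u) ^ 1 * Real.exp (-(s * Real.cosh u)) : ℝ) : ℂ) *
        Complex.exp (ν * u)) - (s ^ 2 + ν ^ 2) *
        ((((Real.cosh u) ^ 0 * Real.exp (-(s * Real.cosh u)) : ℝ) : ℂ) *
        Complex.exp (ν * u))) u := by
    intro u
    have h1 : HasDerivAt (fun u : ℝ => (-s * Real.sinh u - ν : ℂ)) (-s * Real.cosh u) u := by
      have := ((Real.hasDerivAt_sinh u).ofReal_comp.const_mul (-s : ℂ)).sub_const ν
      exact this
    convert! h1.mul (hasDerivAt_exp_cosh_mul_cexp ν s u) using 1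
    have h2 : ((Real.cosh u : ℝ) : ℂ) ^ 2 = ((Real.sinh u : ℝ) : ℂ) ^ 2 + 1 := by
      exact_mod_cast Real.cosh_sq u
    push_cast at h2 ⊢
    rw [h2]
    ring
  have hint := integral_eq_zero_of_hasDerivAt_of_integrable hderiv
    (((hi2.const_mul _).sub (hi1.const_mul _)).sub (hi0.const_mul _)) (by
      have := ((integrable_sinh_mul ν hs).const_mul (-s : ℂ)).sub
        ((integrable_exp_cosh_mul_cexp ν s hs).const_mul ν)
      refine this.congr (Eventually.of_forall fun u => ?_)
      simp only [Pi.sub_apply, hE]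
      ring)
  have h21 := (hi2.const_mul ((s : ℂ) ^ 2)).sub (hi1.const_mul (s : ℂ))
  simp only [Pi.sub_def] at h21
  rw [integral_sub h21 (hi0.const_mul _),
    integral_sub (hi2.const_mul _) (hi1.const_mul _), integral_const_mul, integral_const_mul,
    integral_const_mul, sub_eq_zero] at hint
  exact hint

/-- The derivative of `exp (- s cosh u + ν u)` has integral zero, and `sinh u` shifts `ν` by `± 1`.
The factor `ν` on the left is what produces decay in `Im ν`. -/
theorem besselK_recurrence (ν : ℂ) {s : ℝ} (hs : 0 < s) :
    ν * besselK ν s = (s / 2 : ℂ) * (besselK (ν + 1) s - besselK (ν - 1) s) := by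
  have hi := integrable_exp_cosh_mul_cexp ν s hs
  have hint := integral_eq_zero_of_hasDerivAt_of_integrable
    (fun u => hasDerivAt_exp_cosh_mul_cexp ν s u) (by
      have := ((integrable_sinh_mul ν hs).const_mul (-s : ℂ)).add (hi.const_mul ν)
      refine this.congr (Eventually.of_forall fun u => ?_)
      simp only [Pi.add_apply]
      ring) hi
  have e : ∀ u : ℝ, (-s * Real.sinh u + ν) *
        (((Real.exp (-(s * Real.cosh u)) : ℝ) : ℂ) * Complex.exp (ν * u)) =
      ν * (((Real.exp (-(s * Real.cosh u)) : ℝ) : ℂ) * Complex.exp (ν * u)) - (s / 2 : ℂ) *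
        ((((Real.exp (-(s * Real.cosh u)) : ℝ) : ℂ) * Complex.exp ((ν + 1) * u)) -
        (((Real.exp (-(s * Real.cosh u)) : ℝ) : ℂ) * Complex.exp ((ν - 1) * u))) := by
    intro u
    rw [add_mul ν, sub_mul ν, one_mul, Complex.exp_add, Complex.exp_sub, div_eq_mul_inv _ (Complex.exp u),
      ← Complex.exp_neg]
    push_cast
    rw [Complex.sinh]
    ring
  have hp := integrable_exp_cosh_mul_cexp (ν + 1) s hs
  have hm := integrable_exp_cosh_mul_cexp (ν - 1) s hs
  have hpm := (hp.sub hm).const_mul (s / 2 : ℂ)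
  simp only [Pi.sub_def] at hpm
  rw [integral_congr_ae (Eventually.of_forall e), integral_sub (hi.const_mul _) hpm, integral_const_mul, integral_const_mul, integral_sub hp hm,
    sub_eq_zero] at hint
  have e2 : ∀ ν : ℂ, besselK ν s = (1 / 2 : ℂ) *
      ∫ u : ℝ, ((Real.exp (-(s * Real.cosh u)) : ℝ) : ℂ) * Complex.exp (ν * u) := by
    intro ν
    simp [besselK]
  rw [e2, e2, e2, mul_left_comm, hint]
  ring

theorem norm_besselK_le_integral (ν : ℂ) {t : ℝ} (ht : 0 < t) :
    ‖besselK ν t‖ ≤ 1 / 2 * ∫ u : ℝ, Real.exp (-(t * Real.cosh u)) * Real.exp (ν.re * u) := by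
  rw [besselK, norm_mul]
  have : ‖(1 / 2 : ℂ)‖ = 1 / 2 := by norm_num
  rw [this]
  gcongr
  refine norm_integral_le_of_norm_le (integrable_exp_cosh_mul_exp ht ν.re)
    (Eventually.of_forall fun u => ?_)
  rw [norm_mul, Complex.norm_exp, Complex.norm_exp]
  simp

/-- Uniformity in the strip comes from `exp (σ u) ≤ exp (R u) + exp (- R u)` for `|σ| ≤ R`. -/
theorem exists_norm_besselK_le {t : ℝ} (ht : 0 < t) (R : ℝ) :
    ∃ C : ℝ, ∀ ν : ℂ, |ν.re| ≤ R → ‖besselK ν t‖ ≤ C := by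
  have h1 := integrable_exp_cosh_mul_exp ht R
  have h2 := integrable_exp_cosh_mul_exp ht (-R)
  refine ⟨1 / 2 * ((∫ u : ℝ, Real.exp (-(t * Real.cosh u)) * Real.exp (R * u)) +
    ∫ u : ℝ, Real.exp (-(t * Real.cosh u)) * Real.exp (-R * u)), fun ν hν => ?_⟩
  refine (norm_besselK_le_integral ν ht).trans ?_
  rw [← integral_add h1 h2]
  gcongr ?_ * ?_
  refine integral_mono (integrable_exp_cosh_mul_exp ht ν.re) (h1.add h2) fun u => ?_
  rw [← mul_add]
  gcongr
  have hR : 0 ≤ R := (abs_nonneg _).trans hν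
  rw [abs_le] at hν
  rcases le_total 0 u with hu | hu
  · have : Real.exp (ν.re * u) ≤ Real.exp (R * u) := by
      apply Real.exp_le_exp.mpr; nlinarith
    linarith [Real.exp_pos (-R * u)]
  · have : Real.exp (ν.re * u) ≤ Real.exp (-R * u) := by
      apply Real.exp_le_exp.mpr; nlinarith
    linarith [Real.exp_pos (R * u)]

/-- Rapid decay of `K_ν(t)` as `Im ν → ∞` in vertical strips. -/
theorem exists_im_pow_mul_norm_besselK_le {t : ℝ} (ht : 0 < t) (N : ℕ) :
    ∀ R : ℝ, ∃ C : ℝ, ∀ ν : ℂ, |ν.re| ≤ R → |ν.im| ^ N * ‖besselK ν t‖ ≤ C := by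
  induction N with
  | zero => simpa using exists_norm_besselK_le ht
  | succ N ih =>
    intro R
    -- The recurrence pays for a factor `|ν|` with the shifts `ν ± 1`, so the induction hypothesis
    -- is needed on a wider strip.
    obtain ⟨C, hC⟩ := ih (R + 1)
    refine ⟨t / 2 * (C + C), fun ν hν => ?_⟩
    have h := congrArg norm (besselK_recurrence ν ht)
    rw [norm_mul, norm_mul] at h
    have h2 : ‖(t / 2 : ℂ)‖ = t / 2 := by
      rw [norm_div, Complex.norm_real, Real.norm_of_nonneg ht.le]
      simp
    rw [h2] at h
    have hp := hC (ν + 1) (by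
      rw [Complex.add_re, Complex.one_re]
      exact (abs_add_le _ _).trans (by simpa using hν))
    have hm := hC (ν - 1) (by
      rw [Complex.sub_re, Complex.one_re]
      exact (abs_sub _ _).trans (by simpa using hν))
    rw [Complex.add_im, Complex.one_im, add_zero] at hp
    rw [Complex.sub_im, Complex.one_im, sub_zero] at hm
    calc |ν.im| ^ (N + 1) * ‖besselK ν t‖ = |ν.im| ^ N * (|ν.im| * ‖besselK ν t‖) := by ring
      _ ≤ |ν.im| ^ N * (‖ν‖ * ‖besselK ν t‖) := by
          gcongr
          exact Complex.abs_im_le_norm ν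
      _ ≤ |ν.im| ^ N * (t / 2 * (‖besselK (ν + 1) t‖ + ‖besselK (ν - 1) t‖)) := by
          rw [h]
          gcongr
          exact norm_sub_le _ _
      _ = t / 2 * (|ν.im| ^ N * ‖besselK (ν + 1) t‖ + |ν.im| ^ N * ‖besselK (ν - 1) t‖) := by ring
      _ ≤ _ := by gcongr

end
-- Asymptotics of `K_0` and `K_ν` at infinity; reality and lower bounds of `K_{ir}`.
section

/-- The function `K_0` with real values. -/
def besselK₀ (s : ℝ) : ℝ := 1 / 2 * ∫ u : ℝ, Real.exp (-(s * Real.cosh u))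

theorem image_sinh_half : (fun u : ℝ => Real.sinh (u / 2)) '' univ = univ := by
  rw [image_univ, range_eq_univ]
  intro y
  exact ⟨2 * Real.arsinh y, by simp⟩

theorem hasDerivAt_sinh_half (u : ℝ) :
    HasDerivAt (fun u : ℝ => Real.sinh (u / 2)) (Real.cosh (u / 2) / 2) u := by
  have := ((hasDerivAt_id u).div_const 2).sinh
  simpa [div_eq_mul_inv] using this

theorem integral_comp_sinh_half (g : ℝ → ℝ) :
    ∫ w, g w = ∫ u, Real.cosh (u / 2) / 2 * g (Real.sinh (u / 2)) := by
  have h := integral_image_eq_integral_abs_deriv_smul (s := univ)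
    (f := fun u : ℝ => Real.sinh (u / 2)) MeasurableSet.univ
    (fun u _ => (hasDerivAt_sinh_half u).hasDerivWithinAt)
    (fun a _ b _ hab => by have := Real.sinh_injective hab; linarith) g
  rw [image_sinh_half] at h
  simpa [abs_of_pos (half_pos (Real.cosh_pos _))] using h

theorem integrable_comp_sinh_half {g : ℝ → ℝ} (hg : Integrable g) :
    Integrable fun u => Real.cosh (u / 2) / 2 * g (Real.sinh (u / 2)) := by
  have h := (integrableOn_image_iff_integrableOn_abs_deriv_smul (s := univ)
    (f := fun u : ℝ => Real.sinh (u / 2)) MeasurableSet.univ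
    (fun u _ => (hasDerivAt_sinh_half u).hasDerivWithinAt)
    (fun a _ b _ hab => by have := Real.sinh_injective hab; linarith) g).mp
    (by rw [image_sinh_half]; exact hg.integrableOn)
  simpa [abs_of_pos (half_pos (Real.cosh_pos _))] using h

theorem integrable_sq_mul_gaussian {b : ℝ} (hb : 0 < b) :
    Integrable fun w : ℝ => w ^ 2 * Real.exp (-b * w ^ 2) := by
  simpa using integrable_rpow_mul_exp_neg_mul_sq hb (s := 2) (by norm_num)

theorem integral_sq_mul_gaussian {b : ℝ} (hb : 0 < b) :
    ∫ w : ℝ, w ^ 2 * Real.exp (-b * w ^ 2) = 1 / (2 * b) * √(Real.pi / b) := by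
  have h0 := integrable_exp_neg_mul_sq hb
  have h2 := integrable_sq_mul_gaussian hb
  have hint := integral_eq_zero_of_hasDerivAt_of_integrable
    (f := fun w : ℝ => w * Real.exp (-b * w ^ 2))
    (f' := fun w => Real.exp (-b * w ^ 2) - 2 * b * (w ^ 2 * Real.exp (-b * w ^ 2)))
    (fun w => by
      have := (hasDerivAt_id w).mul (((hasDerivAt_pow 2 w).const_mul (-b)).exp)
      convert! this using 1
      simp
      ring)
    (h0.sub (h2.const_mul _)) (integrable_mul_exp_neg_mul_sq hb)
  rw [integral_sub h0 (h2.const_mul _), integral_const_mul, integral_gaussian] at hint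
  rw [one_div_mul_eq_div, eq_div_iff (by positivity)]
  linarith

theorem exp_mul_two_mul_besselK₀ (s : ℝ) :
    Real.exp s * (2 * besselK₀ s) = ∫ u : ℝ, Real.exp (-(s * (Real.cosh u - 1))) := by
  rw [besselK₀, ← mul_assoc 2, mul_one_div_cancel two_ne_zero, one_mul, ← integral_const_mul]
  congr 1
  ext u
  rw [← Real.exp_add]
  ring_nf

theorem integrable_exp_cosh_sub_one {s : ℝ} (hs : 0 < s) :
    Integrable fun u : ℝ => Real.exp (-(s * (Real.cosh u - 1))) := by
  refine ((integrable_exp_cosh hs).const_mul (Real.exp s)).congr (Eventually.of_forall fun u => ?_)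
  simp only
  rw [← Real.exp_add]
  ring_nf

theorem sqrt_two_pi_div (s : ℝ) : √(2 * Real.pi / s) = 2 * √(Real.pi / (2 * s)) := by
  rw [show 2 * Real.pi / s = 2 ^ 2 * (Real.pi / (2 * s)) by field_simp,
    Real.sqrt_mul (by norm_num), Real.sqrt_sq (by norm_num)]

/-- The change of variables `w = sinh (u / 2)` makes this integral Gaussian. -/
theorem integral_exp_cosh_sub_one_mul_cosh_half (s : ℝ) :
    ∫ u : ℝ, Real.exp (-(s * (Real.cosh u - 1))) * Real.cosh (u / 2) = √(2 * Real.pi / s) := by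
  have h := integral_comp_sinh_half fun w => 2 * Real.exp (-(2 * s) * w ^ 2)
  rw [integral_const_mul, integral_gaussian] at h
  rw [sqrt_two_pi_div, h]
  congr 1
  ext u
  rw [cosh_eq_one_add_two_mul_sinh_sq u]
  ring_nf

theorem integrable_exp_cosh_sub_one_mul_cosh_half {s : ℝ} (hs : 0 < s) :
    Integrable fun u : ℝ => Real.exp (-(s * (Real.cosh u - 1))) * Real.cosh (u / 2) := by
  have h := integrable_comp_sinh_half
    ((integrable_exp_neg_mul_sq (b := 2 * s) (by positivity)).const_mul 2)
  refine h.congr (Eventually.of_forall fun u => ?_)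
  simp only
  rw [cosh_eq_one_add_two_mul_sinh_sq u]
  ring_nf

/-- Inserting the factor `cosh (u / 2) ≥ 1` only increases the integral and makes it Gaussian. -/
theorem exp_mul_besselK₀_le {s : ℝ} (hs : 0 < s) :
    Real.exp s * (2 * besselK₀ s) ≤ √(2 * Real.pi / s) := by
  rw [exp_mul_two_mul_besselK₀, ← integral_exp_cosh_sub_one_mul_cosh_half]
  refine integral_mono (integrable_exp_cosh_sub_one hs)
    (integrable_exp_cosh_sub_one_mul_cosh_half hs) fun u => ?_
  exact le_mul_of_one_le_right (Real.exp_pos _).le (Real.one_le_cosh _)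

/-- The loss in the upper bound is the integral with `cosh (u / 2) - 1` in place of `1`. In the
variable `w = sinh (u / 2)` it is at most the second Gaussian moment, which is the upper bound times
`1 / (8 s)`. -/
theorem le_exp_mul_besselK₀ {s : ℝ} (hs : 0 < s) :
    √(2 * Real.pi / s) * (1 - 1 / (8 * s)) ≤ Real.exp s * (2 * besselK₀ s) := by
  have hi := integrable_comp_sinh_half (integrable_sq_mul_gaussian (b := 2 * s) (by positivity))
  have h2 := integral_comp_sinh_half fun w => w ^ 2 * Real.exp (-(2 * s) * w ^ 2)
  rw [integral_sq_mul_gaussian (by positivity)] at h2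
  have h3 : √(2 * Real.pi / s) - Real.exp s * (2 * besselK₀ s)
      ≤ ∫ u : ℝ, Real.cosh (u / 2) / 2 *
        (Real.sinh (u / 2) ^ 2 * Real.exp (-(2 * s) * Real.sinh (u / 2) ^ 2)) := by
    rw [exp_mul_two_mul_besselK₀, ← integral_exp_cosh_sub_one_mul_cosh_half,
      ← integral_sub (integrable_exp_cosh_sub_one_mul_cosh_half hs)
        (integrable_exp_cosh_sub_one hs)]
    refine integral_mono ((integrable_exp_cosh_sub_one_mul_cosh_half hs).sub
        (integrable_exp_cosh_sub_one hs)) hi fun u => ?_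
    have e : Real.exp (-(s * (Real.cosh u - 1))) = Real.exp (-(2 * s) * Real.sinh (u / 2) ^ 2) := by
      rw [cosh_eq_one_add_two_mul_sinh_sq u]
      ring_nf
    -- With `x = cosh (u / 2) - 1 ≥ 0` and `sinh² = cosh² - 1` this is `x ≤ x (1 + x)(2 + x) / 2`.
    have h4 : Real.cosh (u / 2) - 1 ≤ Real.cosh (u / 2) / 2 * Real.sinh (u / 2) ^ 2 := by
      have a1 := cosh_eq_one_add_two_mul_sinh_sq (u / 2)
      have a2 := Real.one_le_cosh (u / 2)
      have a3 : Real.sinh (u / 2) ^ 2 = Real.cosh (u / 2) ^ 2 - 1 := by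
        rw [Real.cosh_sq]; ring
      rw [a3]
      nlinarith [mul_nonneg (sub_nonneg.mpr a2) (sub_nonneg.mpr a2),
        mul_nonneg (mul_nonneg (sub_nonneg.mpr a2) (sub_nonneg.mpr a2)) (sub_nonneg.mpr a2)]
    simp only [e]
    have := mul_le_mul_of_nonneg_left h4 (Real.exp_pos (-(2 * s) * Real.sinh (u / 2) ^ 2)).le
    linarith
  rw [← h2] at h3
  have h5 : √(2 * Real.pi / s) * (1 / (8 * s)) = 1 / (2 * (2 * s)) * √(Real.pi / (2 * s)) := by
    rw [sqrt_two_pi_div]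
    field_simp
    ring
  linarith

theorem besselK₀_pos {s : ℝ} (hs : 0 < s) : 0 < besselK₀ s := by
  rw [besselK₀]
  have : 0 < ∫ u : ℝ, Real.exp (-(s * Real.cosh u)) :=
    integral_exp_pos (integrable_exp_cosh hs)
  positivity

theorem besselK₀_anti {s t : ℝ} (hs : 0 < s) (hst : s ≤ t) : besselK₀ t ≤ besselK₀ s := by
  rw [besselK₀, besselK₀]
  gcongr ?_ * ?_
  refine integral_mono (integrable_exp_cosh (hs.trans_le hst)) (integrable_exp_cosh hs) fun u => ?_
  have := Real.cosh_pos u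
  simp only
  gcongr

theorem sqrt_mul_exp_mul_besselK₀_tendsto :
    Tendsto (fun s : ℝ => √s * Real.exp s * besselK₀ s) atTop (𝓝 √(Real.pi / 2)) := by
  have e : ∀ s : ℝ, 0 < s → √s * √(2 * Real.pi / s) = 2 * √(Real.pi / 2) := by
    intro s hs
    rw [sqrt_two_pi_div, mul_left_comm, ← Real.sqrt_mul hs.le]
    congr 2
    field_simp
  have h1 : Tendsto (fun s : ℝ => √(Real.pi / 2) * (1 - 1 / (8 * s))) atTop (𝓝 √(Real.pi / 2)) := by
    have : Tendsto (fun s : ℝ => 1 / (8 * s)) atTop (𝓝 0) :=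
      tendsto_const_nhds.div_atTop (tendsto_id.const_mul_atTop (by norm_num))
    simpa using (this.const_sub 1).const_mul √(Real.pi / 2)
  refine tendsto_of_tendsto_of_tendsto_of_le_of_le' h1 tendsto_const_nhds ?_ ?_
  · filter_upwards [eventually_gt_atTop 0] with s hs
    have := mul_le_mul_of_nonneg_left (le_exp_mul_besselK₀ hs) (Real.sqrt_nonneg s)
    rw [← mul_assoc, e s hs] at this
    linarith
  · filter_upwards [eventually_gt_atTop 0] with s hs
    have := mul_le_mul_of_nonneg_left (exp_mul_besselK₀_le hs) (Real.sqrt_nonneg s)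
    rw [e s hs] at this
    linarith

/-- A crude bound with explicit constants. It is the mass bound in the concentration argument for
`K_ν / K_0`, and it makes the sum over the spectrum converge. -/
theorem exp_neg_le_besselK₀ {s : ℝ} (hs : 1 ≤ s) : 1 / (2 * s) * Real.exp (-s) ≤ besselK₀ s := by
  have hs0 : 0 < s := by linarith
  have h := le_exp_mul_besselK₀ hs0
  have h1 : 2 / s ≤ √(2 * Real.pi / s) := by
    apply Real.le_sqrt_of_sq_le
    rw [div_pow, div_le_div_iff₀ (by positivity) hs0]
    have := Real.pi_gt_three
    nlinarith [mul_le_mul_of_nonneg_right hs hs0.le]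
  have h2 : (1 : ℝ) / 2 ≤ 1 - 1 / (8 * s) := by
    have : 1 / (8 * s) ≤ 1 / 2 := by
      rw [div_le_div_iff₀ (by positivity) (by norm_num)]
      linarith
    linarith
  have h3 : 2 / s * (1 / 2) ≤ Real.exp s * (2 * besselK₀ s) :=
    (mul_le_mul h1 h2 (by norm_num) (by positivity)).trans h
  have h4 := mul_le_mul_of_nonneg_left h3 (Real.exp_pos (-s)).le
  rw [← mul_assoc (Real.exp (-s)) (Real.exp s), ← Real.exp_add, neg_add_cancel, Real.exp_zero] at h4
  have e : Real.exp (-s) * (2 / s * (1 / 2)) = 2 * (1 / (2 * s) * Real.exp (-s)) := by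
    field_simp
  linarith

/-- The measures `exp (- s cosh u) du` concentrate at `u = 0`, where `exp (ν u) = 1`; the leading
asymptotics thus do not depend on `ν`. -/
theorem tendsto_besselK_div_besselK₀ (ν : ℂ) :
    Tendsto (fun s : ℝ => besselK ν s / (besselK₀ s : ℂ)) atTop (𝓝 1) := by
  have h := tendsto_laplaceMoment_div (μ := volume) (c := Real.cosh)
    (f := fun u : ℝ => Complex.exp (ν * u))
    (integrable_exp_cosh_mul_cexp ν) (fun s hs => integrable_exp_cosh hs) one_pos
    (fun s hs => by
      have h1 := exp_neg_le_besselK₀ hs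
      have h2 : (1 : ℝ) / (2 * s) * Real.exp (-s) = 1 / 2 * (1 / s * Real.exp (-s)) := by
        have : s ≠ 0 := by linarith
        field_simp
      rw [h2, besselK₀] at h1
      linarith) (f₀ := 1) (fun ε hε => by
      have hcont : Continuous fun u : ℝ => Complex.exp (ν * u) := by fun_prop
      obtain ⟨d, hd, hd'⟩ := Metric.continuousAt_iff.mp (hcont.continuousAt (x := 0)) ε hε
      -- `cosh u < 1 + d² / 2` forces `|u| < d`, by `cosh u ≥ 1 + u² / 2`.
      refine ⟨d ^ 2 / 2, by positivity, fun u hu => ?_⟩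
      have h1 := one_add_sq_div_two_le_cosh u
      have h2 : |u| < d := abs_lt_of_sq_lt_sq (by linarith) hd.le
      have := hd' (x := u) (by simpa using h2)
      simp only [Complex.ofReal_zero, mul_zero, Complex.exp_zero] at this
      rw [dist_eq_norm] at this
      exact this.le)
  refine h.congr fun s => ?_
  rw [besselK_eq_laplaceMoment, besselK₀, Complex.ofReal_mul, mul_div_mul_comm]
  norm_num

theorem sqrt_mul_exp_mul_besselK_tendsto (ν : ℂ) :
    Tendsto (fun s : ℝ => ((√s * Real.exp s : ℝ) : ℂ) * besselK ν s) atTop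
      (𝓝 ((√(Real.pi / 2) : ℝ) : ℂ)) := by
  have h1 := (Complex.continuous_ofReal.tendsto _).comp sqrt_mul_exp_mul_besselK₀_tendsto
  have h2 := h1.mul (tendsto_besselK_div_besselK₀ ν)
  rw [mul_one] at h2
  refine h2.congr' ?_
  filter_upwards [eventually_gt_atTop 0] with s hs
  have : (besselK₀ s : ℂ) ≠ 0 := by exact_mod_cast (besselK₀_pos hs).ne'
  simp only [Function.comp]
  push_cast
  field_simp

theorem besselK_neg (ν : ℂ) (s : ℝ) : besselK (-ν) s = besselK ν s := by
  rw [besselK, besselK, ← integral_neg_eq_self]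
  simp

theorem conj_besselK (ν : ℂ) (s : ℝ) :
    (starRingEnd ℂ) (besselK ν s) = besselK ((starRingEnd ℂ) ν) s := by
  rw [besselK, besselK, map_mul, ← integral_conj]
  simp [← Complex.exp_conj, ← Complex.cosh_conj]
  exact Or.inl (map_ofNat _ 2)

/-- Integrating the derivative of `u exp (- s cosh u)` gives `∫ exp (- s cosh u) = s ∫ u sinh u exp
(- s cosh u)`, and `u sinh u ≥ u²`. -/
theorem integral_sq_mul_exp_cosh_le {s : ℝ} (hs : 0 < s) :
    Integrable (fun u : ℝ => u ^ 2 * Real.exp (-(s * Real.cosh u))) ∧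
      ∫ u : ℝ, u ^ 2 * Real.exp (-(s * Real.cosh u)) ≤ 2 * besselK₀ s / s := by
  have hc : ∀ s u : ℝ, 0 < s → Real.exp (-(s * Real.cosh u)) ≤ Real.exp (-(s / 2) * u ^ 2) := by
    intro s u hs
    apply Real.exp_le_exp.mpr
    nlinarith [mul_le_mul_of_nonneg_left (one_add_sq_div_two_le_cosh u) hs.le]
  have h2 : Integrable (fun u : ℝ => u ^ 2 * Real.exp (-(s * Real.cosh u))) := by
    refine Integrable.mono' (integrable_sq_mul_gaussian (b := s / 2) (by positivity))
      (by fun_prop) (Eventually.of_forall fun u => ?_)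
    rw [Real.norm_of_nonneg (by positivity)]
    exact mul_le_mul_of_nonneg_left (hc s u hs) (by positivity)
  have h1 : Integrable (fun u : ℝ => u * Real.exp (-(s * Real.cosh u))) := by
    refine Integrable.mono (integrable_mul_exp_neg_mul_sq (b := s / 2) (by positivity))
      (by fun_prop) (Eventually.of_forall fun u => ?_)
    rw [norm_mul, norm_mul]
    gcongr
    rw [Real.norm_of_nonneg (by positivity), Real.norm_of_nonneg (by positivity)]
    exact hc s u hs
  have h3 : Integrable (fun u : ℝ => u * Real.sinh u * Real.exp (-(s * Real.cosh u))) := by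
    have hb : Integrable fun u : ℝ => Real.cosh u ^ 2 * Real.exp (-(s * Real.cosh u)) := by
      have := (integrable_besselK_moment 0 2 hs).norm
      refine this.congr (Eventually.of_forall fun u => ?_)
      simp only [zero_mul, Complex.exp_zero, mul_one]
      rw [Complex.norm_real, Real.norm_of_nonneg (by positivity)]
    refine Integrable.mono hb (by fun_prop) (Eventually.of_forall fun u => ?_)
    rw [norm_mul, norm_mul (Real.cosh u ^ 2), norm_mul, pow_two, norm_mul]
    simp only [Real.norm_eq_abs, abs_of_pos (Real.cosh_pos u)]
    have a : |u| ≤ Real.cosh u := by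
      refine le_trans ?_ (abs_sinh_le_cosh u)
      exact sq_le_sq.mp (sq_le_sinh_sq u)
    gcongr
    exact abs_sinh_le_cosh u
  refine ⟨h2, ?_⟩
  have h0 := integrable_exp_cosh hs
  have hint := integral_eq_zero_of_hasDerivAt_of_integrable
    (f := fun u : ℝ => u * Real.exp (-(s * Real.cosh u)))
    (f' := fun u => Real.exp (-(s * Real.cosh u)) -
      s * (u * Real.sinh u * Real.exp (-(s * Real.cosh u))))
    (fun u => by
      have := (hasDerivAt_id u).mul (((Real.hasDerivAt_cosh u).const_mul s).neg.exp)
      convert! this using 1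
      simp only [id, Pi.neg_apply]
      ring)
    (h0.sub (h3.const_mul _)) h1
  rw [integral_sub h0 (h3.const_mul _), integral_const_mul, sub_eq_zero] at hint
  rw [besselK₀, ← mul_assoc 2, mul_one_div_cancel two_ne_zero, one_mul, hint,
    mul_div_cancel_left₀ _ hs.ne']
  refine integral_mono h2 h3 fun u => ?_
  have a : u ^ 2 ≤ u * Real.sinh u := by
    rcases le_total 0 u with hu | hu
    · nlinarith [Real.self_le_sinh_iff.mpr hu]
    · nlinarith [Real.sinh_le_self_iff.mpr hu]
  exact mul_le_mul_of_nonneg_right a (Real.exp_pos _).le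

/-- Averaging over `ν` and `- ν` replaces the exponential by a hyperbolic cosine, which is bounded
below pointwise when `ν²` is real. -/
theorem re_besselK_eq (ν : ℂ) {s : ℝ} (hs : 0 < s) :
    (besselK ν s).re = 1 / 2 * ∫ u : ℝ, Real.exp (-(s * Real.cosh u)) * (Complex.cosh (ν * u)).re := by
  have hp := integrable_exp_cosh_mul_cexp ν s hs
  have hm := integrable_exp_cosh_mul_cexp (-ν) s hs
  have h : besselK ν s = 1 / 2 * ∫ u : ℝ, ((Real.exp (-(s * Real.cosh u)) : ℝ) : ℂ) *
      Complex.cosh (ν * u) := by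
    have e1 : besselK ν s = 1 / 2 * (besselK ν s + besselK (-ν) s) := by
      rw [besselK_neg]; ring
    have e2 : ∀ ν : ℂ, besselK ν s = (1 / 2 : ℂ) *
        ∫ u : ℝ, ((Real.exp (-(s * Real.cosh u)) : ℝ) : ℂ) * Complex.exp (ν * u) := by
      intro ν
      simp [besselK]
    rw [e1, e2, e2, ← mul_add, ← integral_add hp hm, ← integral_const_mul]
    congr 2
    ext u
    rw [Complex.cosh, neg_mul]
    ring
  have hi : Integrable fun u : ℝ => ((Real.exp (-(s * Real.cosh u)) : ℝ) : ℂ) *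
      Complex.cosh (ν * u) := by
    refine ((hp.add hm).const_mul (1 / 2)).congr (Eventually.of_forall fun u => ?_)
    simp only [Pi.add_apply]
    rw [Complex.cosh, neg_mul]
    ring
  rw [h, show (1 / 2 : ℂ) = ((1 / 2 : ℝ) : ℂ) by push_cast; rfl, Complex.re_ofReal_mul]
  congr 1
  have := integral_re hi
  simp only [RCLike.re_to_complex, Complex.re_ofReal_mul] at this
  exact this.symm

/-- For a real eigenvalue parameter, `K_{ir}` is real, and bounded below as long as `r²` is not
large. -/
theorem besselK_real_and_le {r : ℂ} {ρ s : ℝ} (hr : r ^ 2 = ρ) (hs : 0 < s) :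
    ((besselK (Complex.I * r) s).re : ℂ) = besselK (Complex.I * r) s ∧
      (1 - max ρ 0 / (2 * s)) * besselK₀ s ≤ (besselK (Complex.I * r) s).re := by
  have him : r.re * r.im = 0 := by
    have := congrArg Complex.im hr
    simp only [pow_two, Complex.mul_im, Complex.ofReal_im] at this
    linarith
  -- As `r²` is real, `r` is real or purely imaginary. The integrand is then `cos (r u) ≥ 1 - r² u²
  -- / 2`, respectively a real hyperbolic cosine, at least `1`.
  have hcosh : ∀ u : ℝ, 1 - max ρ 0 * u ^ 2 / 2 ≤ (Complex.cosh (Complex.I * r * u)).re := by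
    intro u
    rcases mul_eq_zero.mp him with h | h
    · have e : Complex.I * r * u = ((-(r.im * u) : ℝ) : ℂ) := by
        apply Complex.ext <;> simp [h]
      rw [e, ← Complex.ofReal_cosh, Complex.ofReal_re]
      have : 0 ≤ max ρ 0 * u ^ 2 / 2 := by positivity
      linarith [Real.one_le_cosh (-(r.im * u))]
    · have e : Complex.I * r * u = ((r.re * u : ℝ) : ℂ) * Complex.I := by
        apply Complex.ext <;> simp [h]
      rw [e, Complex.cosh_mul_I, ← Complex.ofReal_cos, Complex.ofReal_re]
      have h1 := Real.one_sub_sq_div_two_le_cos (x := r.re * u)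
      have h2 : ρ = r.re ^ 2 := by
        have := congrArg Complex.re hr
        simp only [pow_two, Complex.mul_re, Complex.ofReal_re, h] at this
        linarith
      have h3 : (r.re * u) ^ 2 ≤ max ρ 0 * u ^ 2 := by
        rw [mul_pow, ← h2]
        gcongr
        exact le_max_left _ _
      linarith
  constructor
  · have : (starRingEnd ℂ) (besselK (Complex.I * r) s) = besselK (Complex.I * r) s := by
      rw [conj_besselK]
      rcases mul_eq_zero.mp him with h | h
      · congr 1
        apply Complex.ext <;> simp [h]
      · rw [← besselK_neg]
        congr 1
        apply Complex.ext <;> simp [h]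
    exact Complex.conj_eq_iff_re.mp this
  · have h0 := integrable_exp_cosh hs
    obtain ⟨h2, h2'⟩ := integral_sq_mul_exp_cosh_le hs
    rw [re_besselK_eq _ hs]
    have hic : Integrable fun u : ℝ => Real.exp (-(s * Real.cosh u)) *
        (Complex.cosh (Complex.I * r * u)).re := by
      have := ((integrable_exp_cosh_mul_cexp (Complex.I * r) s hs).add
        (integrable_exp_cosh_mul_cexp (-(Complex.I * r)) s hs)).const_mul (1 / 2)
      refine this.re.congr (Eventually.of_forall fun u => ?_)
      simp only [Pi.add_apply, RCLike.re_to_complex]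
      rw [← mul_add, mul_left_comm, Complex.re_ofReal_mul, Complex.cosh, neg_mul]
      congr 2
      ring
    have h3 : ∫ u : ℝ, (Real.exp (-(s * Real.cosh u)) -
        max ρ 0 / 2 * (u ^ 2 * Real.exp (-(s * Real.cosh u)))) ≤
        ∫ u : ℝ, Real.exp (-(s * Real.cosh u)) * (Complex.cosh (Complex.I * r * u)).re := by
      refine integral_mono (h0.sub (h2.const_mul _)) hic fun u => ?_
      have := mul_le_mul_of_nonneg_left (hcosh u) (Real.exp_pos (-(s * Real.cosh u))).le
      simp only at this ⊢
      linarith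
    rw [integral_sub h0 (h2.const_mul _), integral_const_mul] at h3
    have h4 : max ρ 0 / 2 * ∫ u : ℝ, u ^ 2 * Real.exp (-(s * Real.cosh u)) ≤
        max ρ 0 / 2 * (2 * besselK₀ s / s) := by gcongr
    have h5 : ∫ u : ℝ, Real.exp (-(s * Real.cosh u)) = 2 * besselK₀ s := by
      rw [besselK₀]; ring
    rw [h5] at h3
    have h6 : (1 - max ρ 0 / (2 * s)) * besselK₀ s
        = 1 / 2 * (2 * besselK₀ s - max ρ 0 / 2 * (2 * besselK₀ s / s)) := by
      field_simp
    rw [h6]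
    gcongr
    linarith

end
section

/-! ### Integration on the upper half plane -/

theorem range_upperHalfPlane_coe : range UpperHalfPlane.coe = {z : ℂ | 0 < z.im} := by
  ext z
  constructor
  · rintro ⟨w, rfl⟩
    exact w.im_pos
  · intro hz
    exact ⟨⟨z, hz⟩, rfl⟩

theorem measurePreserving_upperHalfPlane_coe :
    MeasurePreserving UpperHalfPlane.coe ((volume : Measure ℂ).comap UpperHalfPlane.coe)
      ((volume : Measure ℂ).restrict {z : ℂ | 0 < z.im}) :=
  ⟨UpperHalfPlane.measurable_coe, by
    rw [UpperHalfPlane.measurableEmbedding_coe.map_comap, range_upperHalfPlane_coe]⟩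

theorem measurable_density :
    Measurable fun z : ℍ => (1 / NNReal.mk z.im z.im_pos.le) ^ 2 := by
  have : Continuous fun z : ℍ => (1 / NNReal.mk z.im z.im_pos.le) ^ 2 := by
    refine .pow (.div₀ continuous_const ?_ ?_) _
    · exact UpperHalfPlane.continuous_im.subtype_mk _
    · exact fun x ↦ NNReal.ne_iff.mp x.im_ne_zero
  exact this.measurable

theorem lintegral_upperHalfPlane (f : ℂ → ENNReal) :
    ∫⁻ z : ℍ, f z = ∫⁻ z in {z : ℂ | 0 < z.im}, ENNReal.ofReal (1 / z.im ^ 2) * f z := by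
  rw [UpperHalfPlane.volume_def,
    lintegral_withDensity_eq_lintegral_mul_non_measurable _ measurable_density.coe_nnreal_ennreal
      (Eventually.of_forall fun _ => ENNReal.coe_lt_top),
    ← measurePreserving_upperHalfPlane_coe.lintegral_comp_emb
      UpperHalfPlane.measurableEmbedding_coe]
  refine lintegral_congr fun z => ?_
  simp only [Pi.mul_apply]
  congr 1
  rw [ENNReal.ofReal, ENNReal.coe_inj]
  ext
  rw [Real.coe_toNNReal _ (by positivity)]
  simp [UpperHalfPlane.coe_im]

theorem integral_upperHalfPlane (f : ℂ → ℂ) :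
    ∫ z : ℍ, f z = ∫ z in {z : ℂ | 0 < z.im}, ((1 / z.im ^ 2 : ℝ) : ℂ) * f z := by
  rw [UpperHalfPlane.volume_def, integral_withDensity_eq_integral_smul measurable_density,
    ← measurePreserving_upperHalfPlane_coe.integral_comp UpperHalfPlane.measurableEmbedding_coe]
  refine integral_congr_ae (Eventually.of_forall fun z => ?_)
  simp only [NNReal.smul_def, UpperHalfPlane.coe_im]
  simp [Complex.real_smul]

/-- `cosh d(z, w)` as a function of `w`, on all of `ℂ`. -/
def coshDist (z : ℍ) (w : ℂ) : ℝ :=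
  ((w.re - z.re) ^ 2 + w.im ^ 2 + z.im ^ 2) / (2 * z.im * w.im)

theorem coshDist_eq (z w : ℍ) : coshDist z w = Real.cosh (dist z w) := by
  rw [UpperHalfPlane.cosh_dist, coshDist, Complex.dist_eq_re_im, Real.sq_sqrt (by positivity)]
  have := z.im_pos
  have := w.im_pos
  simp only [UpperHalfPlane.coe_im, UpperHalfPlane.coe_re]
  field_simp
  ring

theorem lintegral_gaussian_sub {b : ℝ} (hb : 0 < b) (x₀ : ℝ) :
    ∫⁻ x : ℝ, ENNReal.ofReal (Real.exp (-b * (x - x₀) ^ 2)) = ENNReal.ofReal √(Real.pi / b) := by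
  rw [lintegral_sub_right_eq_self (fun x : ℝ => ENNReal.ofReal (Real.exp (-b * x ^ 2))) x₀,
    ← ofReal_integral_eq_lintegral_ofReal (integrable_exp_neg_mul_sq hb)
      (Eventually.of_forall fun x => (Real.exp_pos _).le), integral_gaussian]

theorem lintegral_Ioi_eq_lintegral_exp {y₀ : ℝ} (hy₀ : 0 < y₀) (g : ℝ → ENNReal) :
    ∫⁻ y in Ioi 0, g y = ∫⁻ u : ℝ, ENNReal.ofReal (y₀ * Real.exp u) * g (y₀ * Real.exp u) := by
  have himg : (fun u : ℝ => y₀ * Real.exp u) '' univ = Ioi 0 := by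
    rw [image_univ]
    ext y
    constructor
    · rintro ⟨u, rfl⟩
      exact mul_pos hy₀ (Real.exp_pos u)
    · intro hy
      refine ⟨Real.log (y / y₀), ?_⟩
      simp only
      rw [Real.exp_log (div_pos hy hy₀)]
      field_simp
  have h := lintegral_image_eq_lintegral_abs_deriv_mul (s := univ) MeasurableSet.univ
    (fun u _ => ((Real.hasDerivAt_exp u).const_mul y₀).hasDerivWithinAt)
    (fun a _ b _ hab => Real.exp_injective (mul_left_cancel₀ hy₀.ne' hab)) g
  rw [himg, Measure.restrict_univ] at h
  rw [h]
  refine lintegral_congr fun u => ?_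
  rw [abs_of_pos (by positivity)]

/-- This is the elementary function `K_{1/2}`: the symmetry `u ↦ - u` turns the exponential into
`cosh (u / 2)`, and the integral becomes Gaussian. -/
theorem integral_exp_cosh_mul_exp_half (s : ℝ) (hs : 0 < s) :
    ∫ u : ℝ, Real.exp (-(s * Real.cosh u)) * Real.exp (-(1 / 2) * u)
      = Real.exp (-s) * √(2 * Real.pi / s) := by
  have h1 := integrable_exp_cosh_mul_exp hs (-(1 / 2))
  have h2 := integrable_exp_cosh_mul_exp hs (1 / 2)
  have e1 : ∫ u : ℝ, Real.exp (-(s * Real.cosh u)) * Real.exp (1 / 2 * u)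
      = ∫ u : ℝ, Real.exp (-(s * Real.cosh u)) * Real.exp (-(1 / 2) * u) := by
    rw [← integral_neg_eq_self]
    simp
  have e2 : ∫ u : ℝ, Real.exp (-(s * Real.cosh u)) * Real.exp (-(1 / 2) * u)
      = ∫ u : ℝ, Real.exp (-s) * (Real.exp (-(s * (Real.cosh u - 1))) * Real.cosh (u / 2)) := by
    have e3 : ∫ u : ℝ, Real.exp (-(s * Real.cosh u)) * Real.exp (-(1 / 2) * u)
        = 1 / 2 * ∫ u : ℝ, (Real.exp (-(s * Real.cosh u)) * Real.exp (1 / 2 * u)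
          + Real.exp (-(s * Real.cosh u)) * Real.exp (-(1 / 2) * u)) := by
      rw [integral_add h2 h1, e1]
      ring
    rw [e3, ← integral_const_mul]
    congr 1
    ext u
    rw [← mul_assoc, ← Real.exp_add (-s), Real.cosh_eq (u / 2),
      show -s + -(s * (Real.cosh u - 1)) = -(s * Real.cosh u) by ring,
      show -(1 / 2) * u = -(u / 2) by ring, show 1 / 2 * u = u / 2 by ring]
    ring
  rw [e2, integral_const_mul, integral_exp_cosh_sub_one_mul_cosh_half]

/-- For fixed `y` the integral over `x` is Gaussian; the substitution `y = Im z · exp u` then leads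
to the integral of `K_{1/2}`. The result is independent of `z`, as it must be by invariance. -/
theorem lintegral_exp_neg_mul_coshDist (z : ℍ) {s : ℝ} (hs : 0 < s) :
    ∫⁻ w : ℍ, ENNReal.ofReal (Real.exp (-(s * Real.cosh (dist z w))))
      = ENNReal.ofReal (2 * Real.pi / s * Real.exp (-s)) := by
  have hy₀ := z.im_pos
  have hm : Measurable fun w : ℂ => ENNReal.ofReal (1 / w.im ^ 2) *
      ENNReal.ofReal (Real.exp (-(s * coshDist z w))) := by
    unfold coshDist
    fun_prop
  have h1 : ∫⁻ w : ℍ, ENNReal.ofReal (Real.exp (-(s * Real.cosh (dist z w))))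
      = ∫⁻ w : ℂ, (Complex.im ⁻¹' Ioi 0).indicator (fun w => ENNReal.ofReal (1 / w.im ^ 2) *
          ENNReal.ofReal (Real.exp (-(s * coshDist z w)))) w := by
    rw [lintegral_indicator (Complex.measurable_im measurableSet_Ioi)]
    simp only [← coshDist_eq]
    exact lintegral_upperHalfPlane fun w : ℂ => ENNReal.ofReal (Real.exp (-(s * coshDist z w)))
  have hmi := hm.indicator (Complex.measurable_im (measurableSet_Ioi (a := (0 : ℝ))))
  have hmc := hmi.comp Complex.measurableEquivRealProd.symm.measurable
  simp only [Function.comp_def] at hmc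
  rw [h1, ← (Complex.volume_preserving_equiv_real_prod.symm).lintegral_comp hmi,
    Measure.volume_eq_prod, lintegral_prod_symm _ hmc.aemeasurable]
  have h2 : ∀ y : ℝ, ∫⁻ x : ℝ, (Complex.im ⁻¹' Ioi 0).indicator
      (fun w => ENNReal.ofReal (1 / w.im ^ 2) * ENNReal.ofReal (Real.exp (-(s * coshDist z w))))
      (Complex.measurableEquivRealProd.symm (x, y)) = (Ioi 0).indicator (fun y =>
        ENNReal.ofReal (1 / y ^ 2 * Real.exp (-(s * ((y ^ 2 + z.im ^ 2) / (2 * z.im * y)))) *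
          √(2 * Real.pi / s * (z.im * y)))) y := by
    intro y
    by_cases hy : 0 < y
    · rw [indicator_of_mem (mem_Ioi.mpr hy)]
      have : ∀ x : ℝ, (Complex.im ⁻¹' Ioi 0).indicator
          (fun w => ENNReal.ofReal (1 / w.im ^ 2) *
            ENNReal.ofReal (Real.exp (-(s * coshDist z w))))
          (Complex.measurableEquivRealProd.symm (x, y)) = ENNReal.ofReal (1 / y ^ 2 *
          Real.exp (-(s * ((y ^ 2 + z.im ^ 2) / (2 * z.im * y))))) *
          ENNReal.ofReal (Real.exp (-(s / (2 * z.im * y)) * (x - z.re) ^ 2)) := by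
        intro x
        rw [indicator_of_mem (by simpa [Complex.measurableEquivRealProd] using hy),
          ← ENNReal.ofReal_mul (by positivity), ← ENNReal.ofReal_mul (by positivity), mul_assoc,
          ← Real.exp_add]
        simp only [Complex.measurableEquivRealProd_symm_apply, coshDist]
        congr 3
        field_simp
        ring
      simp_rw [this]
      rw [lintegral_const_mul _ (by fun_prop), lintegral_gaussian_sub (by positivity),
        ← ENNReal.ofReal_mul (by positivity)]
      congr 3
      field_simp
    · rw [indicator_of_notMem (by simpa using hy)]
      refine (lintegral_congr fun x => indicator_of_notMem ?_ _).trans lintegral_zero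
      simpa [Complex.measurableEquivRealProd] using hy
  simp_rw [h2]
  rw [lintegral_indicator measurableSet_Ioi, lintegral_Ioi_eq_lintegral_exp hy₀]
  have h3 : ∀ u : ℝ, ENNReal.ofReal (z.im * Real.exp u) * ENNReal.ofReal (1 / (z.im * Real.exp u) ^ 2 *
      Real.exp (-(s * (((z.im * Real.exp u) ^ 2 + z.im ^ 2) / (2 * z.im * (z.im * Real.exp u))))) *
          √(2 * Real.pi / s * (z.im * (z.im * Real.exp u)))) =
      ENNReal.ofReal (√(2 * Real.pi / s) * (Real.exp (-(s * Real.cosh u)) *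
        Real.exp (-(1 / 2) * u))) := by
    intro u
    rw [← ENNReal.ofReal_mul (by positivity)]
    congr 1
    have e1 : ((z.im * Real.exp u) ^ 2 + z.im ^ 2) / (2 * z.im * (z.im * Real.exp u))
        = Real.cosh u := by
      rw [Real.cosh_eq, Real.exp_neg]
      field_simp
    have e2 : √(2 * Real.pi / s * (z.im * (z.im * Real.exp u)))
        = √(2 * Real.pi / s) * (z.im * Real.exp (u / 2)) := by
      rw [Real.sqrt_mul (by positivity)]
      congr 1
      rw [show z.im * (z.im * Real.exp u) = (z.im * Real.exp (u / 2)) ^ 2 by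
        rw [mul_pow, ← Real.exp_nat_mul]
        push_cast
        rw [mul_div_cancel₀ _ (two_ne_zero)]
        ring]
      rw [Real.sqrt_sq (by positivity)]
    have e3 : Real.exp u = Real.exp (u / 2) * Real.exp (u / 2) := by
      rw [← Real.exp_add]; ring_nf
    have e4 : Real.exp (-(1 / 2) * u) = (Real.exp (u / 2))⁻¹ := by
      rw [← Real.exp_neg]; ring_nf
    rw [e1, e2, e4, e3]
    have := (Real.exp_pos (u / 2)).ne'
    field_simp
  simp_rw [h3]
  rw [← ofReal_integral_eq_lintegral_ofReal ((integrable_exp_cosh_mul_exp hs _).const_mul _)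
    (Eventually.of_forall fun u => by positivity), integral_const_mul,
    integral_exp_cosh_mul_exp_half s hs]
  congr 1
  rw [mul_left_comm, Real.mul_self_sqrt (by positivity)]
  ring

theorem measurable_cosh_dist (z : ℍ) : Measurable fun w : ℍ => Real.cosh (dist z w) :=
  (Real.continuous_cosh.comp (continuous_const.dist continuous_id)).measurable

theorem integrable_exp_neg_mul_coshDist (z : ℍ) {s : ℝ} (hs : 0 < s) :
    Integrable fun w : ℍ => Real.exp (-(s * Real.cosh (dist z w))) := by
  have hm := measurable_cosh_dist z
  refine ⟨Measurable.aestronglyMeasurable (by fun_prop), ?_⟩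
  rw [hasFiniteIntegral_iff_ofReal (Eventually.of_forall fun _ => (Real.exp_pos _).le),
    lintegral_exp_neg_mul_coshDist z hs]
  exact ENNReal.ofReal_lt_top

theorem integral_exp_neg_mul_coshDist (z : ℍ) {s : ℝ} (hs : 0 < s) :
    ∫ w : ℍ, Real.exp (-(s * Real.cosh (dist z w))) = 2 * Real.pi / s * Real.exp (-s) := by
  have hm := measurable_cosh_dist z
  rw [integral_eq_lintegral_of_nonneg_ae (Eventually.of_forall fun _ => (Real.exp_pos _).le)
    (Measurable.aestronglyMeasurable (by fun_prop)), lintegral_exp_neg_mul_coshDist z hs,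
    ENNReal.toReal_ofReal (by positivity)]

end
section

/-! ### Green's formula -/

/-- Functions supported on a compact subset `K` of the open set `U`, continuous on `U`. -/
theorem continuous_of_continuousOn_of_eq_zero {X E : Type*} [TopologicalSpace X]
    [TopologicalSpace E] [Zero E] {U K : Set X} (hU : IsOpen U) (hK : IsClosed K)
    (hKU : K ⊆ U) {g : X → E} (hg : ContinuousOn g U) (h0 : ∀ x ∉ K, g x = 0) : Continuous g := by
  rw [continuous_iff_continuousAt]
  intro x
  by_cases hx : x ∈ U
  · exact hg.continuousAt (hU.mem_nhds hx)
  · have hxK : x ∉ K := fun h => hx (hKU h)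
    have : g =ᶠ[𝓝 x] fun _ => 0 :=
      Filter.eventually_of_mem (hK.isOpen_compl.mem_nhds hxK) fun y hy => h0 y hy
    exact continuousAt_const.congr this.symm

theorem integrable_of_continuousOn_of_eq_zero {E : Type*} [NormedAddCommGroup E]
    {U K : Set ℂ} (hU : IsOpen U) (hK : IsCompact K)
    (hKU : K ⊆ U) {g : ℂ → E} (hg : ContinuousOn g U) (h0 : ∀ x ∉ K, g x = 0) :
    Integrable g :=
  (continuous_of_continuousOn_of_eq_zero hU hK.isClosed hKU hg h0).integrable_of_hasCompactSupport
    (HasCompactSupport.intro hK h0)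

theorem iteratedFDeriv_two_diag {E F : Type*} [NormedAddCommGroup E] [NormedSpace ℝ E]
    [NormedAddCommGroup F] [NormedSpace ℝ F] (f : E → F) {w : E} (v : E)
    (h : DifferentiableAt ℝ (fderiv ℝ f) w) :
    iteratedFDeriv ℝ 2 f w ![v, v] = fderiv ℝ (fun x => fderiv ℝ f x v) w v := by
  rw [iteratedFDeriv_two_apply]
  simp only [Matrix.cons_val_zero, Matrix.cons_val_one]
  rw [fderiv_clm_apply h (differentiableAt_const v)]
  simp

section Green

variable {U K : Set ℂ} {Φ η : ℂ → ℂ}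

theorem fderiv_differentiableAt_of_contDiffOn (hU : IsOpen U) (hΦ : ContDiffOn ℝ 2 Φ U) {w : ℂ}
    (hw : w ∈ U) : DifferentiableAt ℝ (fderiv ℝ Φ) w :=
  ((hΦ.fderiv_of_isOpen hU (m := 1) (by norm_num)).differentiableOn (by norm_num)).differentiableAt
    (hU.mem_nhds hw)

theorem fderiv_apply_contDiffOn (hU : IsOpen U) (hΦ : ContDiffOn ℝ 2 Φ U) (v : ℂ) :
    ContDiffOn ℝ 1 (fun x => fderiv ℝ Φ x v) U :=
  (hΦ.fderiv_of_isOpen hU (m := 1) (by norm_num)).clm_apply contDiffOn_const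

theorem fderiv_fderiv_continuousOn (hU : IsOpen U) (hΦ : ContDiffOn ℝ 2 Φ U) (v : ℂ) :
    ContinuousOn (fun x => fderiv ℝ (fun x => fderiv ℝ Φ x v) x v) U :=
  (((fderiv_apply_contDiffOn hU hΦ v).fderiv_of_isOpen hU (m := 0) (by norm_num)).continuousOn).clm_apply
    continuousOn_const

/-- Integrating twice by parts in the direction `v`. -/
theorem integral_mul_second_fderiv_eq (hU : IsOpen U) (hK : IsCompact K) (hKU : K ⊆ U)
    (hΦ : ContDiffOn ℝ 2 Φ U) (hη : ContDiff ℝ 2 η) (h0 : ∀ x ∉ K, η x = 0) (v : ℂ) :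
    ∫ w, Φ w * fderiv ℝ (fun x => fderiv ℝ η x v) w v =
      ∫ w, fderiv ℝ (fun x => fderiv ℝ Φ x v) w v * η w := by
  have hts : tsupport η ⊆ K := closure_minimal (fun x hx => by
    by_contra h
    exact hx (h0 x h)) hK.isClosed
  have hf0 : ∀ x ∉ K, fderiv ℝ η x v = 0 := by
    intro x hx
    have : x ∉ tsupport (fderiv ℝ η) := fun h => hx (hts (tsupport_fderiv_subset ℝ h))
    rw [image_eq_zero_of_notMem_tsupport this]
    rfl
  have hts1 : tsupport (fun x => fderiv ℝ η x v) ⊆ K := closure_minimal (fun x hx => by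
    by_contra h
    exact hx (hf0 x h)) hK.isClosed
  have hf1 : ∀ x ∉ K, fderiv ℝ (fun x => fderiv ℝ η x v) x v = 0 := by
    intro x hx
    have : x ∉ tsupport (fderiv ℝ (fun x => fderiv ℝ η x v)) :=
      fun h => hx (hts1 (tsupport_fderiv_subset ℝ h))
    rw [image_eq_zero_of_notMem_tsupport this]
    rfl
  have hη' : ContDiffOn ℝ 2 η U := hη.contDiffOn
  have cΦ := hΦ.continuousOn
  have cη := hη'.continuousOn
  have cΦ1 := (fderiv_apply_contDiffOn hU hΦ v).continuousOn
  have cη1 := (fderiv_apply_contDiffOn hU hη' v).continuousOn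
  have cΦ2 := fderiv_fderiv_continuousOn hU hΦ v
  have cη2 := fderiv_fderiv_continuousOn hU hη' v
  have dη1 : Differentiable ℝ (fun x => fderiv ℝ η x v) := by
    have : ContDiff ℝ 1 (fun x => fderiv ℝ η x v) :=
      (hη.fderiv_right (m := 1) (by norm_num)).clm_apply contDiff_const
    exact this.differentiable (by norm_num)
  have dη : Differentiable ℝ η := hη.differentiable (by norm_num)
  have s1 := integral_bilinear_hasLineDerivAt_right_eq_neg_left_of_integrable (μ := volume)
    (f := Φ) (f' := fun x => fderiv ℝ Φ x v) (g := fun x => fderiv ℝ η x v)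
    (g' := fun w => fderiv ℝ (fun x => fderiv ℝ η x v) w v) (v := v)
    (B := ContinuousLinearMap.mul ℝ ℂ)
    (integrable_of_continuousOn_of_eq_zero hU hK hKU (cΦ1.mul cη1) fun x hx => by
      simp [hf0 x hx])
    (integrable_of_continuousOn_of_eq_zero hU hK hKU (cΦ.mul cη2) fun x hx => by
      simp [hf1 x hx])
    (integrable_of_continuousOn_of_eq_zero hU hK hKU (cΦ.mul cη1) fun x hx => by
      simp [hf0 x hx])
    (fun x hx => ((hΦ.contDiffAt (hU.mem_nhds (hKU (hts1 hx)))).differentiableAt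
      (by norm_num)).hasFDerivAt.hasLineDerivAt v)
    (fun x _ => (dη1 x).hasFDerivAt.hasLineDerivAt v)
  have s2 := integral_bilinear_hasLineDerivAt_right_eq_neg_left_of_integrable (μ := volume)
    (f := fun x => fderiv ℝ Φ x v) (f' := fun w => fderiv ℝ (fun x => fderiv ℝ Φ x v) w v)
    (g := η) (g' := fun x => fderiv ℝ η x v) (v := v)
    (B := ContinuousLinearMap.mul ℝ ℂ)
    (integrable_of_continuousOn_of_eq_zero hU hK hKU (cΦ2.mul cη) fun x hx => by
      simp [h0 x hx])
    (integrable_of_continuousOn_of_eq_zero hU hK hKU (cΦ1.mul cη1) fun x hx => by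
      simp [hf0 x hx])
    (integrable_of_continuousOn_of_eq_zero hU hK hKU (cΦ1.mul cη) fun x hx => by
      simp [h0 x hx])
    (fun x hx => (((fderiv_apply_contDiffOn hU hΦ v).contDiffAt
      (hU.mem_nhds (hKU (hts hx)))).differentiableAt (by norm_num)).hasFDerivAt.hasLineDerivAt v)
    (fun x _ => (dη x).hasFDerivAt.hasLineDerivAt v)
  simp only [ContinuousLinearMap.mul_apply'] at s1 s2
  rw [s1, s2, neg_neg]

/-- Two integrations by parts in each of the directions `1` and `I`. There is no boundary term
because `η` vanishes off the compact `K`, and for the same reason `Φ` need only be regular on `U`.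
-/
theorem integral_mul_laplacian_eq (hU : IsOpen U) (hK : IsCompact K) (hKU : K ⊆ U)
    (hΦ : ContDiffOn ℝ 2 Φ U) (hη : ContDiff ℝ 2 η) (h0 : ∀ x ∉ K, η x = 0) :
    ∫ w in U, Φ w * (Laplacian.laplacian η : ℂ → ℂ) w =
      ∫ w in U, (Laplacian.laplacian Φ : ℂ → ℂ) w * η w := by
  have hη' : ContDiffOn ℝ 2 η U := hη.contDiffOn
  have hts : tsupport η ⊆ K := closure_minimal (fun x hx => by
    by_contra h
    exact hx (h0 x h)) hK.isClosed
  have hf2 : ∀ v, ∀ x ∉ K, fderiv ℝ (fun x => fderiv ℝ η x v) x v = 0 := by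
    intro v x hx
    have he : η =ᶠ[𝓝 x] fun _ => 0 :=
      Filter.eventually_of_mem (hK.isClosed.isOpen_compl.mem_nhds hx) fun y hy => h0 y hy
    have he2 : (fun x => fderiv ℝ η x v) =ᶠ[𝓝 x] fun _ => 0 := by
      filter_upwards [he.fderiv (𝕜 := ℝ)] with y hy
      rw [hy]
      simp
    rw [he2.fderiv_eq]
    simp
  have e1 : ∀ w ∈ U, Φ w * (Laplacian.laplacian η : ℂ → ℂ) w =
      Φ w * fderiv ℝ (fun x => fderiv ℝ η x 1) w 1 +
      Φ w * fderiv ℝ (fun x => fderiv ℝ η x Complex.I) w Complex.I := by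
    intro w hw
    rw [InnerProductSpace.laplacian_eq_iteratedFDeriv_complexPlane]
    simp only
    rw [iteratedFDeriv_two_diag _ _ (fderiv_differentiableAt_of_contDiffOn hU hη' hw),
      iteratedFDeriv_two_diag _ _ (fderiv_differentiableAt_of_contDiffOn hU hη' hw), mul_add]
  have e2 : ∀ w ∈ U, (Laplacian.laplacian Φ : ℂ → ℂ) w * η w =
      fderiv ℝ (fun x => fderiv ℝ Φ x 1) w 1 * η w +
      fderiv ℝ (fun x => fderiv ℝ Φ x Complex.I) w Complex.I * η w := by
    intro w hw
    rw [InnerProductSpace.laplacian_eq_iteratedFDeriv_complexPlane]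
    simp only
    rw [iteratedFDeriv_two_diag _ _ (fderiv_differentiableAt_of_contDiffOn hU hΦ hw),
      iteratedFDeriv_two_diag _ _ (fderiv_differentiableAt_of_contDiffOn hU hΦ hw), add_mul]
  have z1 : ∀ v, ∀ x ∉ K, Φ x * fderiv ℝ (fun x => fderiv ℝ η x v) x v = 0 := by
    intro v x hx
    rw [hf2 v x hx, mul_zero]
  have z2 : ∀ v, ∀ x ∉ K, fderiv ℝ (fun x => fderiv ℝ Φ x v) x v * η x = 0 := by
    intro v x hx
    rw [h0 x hx, mul_zero]
  have i1 : ∀ v, Integrable (fun x => Φ x * fderiv ℝ (fun x => fderiv ℝ η x v) x v) :=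
    fun v => integrable_of_continuousOn_of_eq_zero hU hK hKU
    (hΦ.continuousOn.mul (fderiv_fderiv_continuousOn hU hη' v)) (z1 v)
  have i2 : ∀ v, Integrable (fun x => fderiv ℝ (fun x => fderiv ℝ Φ x v) x v * η x) :=
    fun v => integrable_of_continuousOn_of_eq_zero hU hK hKU
    ((fderiv_fderiv_continuousOn hU hΦ v).mul hη'.continuousOn) (z2 v)
  rw [setIntegral_congr_fun hU.measurableSet e1, setIntegral_congr_fun hU.measurableSet e2,
    integral_add (i1 _).integrableOn (i1 _).integrableOn,
    integral_add (i2 _).integrableOn (i2 _).integrableOn]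
  have key : ∀ v, ∫ w in U, Φ w * fderiv ℝ (fun x => fderiv ℝ η x v) w v =
      ∫ w in U, fderiv ℝ (fun x => fderiv ℝ Φ x v) w v * η w := by
    intro v
    rw [setIntegral_eq_integral_of_forall_compl_eq_zero fun x hx => z1 v x fun h => hx (hKU h),
      setIntegral_eq_integral_of_forall_compl_eq_zero fun x hx => z2 v x fun h => hx (hKU h)]
    exact integral_mul_second_fderiv_eq hU hK hKU hΦ hη h0 v
  rw [key, key]

end Green

/-! ### Radial functions -/

theorem isOpen_im_pos : IsOpen {z : ℂ | 0 < z.im} := isOpen_lt continuous_const Complex.continuous_im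

theorem contDiffAt_coshDist (z : ℍ) {w : ℂ} (hw : 0 < w.im) : ContDiffAt ℝ 2 (coshDist z) w := by
  have hre : ContDiff ℝ 2 (fun w : ℂ => w.re) := Complex.reCLM.contDiff
  have him : ContDiff ℝ 2 (fun w : ℂ => w.im) := Complex.imCLM.contDiff
  have hz := z.im_pos
  unfold coshDist
  refine ContDiffAt.div ?_ ?_ (by positivity)
  · exact (((hre.sub contDiff_const).pow 2).add (him.pow 2)).add contDiff_const |>.contDiffAt
  · exact (contDiff_const.mul him).contDiffAt

/-- The horizontal derivative of `coshDist z`. -/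
def coshDistX (z : ℍ) (w : ℂ) : ℝ := (w.re - z.re) / (z.im * w.im)

/-- The vertical derivative of `coshDist z`. -/
def coshDistY (z : ℍ) (w : ℂ) : ℝ :=
  (w.im ^ 2 - z.im ^ 2 - (w.re - z.re) ^ 2) / (2 * z.im * w.im ^ 2)

theorem hasDerivAt_coshDist_one (z : ℍ) {w : ℂ} (hw : 0 < w.im) :
    HasLineDerivAt ℝ (coshDist z) (coshDistX z w) w 1 := by
  have hz := z.im_pos
  unfold HasLineDerivAt coshDist coshDistX
  have h1 : HasDerivAt (fun t : ℝ => (w + t • 1).re - z.re) 1 0 := by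
    simpa using ((hasDerivAt_id (0 : ℝ)).const_add w.re).sub_const z.re
  have h := (((h1.pow 2).add_const (w.im ^ 2)).add_const (z.im ^ 2)).div_const (2 * z.im * w.im)
  convert! h using 1
  · ext t
    simp
  · simp
    field_simp

theorem hasDerivAt_coshDist_I (z : ℍ) {w : ℂ} (hw : 0 < w.im) :
    HasLineDerivAt ℝ (coshDist z) (coshDistY z w) w Complex.I := by
  have hz := z.im_pos
  unfold HasLineDerivAt coshDist coshDistY
  have h1 : HasDerivAt (fun t : ℝ => (w + t • Complex.I).im) 1 0 := by
    simpa using ((hasDerivAt_id (0 : ℝ)).const_add w.im)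
  have h := (((h1.pow 2).const_add ((w.re - z.re) ^ 2)).add_const (z.im ^ 2)).div
    (h1.const_mul (2 * z.im)) (by simp; exact ⟨hz.ne', hw.ne'⟩)
  convert! h using 1
  · ext t
    simp
  · simp
    field_simp
    ring

theorem hasDerivAt_coshDistX_one (z : ℍ) (w : ℂ) :
    HasLineDerivAt ℝ (coshDistX z) (1 / (z.im * w.im)) w 1 := by
  unfold HasLineDerivAt coshDistX
  have h1 : HasDerivAt (fun t : ℝ => (w + t • 1).re - z.re) 1 0 := by
    simpa using ((hasDerivAt_id (0 : ℝ)).const_add w.re).sub_const z.re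
  convert! h1.div_const (z.im * w.im) using 1
  ext t
  simp

theorem hasDerivAt_coshDistY_I (z : ℍ) {w : ℂ} (hw : 0 < w.im) :
    HasLineDerivAt ℝ (coshDistY z) ((z.im ^ 2 + (w.re - z.re) ^ 2) / (z.im * w.im ^ 3)) w
      Complex.I := by
  have hz := z.im_pos
  unfold HasLineDerivAt coshDistY
  have h1 : HasDerivAt (fun t : ℝ => (w + t • Complex.I).im) 1 0 := by
    simpa using ((hasDerivAt_id (0 : ℝ)).const_add w.im)
  have h := (((h1.pow 2).sub_const (z.im ^ 2)).sub_const ((w.re - z.re) ^ 2)).div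
    ((h1.pow 2).const_mul (2 * z.im)) (by simp; exact ⟨hz.ne', hw.ne'⟩)
  convert! h using 1
  · ext t
    simp
  · simp
    field_simp
    ring

theorem differentiableAt_coshDistX (z : ℍ) {w : ℂ} (hw : 0 < w.im) :
    DifferentiableAt ℝ (coshDistX z) w := by
  have hz := z.im_pos
  have hre : ContDiff ℝ 1 (fun w : ℂ => w.re) := Complex.reCLM.contDiff
  have him : ContDiff ℝ 1 (fun w : ℂ => w.im) := Complex.imCLM.contDiff
  unfold coshDistX
  exact ((hre.sub contDiff_const).contDiffAt.div (contDiff_const.mul him).contDiffAt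
    (by positivity)).differentiableAt (by norm_num)

theorem differentiableAt_coshDistY (z : ℍ) {w : ℂ} (hw : 0 < w.im) :
    DifferentiableAt ℝ (coshDistY z) w := by
  have hz := z.im_pos
  have hre : ContDiff ℝ 1 (fun w : ℂ => w.re) := Complex.reCLM.contDiff
  have him : ContDiff ℝ 1 (fun w : ℂ => w.im) := Complex.imCLM.contDiff
  unfold coshDistY
  exact ((((him.pow 2).sub contDiff_const).sub ((hre.sub contDiff_const).pow 2)).contDiffAt.div
    (contDiff_const.mul (him.pow 2)).contDiffAt (by positivity)).differentiableAt (by norm_num)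

/-- The chain rule `(f ∘ c)'' = f''(c) c'² + f'(c) c''` along one direction, so that explicit line
derivatives of `coshDist` suffice. -/
theorem second_fderiv_comp {c c₁ : ℂ → ℝ} {c₂ : ℝ} {v : ℂ} {U : Set ℂ} (hU : IsOpen U)
    {f : ℝ → ℝ} (hf : ContDiff ℝ 2 f) {w : ℂ} (hw : w ∈ U)
    (hc : ∀ w ∈ U, DifferentiableAt ℝ c w) (hc₁ : ∀ w ∈ U, HasLineDerivAt ℝ c (c₁ w) w v)
    (hd₁ : DifferentiableAt ℝ c₁ w) (hc₂ : HasLineDerivAt ℝ c₁ c₂ w v) {η : ℂ → ℂ}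
    (hη : ∀ w ∈ U, η w = (f (c w) : ℂ)) :
    fderiv ℝ (fun x => fderiv ℝ η x v) w v
      = ((deriv (deriv f) (c w) * c₁ w ^ 2 + deriv f (c w) * c₂ : ℝ) : ℂ) := by
  have hf1 : Differentiable ℝ f := hf.differentiable (by norm_num)
  have hf2 : Differentiable ℝ (deriv f) := by
    have : ContDiff ℝ 1 (deriv f) := ((contDiff_succ_iff_deriv (n := 1)).mp (by
      rw [one_add_one_eq_two]; exact hf)).2.2
    exact this.differentiable (by norm_num)
  have hcv : ∀ w ∈ U, fderiv ℝ c w v = c₁ w := fun w hw =>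
    ((hc w hw).hasFDerivAt.hasLineDerivAt v).unique (hc₁ w hw)
  have hc1v : fderiv ℝ c₁ w v = c₂ := (hd₁.hasFDerivAt.hasLineDerivAt v).unique hc₂
  have e1 : ∀ w ∈ U, fderiv ℝ η w v = ((deriv f (c w) * c₁ w : ℝ) : ℂ) := by
    intro w hw
    have he : η =ᶠ[𝓝 w] fun w => ((f (c w) : ℝ) : ℂ) :=
      Filter.eventually_of_mem (hU.mem_nhds hw) hη
    rw [he.fderiv_eq]
    have h1 : HasFDerivAt (fun w => f (c w)) (deriv f (c w) • fderiv ℝ c w) w :=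
      (hf1 (c w)).hasDerivAt.comp_hasFDerivAt w (hc w hw).hasFDerivAt
    have h2 := (Complex.ofRealCLM.hasFDerivAt (x := f (c w))).comp w h1
    have h3 : HasFDerivAt (fun w => ((f (c w) : ℝ) : ℂ))
      (Complex.ofRealCLM.comp (deriv f (c w) • fderiv ℝ c w)) w := h2
    rw [h3.fderiv]
    simp [hcv w hw]
  have he : (fun x => fderiv ℝ η x v) =ᶠ[𝓝 w] fun w => ((deriv f (c w) * c₁ w : ℝ) : ℂ) :=
    Filter.eventually_of_mem (hU.mem_nhds hw) e1
  rw [he.fderiv_eq]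
  have h1 : HasFDerivAt (fun w => deriv f (c w)) (deriv (deriv f) (c w) • fderiv ℝ c w) w :=
    (hf2 (c w)).hasDerivAt.comp_hasFDerivAt w (hc w hw).hasFDerivAt
  have h2 := (Complex.ofRealCLM.hasFDerivAt (x := deriv f (c w) * c₁ w)).comp w
    (h1.mul hd₁.hasFDerivAt)
  have h3 : HasFDerivAt (fun w => ((deriv f (c w) * c₁ w : ℝ) : ℂ)) (Complex.ofRealCLM.comp
    (deriv f (c w) • fderiv ℝ c₁ w + c₁ w • deriv (deriv f) (c w) • fderiv ℝ c w)) w := h2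
  rw [h3.fderiv]
  simp [hcv w hw, hc1v]
  ring

/-- The weak form of the eigenvalue equation against radial functions `f (cosh d(z, ·))`. -/
theorem integral_mul_radial_laplacian {Φ : ℂ → ℂ} {lam : ℝ}
    (hΦ : ContDiffOn ℝ 2 Φ {z : ℂ | 0 < z.im})
    (hlam : ∀ w : ℂ, 0 < w.im →
      -((w.im : ℂ) ^ 2) * (Laplacian.laplacian Φ : ℂ → ℂ) w = (lam : ℂ) * Φ w)
    (z : ℍ) {f : ℝ → ℝ} (hf : ContDiff ℝ 2 f) {R : ℝ} (hR : ∀ x, R ≤ x → f x = 0) :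
    ∫ w : ℍ, (((Real.cosh (dist z w) ^ 2 - 1) * deriv (deriv f) (Real.cosh (dist z w)) +
        2 * Real.cosh (dist z w) * deriv f (Real.cosh (dist z w)) : ℝ) : ℂ) * Φ w
      = -(lam : ℂ) * ∫ w : ℍ, (f (Real.cosh (dist z w)) : ℂ) * Φ w := by
  have hz := z.im_pos
  set U := {z : ℂ | 0 < z.im} with hUdef
  have hU : IsOpen U := isOpen_im_pos
  set K : Set ℂ := UpperHalfPlane.coe '' {w : ℍ | Real.cosh (dist z w) ≤ R} with hKdef
  -- The preimage lies in a closed hyperbolic ball because `dist ≤ cosh dist`, and `ℍ` is proper.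
  have hK : IsCompact K := by
    refine IsCompact.image ?_ UpperHalfPlane.continuous_coe
    refine (isCompact_closedBall z R).of_isClosed_subset (isClosed_le
      (Real.continuous_cosh.comp (continuous_const.dist continuous_id)) continuous_const) ?_
    intro w hw
    rw [Metric.mem_closedBall, dist_comm]
    have : dist z w ≤ Real.cosh (dist z w) := by
      have := one_add_sq_div_two_le_cosh (dist z w)
      nlinarith [sq_nonneg (dist z w - 1)]
    exact this.trans hw
  have hKU : K ⊆ U := by
    rintro _ ⟨w, -, rfl⟩
    exact w.im_pos
  -- The formula for `coshDist` has no geometric meaning when `Im w ≤ 0`. Extension by zero is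
  -- smooth, since the support is a compact subset of the open half plane.
  set η : ℂ → ℂ := U.indicator fun w => (f (coshDist z w) : ℂ) with hηdef
  have hηU : ∀ w ∈ U, η w = (f (coshDist z w) : ℂ) := fun w hw => indicator_of_mem hw _
  have h0 : ∀ w ∉ K, η w = 0 := by
    intro w hw
    by_cases hwU : w ∈ U
    · rw [hηU w hwU]
      have : R ≤ coshDist z w := by
        by_contra hlt
        apply hw
        refine ⟨⟨w, hwU⟩, ?_, rfl⟩
        rw [mem_ofPred_eq, ← coshDist_eq]
        exact (not_le.mp hlt).le
      rw [hR _ this, Complex.ofReal_zero]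
    · exact indicator_of_notMem hwU _
  have hη : ContDiff ℝ 2 η := by
    rw [contDiff_iff_contDiffAt]
    intro w
    by_cases hw : w ∈ U
    · have he : η =ᶠ[𝓝 w] fun w => (f (coshDist z w) : ℂ) :=
        Filter.eventually_of_mem (hU.mem_nhds hw) hηU
      refine ContDiffAt.congr_of_eventuallyEq ?_ he
      exact (Complex.ofRealCLM.contDiff.comp hf).contDiffAt.comp w (contDiffAt_coshDist z hw)
    · have he : η =ᶠ[𝓝 w] fun _ => 0 :=
        Filter.eventually_of_mem (hK.isClosed.isOpen_compl.mem_nhds fun h => hw (hKU h))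
          fun y hy => h0 y hy
      exact contDiffAt_const.congr_of_eventuallyEq he
  have hlap : ∀ w ∈ U, ((w.im : ℂ) ^ 2) * (Laplacian.laplacian η : ℂ → ℂ) w =
      (((coshDist z w ^ 2 - 1) * deriv (deriv f) (coshDist z w) +
        2 * coshDist z w * deriv f (coshDist z w) : ℝ) : ℂ) := by
    intro w hw
    have hw' : 0 < w.im := hw
    rw [InnerProductSpace.laplacian_eq_iteratedFDeriv_complexPlane]
    simp only
    rw [iteratedFDeriv_two_diag _ _ (fderiv_differentiableAt_of_contDiffOn hU hη.contDiffOn hw),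
      iteratedFDeriv_two_diag _ _ (fderiv_differentiableAt_of_contDiffOn hU hη.contDiffOn hw),
      second_fderiv_comp hU hf hw
        (fun w hw => (contDiffAt_coshDist z hw).differentiableAt (by norm_num))
        (fun w hw => hasDerivAt_coshDist_one z hw) (differentiableAt_coshDistX z hw)
        (hasDerivAt_coshDistX_one z w) hηU,
      second_fderiv_comp hU hf hw
        (fun w hw => (contDiffAt_coshDist z hw).differentiableAt (by norm_num))
        (fun w hw => hasDerivAt_coshDist_I z hw) (differentiableAt_coshDistY z hw)
        (hasDerivAt_coshDistY_I z hw) hηU]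
    rw [← Complex.ofReal_add, ← Complex.ofReal_pow, ← Complex.ofReal_mul, Complex.ofReal_inj]
    -- With `c = cosh d(z, w)`, the hyperbolic gradient has square norm `c² - 1` and `y² (∂_x² +
    -- ∂_y²) c = 2 c`; these two identities give the radial Laplacian.
    have e1 : w.im ^ 2 * (coshDistX z w ^ 2 + coshDistY z w ^ 2) = coshDist z w ^ 2 - 1 := by
      simp only [coshDistX, coshDistY, coshDist]
      field_simp
      ring
    have e2 : w.im ^ 2 * (1 / (z.im * w.im) + (z.im ^ 2 + (w.re - z.re) ^ 2) / (z.im * w.im ^ 3))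
        = 2 * coshDist z w := by
      simp only [coshDist]
      field_simp
      ring
    rw [← e1, ← e2]
    ring
  -- The factor `y²` of the hyperbolic Laplacian cancels the density `y⁻²` of the area, so Euclidean
  -- Green's formula is all that is needed.
  have hG := integral_mul_laplacian_eq hU hK hKU hΦ hη h0
  have hL := integral_upperHalfPlane fun w =>
    (((coshDist z w ^ 2 - 1) * deriv (deriv f) (coshDist z w) +
        2 * coshDist z w * deriv f (coshDist z w) : ℝ) : ℂ) * Φ w
  have hRr := integral_upperHalfPlane fun w => (f (coshDist z w) : ℂ) * Φ w
  simp only [coshDist_eq] at hL hRr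
  rw [hL, hRr, ← integral_const_mul]
  have e3 : ∀ w ∈ U, ((1 / w.im ^ 2 : ℝ) : ℂ) * ((((coshDist z w ^ 2 - 1) *
      deriv (deriv f) (coshDist z w) +
        2 * coshDist z w * deriv f (coshDist z w) : ℝ) : ℂ) * Φ w) =
        Φ w * (Laplacian.laplacian η : ℂ → ℂ) w := by
    intro w hw
    have : (w.im : ℂ) ≠ 0 := by exact_mod_cast (show 0 < w.im from hw).ne'
    rw [← hlap w hw]
    push_cast
    field_simp
  have e4 : ∀ w ∈ U, -(lam : ℂ) * (((1 / w.im ^ 2 : ℝ) : ℂ) * ((f (coshDist z w) : ℂ) * Φ w)) =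
        (Laplacian.laplacian Φ : ℂ → ℂ) w * η w := by
    intro w hw
    have : (w.im : ℂ) ≠ 0 := by exact_mod_cast (show 0 < w.im from hw).ne'
    have h5 := hlam w hw
    rw [hηU w hw, show -(lam : ℂ) * (((1 / w.im ^ 2 : ℝ) : ℂ) * ((f (coshDist z w) : ℂ) * Φ w))
      = -(((1 / w.im ^ 2 : ℝ) : ℂ) * (f (coshDist z w) : ℂ) * (lam * Φ w)) by ring, ← h5]
    push_cast
    field_simp
  rw [setIntegral_congr_fun hU.measurableSet e3, setIntegral_congr_fun hU.measurableSet e4]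
  exact hG

end
section

/-! ### Eigenfunctions of the Laplacian are eigenfunctions of `exp (- s cosh d(z, w))` -/

/-- The translates `χ (c - n)` exhaust the half line and share one bound for their first two
derivatives; this gives dominated convergence when the cutoff is removed. -/
theorem exists_smooth_cutoff : ∃ χ : ℝ → ℝ, ContDiff ℝ 2 χ ∧ (∀ x ≤ 0, χ x = 1) ∧
    (∀ x, 1 ≤ x → χ x = 0) ∧
    ∃ C : ℝ, 0 ≤ C ∧ ∀ x, |χ x| ≤ C ∧ |deriv χ x| ≤ C ∧ |deriv (deriv χ) x| ≤ C := by
  set χ : ℝ → ℝ := fun x => Real.smoothTransition (1 - x) with hχ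
  have hc : ContDiff ℝ 2 χ := Real.smoothTransition.contDiff.comp (contDiff_const.sub contDiff_id)
  have hc1 : ContDiff ℝ 1 (deriv χ) := ((contDiff_succ_iff_deriv (n := 1)).mp (by
      rw [one_add_one_eq_two]; exact hc)).2.2
  have hc2 : ContDiff ℝ 0 (deriv (deriv χ)) := ((contDiff_succ_iff_deriv (n := 0)).mp (by
      rw [zero_add]; exact hc1)).2.2
  have h1 : ∀ x ≤ 0, χ x = 1 := fun x hx => Real.smoothTransition.one_of_one_le (by linarith)
  have h0 : ∀ x, 1 ≤ x → χ x = 0 := fun x hx => Real.smoothTransition.zero_of_nonpos (by linarith)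
  have d1 : ∀ x, x < 0 ∨ 1 < x → deriv χ x = 0 := by
    rintro x (hx | hx)
    · have : χ =ᶠ[𝓝 x] fun _ => 1 := by
        filter_upwards [Iio_mem_nhds hx] with y hy using h1 y (le_of_lt hy)
      rw [this.deriv_eq]
      simp
    · have : χ =ᶠ[𝓝 x] fun _ => 0 := by
        filter_upwards [Ioi_mem_nhds hx] with y hy using h0 y (le_of_lt hy)
      rw [this.deriv_eq]
      simp
  have d2 : ∀ x, x < 0 ∨ 1 < x → deriv (deriv χ) x = 0 := by
    rintro x (hx | hx)
    · have : deriv χ =ᶠ[𝓝 x] fun _ => 0 := by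
        filter_upwards [Iio_mem_nhds hx] with y hy using d1 y (Or.inl hy)
      rw [this.deriv_eq]
      simp
    · have : deriv χ =ᶠ[𝓝 x] fun _ => 0 := by
        filter_upwards [Ioi_mem_nhds hx] with y hy using d1 y (Or.inr hy)
      rw [this.deriv_eq]
      simp
  obtain ⟨C1, hC1⟩ := (isCompact_Icc (a := (0 : ℝ)) (b := 1)).exists_bound_of_continuousOn
    hc1.continuous.continuousOn
  obtain ⟨C2, hC2⟩ := (isCompact_Icc (a := (0 : ℝ)) (b := 1)).exists_bound_of_continuousOn
    hc2.continuous.continuousOn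
  have hout : ∀ x : ℝ, x ∉ Icc (0 : ℝ) 1 → x < 0 ∨ 1 < x := by
    intro x hx
    by_contra h
    push Not at h
    exact hx ⟨h.1, h.2⟩
  refine ⟨χ, hc, h1, h0, max 1 (max C1 C2), by positivity, fun x => ⟨?_, ?_, ?_⟩⟩
  · refine le_max_of_le_left ?_
    rw [abs_of_nonneg (Real.smoothTransition.nonneg _)]
    exact Real.smoothTransition.le_one _
  · by_cases hx : x ∈ Icc (0 : ℝ) 1
    · exact (hC1 x hx).trans ((le_max_left _ _).trans (le_max_right _ _))
    · rw [d1 x (hout x hx), abs_zero]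
      positivity
  · by_cases hx : x ∈ Icc (0 : ℝ) 1
    · exact (hC2 x hx).trans ((le_max_right _ _).trans (le_max_right _ _))
    · rw [d2 x (hout x hx), abs_zero]
      positivity

theorem integrable_exp_neg_mul_coshDist_mul {φ : ℍ → ℂ} (hφ : Measurable φ) {B : ℝ}
    (hB : ∀ w, ‖φ w‖ ≤ B) (z : ℍ) (s : ℝ) (hs : 0 < s) :
    Integrable fun w : ℍ => ((Real.exp (-(s * Real.cosh (dist z w))) : ℝ) : ℂ) * φ w := by
  have hm := measurable_cosh_dist z
  refine Integrable.mono' ((integrable_exp_neg_mul_coshDist z hs).mul_const B)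
    (Measurable.aestronglyMeasurable (by fun_prop)) (Eventually.of_forall fun w => ?_)
  rw [norm_mul, Complex.norm_real, Real.norm_of_nonneg (Real.exp_pos _).le]
  gcongr
  exact hB w

/-- This is the radial weak equation for `f(c) = exp (- s c)`, for which `(c² - 1) f'' + 2 c f' =
((c² - 1) s² - 2 s c) f`. As `f` has no compact support, it is multiplied by `χ (c - n)` and `n →
∞`. -/
theorem eigen_moment_equation {Φ : ℂ → ℂ} {lam : ℝ}
    (hΦ : ContDiffOn ℝ 2 Φ {z : ℂ | 0 < z.im})
    (hlam : ∀ w : ℂ, 0 < w.im →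
      -((w.im : ℂ) ^ 2) * (Laplacian.laplacian Φ : ℂ → ℂ) w = (lam : ℂ) * Φ w)
    {B : ℝ} (hB : ∀ w : ℍ, ‖Φ w‖ ≤ B) (z : ℍ) {s : ℝ} (hs : 0 < s) :
    (s : ℂ) ^ 2 * laplaceMoment volume (fun w : ℍ => Real.cosh (dist z w)) (fun w => Φ w) 2 s
      - 2 * s * laplaceMoment volume (fun w : ℍ => Real.cosh (dist z w)) (fun w => Φ w) 1 s
      = ((s : ℂ) ^ 2 - lam) *
        laplaceMoment volume (fun w : ℍ => Real.cosh (dist z w)) (fun w => Φ w) 0 s := by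
  have hφm : Measurable fun w : ℍ => Φ w :=
    (hΦ.continuousOn.comp_continuous UpperHalfPlane.continuous_coe fun w => w.im_pos).measurable
  have hcm := measurable_cosh_dist z
  have hint := integrable_exp_neg_mul_coshDist_mul hφm hB z
  have hc : ∀ w : ℍ, 1 ≤ Real.cosh (dist z w) := fun w => Real.one_le_cosh _
  have hj := fun j => integrable_laplaceMoment hcm hc hint j hs
  obtain ⟨χ, hχ, hχ1, hχ0, C, hC0, hC⟩ := exists_smooth_cutoff
  have hχd : Differentiable ℝ χ := hχ.differentiable (by norm_num)
  have hχ' : ContDiff ℝ 1 (deriv χ) := ((contDiff_succ_iff_deriv (n := 1)).mp (by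
      rw [one_add_one_eq_two]; exact hχ)).2.2
  have hχ'' : ContDiff ℝ 0 (deriv (deriv χ)) := ((contDiff_succ_iff_deriv (n := 0)).mp (by
      rw [zero_add]; exact hχ')).2.2
  have hχd' : Differentiable ℝ (deriv χ) := hχ'.differentiable (by norm_num)
  have hm0 : Measurable χ := hχ.continuous.measurable
  have hm1 : Measurable (deriv χ) := hχ'.continuous.measurable
  have hm2 : Measurable (deriv (deriv χ)) := hχ''.continuous.measurable
  set f : ℕ → ℝ → ℝ := fun n c => Real.exp (-(s * c)) * χ (c - n) with hf
  have hfc : ∀ n, ContDiff ℝ 2 (f n) := fun n =>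
    (Real.contDiff_exp.comp (contDiff_const.mul contDiff_id).neg).mul
      (hχ.comp (contDiff_id.sub contDiff_const))
  have he : ∀ c : ℝ, HasDerivAt (fun c => Real.exp (-(s * c))) (Real.exp (-(s * c)) * (-s)) c := by
    intro c
    simpa using ((hasDerivAt_id c).const_mul s).neg.exp
  have hsh : ∀ (g : ℝ → ℝ), Differentiable ℝ g → ∀ (n : ℕ) (c : ℝ),
      HasDerivAt (fun c => g (c - n)) (deriv g (c - n)) c := by
    intro g hg n c
    exact (hg (c - n)).hasDerivAt.comp_sub_const c n
  have hf1 : ∀ n c, deriv (f n) c =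
      Real.exp (-(s * c)) * (deriv χ (c - n) - s * χ (c - n)) := by
    intro n c
    refine HasDerivAt.deriv ?_
    convert! (he c).mul (hsh χ hχd n c) using 1
    ring
  have hf2 : ∀ n c, deriv (deriv (f n)) c = Real.exp (-(s * c)) *
      (deriv (deriv χ) (c - n) - 2 * s * deriv χ (c - n) + s ^ 2 * χ (c - n)) := by
    intro n c
    rw [funext (hf1 n)]
    refine HasDerivAt.deriv ?_
    convert! (he c).mul ((hsh _ hχd' n c).sub ((hsh χ hχd n c).const_mul s)) using 1
    simp only [Pi.sub_apply]
    ring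
  have hE : Measurable fun c : ℝ => Real.exp (-(s * c)) := by fun_prop
  have hms : ∀ g : ℝ → ℝ, Measurable g → ∀ n : ℕ, Measurable fun c : ℝ => g (c - n) :=
    fun g hg n => hg.comp (measurable_id.sub_const _)
  have hrad := fun n : ℕ => integral_mul_radial_laplacian hΦ hlam z (hfc n) (R := n + 1)
    (fun x hx => by simp only [hf]; rw [hχ0 _ (by linarith), mul_zero])
  have hlimL : Tendsto (fun n : ℕ => ∫ w : ℍ,
      (((Real.cosh (dist z w) ^ 2 - 1) * deriv (deriv (f n)) (Real.cosh (dist z w)) +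
        2 * Real.cosh (dist z w) * deriv (f n) (Real.cosh (dist z w)) : ℝ) : ℂ) * Φ w) atTop
      (𝓝 (∫ w : ℍ, (((Real.cosh (dist z w) ^ 2 - 1) *
        (Real.exp (-(s * Real.cosh (dist z w))) * s ^ 2) +
        2 * Real.cosh (dist z w) *
          (Real.exp (-(s * Real.cosh (dist z w))) * (-s)) : ℝ) : ℂ) * Φ w)) := by
    refine tendsto_integral_of_dominated_convergence (fun w =>
      -- The constant collects the bounds `C` for `χ` and its two derivatives in the product rule;
      -- the first order term is absorbed by `c ≤ c²`.
      (C * (1 + 2 * s + s ^ 2) + 2 * C * (1 + s)) *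
        ‖((Real.cosh (dist z w) ^ 2 * Real.exp (-(s * Real.cosh (dist z w))) : ℝ) : ℂ) * Φ w‖)
      (fun n => ?_) ((hj 2).norm.const_mul _) (fun n => Eventually.of_forall fun w => ?_)
      (Eventually.of_forall fun w => ?_)
    · simp only [hf2, hf1]
      have a0 := hms _ hm0 n
      have a1 := hms _ hm1 n
      have a2 := hms _ hm2 n
      have := (((measurable_id (α := ℝ)).pow_const 2).sub_const 1).mul
        (hE.mul ((a2.sub (a1.const_mul (2 * s))).add (a0.const_mul (s ^ 2))))
        |>.add ((measurable_id.const_mul 2).mul (hE.mul (a1.sub (a0.const_mul s))))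
      exact ((Complex.measurable_ofReal.comp (this.comp hcm)).mul hφm).aestronglyMeasurable
    · rw [norm_mul, norm_mul, ← mul_assoc]
      gcongr
      rw [Complex.norm_real, Complex.norm_real, hf2, hf1]
      set c := Real.cosh (dist z w) with hcdef
      have hc1 : 1 ≤ c := hc w
      obtain ⟨b0, b1, b2⟩ := hC (c - n)
      have hE := Real.exp_pos (-(s * c))
      rw [Real.norm_of_nonneg (show 0 ≤ c ^ 2 * Real.exp (-(s * c)) by positivity),
        Real.norm_eq_abs]
      have a1 : |deriv (deriv χ) (c - n) - 2 * s * deriv χ (c - n) + s ^ 2 * χ (c - n)|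
          ≤ C * (1 + 2 * s + s ^ 2) := by
        calc _ ≤ |deriv (deriv χ) (c - n)| + |2 * s * deriv χ (c - n)| + |s ^ 2 * χ (c - n)| :=
              (abs_add_le _ _).trans (by gcongr; exact abs_sub _ _)
          _ = |deriv (deriv χ) (c - n)| + 2 * s * |deriv χ (c - n)| + s ^ 2 * |χ (c - n)| := by
              rw [abs_mul (2 * s), abs_mul (s ^ 2), abs_of_pos (show 0 < 2 * s by positivity),
                abs_of_pos (show 0 < s ^ 2 by positivity)]
          _ ≤ C + 2 * s * C + s ^ 2 * C := by gcongr
          _ = _ := by ring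
      have a2 : |deriv χ (c - n) - s * χ (c - n)| ≤ C * (1 + s) := by
        calc _ ≤ |deriv χ (c - n)| + |s * χ (c - n)| := abs_sub _ _
          _ = |deriv χ (c - n)| + s * |χ (c - n)| := by rw [abs_mul, abs_of_pos hs]
          _ ≤ C + s * C := by gcongr
          _ = _ := by ring
      have a3 : c ≤ c ^ 2 := by nlinarith
      calc _ ≤ |(c ^ 2 - 1) * (Real.exp (-(s * c)) *
              (deriv (deriv χ) (c - n) - 2 * s * deriv χ (c - n) + s ^ 2 * χ (c - n)))| +
              |2 * c * (Real.exp (-(s * c)) * (deriv χ (c - n) - s * χ (c - n)))| :=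
            abs_add_le _ _
        _ = (c ^ 2 - 1) * (Real.exp (-(s * c)) *
              |deriv (deriv χ) (c - n) - 2 * s * deriv χ (c - n) + s ^ 2 * χ (c - n)|) +
              2 * c * (Real.exp (-(s * c)) * |deriv χ (c - n) - s * χ (c - n)|) := by
            rw [abs_mul (c ^ 2 - 1), abs_mul (2 * c), abs_mul (Real.exp _), abs_mul (Real.exp _),
              abs_of_pos hE,
              abs_of_nonneg (show 0 ≤ c ^ 2 - 1 by nlinarith),
              abs_of_pos (show 0 < 2 * c by linarith)]
        _ ≤ c ^ 2 * (Real.exp (-(s * c)) * (C * (1 + 2 * s + s ^ 2))) +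
              2 * c ^ 2 * (Real.exp (-(s * c)) * (C * (1 + s))) := by
            gcongr
            linarith
        _ = _ := by ring
    · refine Tendsto.mul_const _ ((Complex.continuous_ofReal.tendsto _).comp ?_)
      refine tendsto_const_nhds.congr' ?_
      obtain ⟨N, hN⟩ := exists_nat_gt (Real.cosh (dist z w))
      filter_upwards [eventually_ge_atTop N] with n hn
      have hneg : Real.cosh (dist z w) - n < 0 := by
        have : (N : ℝ) ≤ n := by exact_mod_cast hn
        linarith
      -- For `n > cosh d(z, w)` the cutoff is identically `1` near the point, so its derivatives
      -- drop out.
      have e0 : χ =ᶠ[𝓝 (Real.cosh (dist z w) - n)] fun _ => 1 := by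
        filter_upwards [Iio_mem_nhds hneg] with y hy using hχ1 y (le_of_lt hy)
      have e1 : deriv χ =ᶠ[𝓝 (Real.cosh (dist z w) - n)] fun _ => 0 := by
        filter_upwards [Iio_mem_nhds hneg] with y hy
        have : χ =ᶠ[𝓝 y] fun _ => 1 := by
          filter_upwards [Iio_mem_nhds hy] with x hx using hχ1 x (le_of_lt hx)
        rw [this.deriv_eq]
        simp
      rw [hf2, hf1, e1.deriv_eq, e1.eq_of_nhds, e0.eq_of_nhds]
      simp
  have hlimR : Tendsto (fun n : ℕ => -(lam : ℂ) * ∫ w : ℍ, (f n (Real.cosh (dist z w)) : ℂ) * Φ w)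
      atTop (𝓝 (-(lam : ℂ) * ∫ w : ℍ,
        ((Real.exp (-(s * Real.cosh (dist z w))) : ℝ) : ℂ) * Φ w)) := by
    refine Tendsto.const_mul _ ?_
    refine tendsto_integral_of_dominated_convergence (fun w =>
      C * ‖((Real.exp (-(s * Real.cosh (dist z w))) : ℝ) : ℂ) * Φ w‖)
      (fun n => ?_) ((hint s hs).norm.const_mul _) (fun n => Eventually.of_forall fun w => ?_)
      (Eventually.of_forall fun w => ?_)
    · exact ((Complex.measurable_ofReal.comp ((hE.mul (hms _ hm0 n)).comp hcm)).mul
        hφm).aestronglyMeasurable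
    · rw [norm_mul, norm_mul, ← mul_assoc]
      gcongr
      simp only [hf]
      rw [Complex.norm_real, Complex.norm_real, norm_mul, mul_comm]
      gcongr
      exact (hC _).1
    · refine Tendsto.mul_const _ ((Complex.continuous_ofReal.tendsto _).comp ?_)
      refine tendsto_const_nhds.congr' ?_
      obtain ⟨N, hN⟩ := exists_nat_gt (Real.cosh (dist z w))
      filter_upwards [eventually_ge_atTop N] with n hn
      have : (N : ℝ) ≤ n := by exact_mod_cast hn
      simp only [hf]
      rw [hχ1 _ (by linarith), mul_one]
  have key := tendsto_nhds_unique (hlimL.congr hrad) hlimR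
  have e0 : laplaceMoment volume (fun w : ℍ => Real.cosh (dist z w)) (fun w => Φ w) 0 s
      = ∫ w : ℍ, ((Real.exp (-(s * Real.cosh (dist z w))) : ℝ) : ℂ) * Φ w := by
    simp [laplaceMoment]
  have eL : ∫ w : ℍ, (((Real.cosh (dist z w) ^ 2 - 1) *
        (Real.exp (-(s * Real.cosh (dist z w))) * s ^ 2) +
        2 * Real.cosh (dist z w) *
          (Real.exp (-(s * Real.cosh (dist z w))) * (-s)) : ℝ) : ℂ) * Φ w =
      (s : ℂ) ^ 2 * laplaceMoment volume (fun w : ℍ => Real.cosh (dist z w)) (fun w => Φ w) 2 s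
      - 2 * s * laplaceMoment volume (fun w : ℍ => Real.cosh (dist z w)) (fun w => Φ w) 1 s
      - (s : ℂ) ^ 2 *
        laplaceMoment volume (fun w : ℍ => Real.cosh (dist z w)) (fun w => Φ w) 0 s := by
    have h21 := ((hj 2).const_mul ((s : ℂ) ^ 2)).sub ((hj 1).const_mul (2 * (s : ℂ)))
    simp only [Pi.sub_def] at h21
    rw [laplaceMoment, laplaceMoment, laplaceMoment, ← integral_const_mul, ← integral_const_mul,
      ← integral_const_mul, ← integral_sub ((hj 2).const_mul _) ((hj 1).const_mul _),
      ← integral_sub h21 ((hj 0).const_mul _)]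
    congr 1
    ext w
    push_cast
    ring
  rw [eL, ← e0] at key
  linear_combination key

/-! ### The radial equation -/

/-- Solutions of `h' = p / s²`, `p' = (s² - λ) h` on `s > 0`. -/
structure IsRadialSolution (lam : ℝ) (h p : ℝ → ℂ) : Prop where
  deriv_fst : ∀ s : ℝ, 0 < s → HasDerivAt h (p s / (s : ℂ) ^ 2) s
  deriv_snd : ∀ s : ℝ, 0 < s → HasDerivAt p (((s : ℂ) ^ 2 - lam) * h s) s

theorem IsRadialSolution.sub_const_mul {lam : ℝ} {h p g q : ℝ → ℂ}
    (hp : IsRadialSolution lam h p) (hq : IsRadialSolution lam g q) (C : ℂ) :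
    IsRadialSolution lam (fun s => h s - C * g s) (fun s => p s - C * q s) where
  deriv_fst s hs := by
    convert! (hp.deriv_fst s hs).sub ((hq.deriv_fst s hs).const_mul C) using 1
    ring
  deriv_snd s hs := by
    convert! (hp.deriv_snd s hs).sub ((hq.deriv_snd s hs).const_mul C) using 1
    ring

/-- Uniqueness for a linear system, run backwards from `s₀`. The singularity at `0` is harmless,
since the coefficients are bounded on `[s, s₀]`. -/
theorem IsRadialSolution.eq_zero {lam : ℝ} {h p : ℝ → ℂ} (hp : IsRadialSolution lam h p) {s₀ : ℝ}
    (h0 : h s₀ = 0) (p0 : p s₀ = 0) {s : ℝ} (hs : 0 < s) (hs₀ : s ≤ s₀) : h s = 0 := by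
  set v : ℝ → ℂ × ℂ → ℂ × ℂ := fun t x => (x.2 / (t : ℂ) ^ 2, ((t : ℂ) ^ 2 - lam) * x.1) with hv
  -- The sum of the suprema over `[s, s₀]` of the two coefficients `1 / t²` and `|t² - λ|`, the
  -- latter bounded by `s₀² + |λ|`.
  set K : NNReal := Real.toNNReal (1 / s ^ 2 + (s₀ ^ 2 + |lam|)) with hK
  have hKr : (K : ℝ) = 1 / s ^ 2 + (s₀ ^ 2 + |lam|) := Real.coe_toNNReal _ (by positivity)
  have hd : ∀ t, 0 < t → HasDerivAt (fun t => (h t, p t)) (v t (h t, p t)) t := fun t ht =>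
    (hp.deriv_fst t ht).prodMk (hp.deriv_snd t ht)
  have hLip : ∀ t ∈ Ioc s s₀, LipschitzOnWith K (v t) univ := by
    intro t ht
    have ht0 : 0 < t := hs.trans ht.1
    refine LipschitzWith.lipschitzOnWith (LipschitzWith.of_dist_le_mul fun x y => ?_)
    have e : v t x - v t y = v t (x - y) := by
      simp only [hv]
      ext <;> simp <;> ring
    rw [dist_eq_norm, dist_eq_norm, e, hKr]
    simp only [hv]
    have n1 : ‖(x - y).1‖ ≤ ‖x - y‖ := norm_fst_le _
    have n2 : ‖(x - y).2‖ ≤ ‖x - y‖ := norm_snd_le _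
    refine norm_prod_le_iff.mpr ⟨?_, ?_⟩
    · rw [norm_div, norm_pow, Complex.norm_real, Real.norm_of_nonneg ht0.le, div_eq_mul_one_div,
        mul_comm]
      refine mul_le_mul ?_ n2 (norm_nonneg _) (by positivity)
      have : 1 / t ^ 2 ≤ 1 / s ^ 2 := by
        have := ht.1.le
        gcongr
      have h2 : 0 ≤ s₀ ^ 2 + |lam| := by positivity
      linarith
    · rw [norm_mul]
      refine mul_le_mul ?_ n1 (norm_nonneg _) (by positivity)
      have h1 : ‖(t : ℂ) ^ 2 - lam‖ ≤ t ^ 2 + |lam| := by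
        refine (norm_sub_le _ _).trans ?_
        rw [norm_pow, Complex.norm_real, Complex.norm_real, Real.norm_of_nonneg ht0.le,
          Real.norm_eq_abs]
      have h2 : t ^ 2 ≤ s₀ ^ 2 := by
        have := ht.2
        gcongr
      have h3 : 0 ≤ 1 / s ^ 2 := by positivity
      linarith
  have huniq := ODE_solution_unique_of_mem_Icc_left (v := v) (s := fun _ => univ) (K := K)
    (f := fun t => (h t, p t)) (g := fun _ => (0, 0)) (a := s) (b := s₀) hLip
    (fun t ht => (hd t (hs.trans_le ht.1)).continuousAt.continuousWithinAt)
    (fun t ht => (hd t (hs.trans ht.1)).hasDerivWithinAt) (fun _ _ => mem_univ _)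
    continuousOn_const
    (fun t _ => by
      have : v t (0, 0) = 0 := by simp [hv]
      simp only [this]
      exact (hasDerivAt_const t ((0 : ℂ), (0 : ℂ))).hasDerivWithinAt)
    (fun _ _ => mem_univ _) (by simp [h0, p0])
  exact congrArg Prod.fst (huniq (left_mem_Icc.mpr hs₀))

theorem eqOn_const_of_hasDerivAt_zero {W : ℝ → ℂ} {a : ℝ} (h : ∀ s, a < s → HasDerivAt W 0 s)
    {s t : ℝ} (hs : a < s) (ht : a < t) : W s = W t := by
  refine (convex_Ioi a).is_const_of_fderivWithin_eq_zero (𝕜 := ℝ) (s := Ioi a)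
    (fun x hx => (h x hx).differentiableAt.differentiableWithinAt) (fun x hx => ?_) hs ht
  rw [fderivWithin_of_isOpen isOpen_Ioi hx]
  ext
  simp [(h x hx).deriv]

/-- The Wronskian `p g - q h` is constant and tends to `0`, hence vanishes, so `h / g` is constant
where `g ≠ 0` is known. Backward uniqueness carries the proportionality to all `s > 0`, even past
possible zeros of `g`. -/
theorem IsRadialSolution.exists_const_mul {lam : ℝ} {h p g q : ℝ → ℂ}
    (hp : IsRadialSolution lam h p) (hq : IsRadialSolution lam g q)
    (hW : Tendsto (fun s => p s * g s - q s * h s) atTop (𝓝 0)) {S : ℝ} (hS : 0 < S)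
    (hg : ∀ s, S ≤ s → g s ≠ 0) : ∃ C : ℂ, ∀ s, 0 < s → h s = C * g s := by
  have hWd : ∀ s : ℝ, 0 < s → HasDerivAt (fun s => p s * g s - q s * h s) 0 s := by
    intro s hs
    convert! ((hp.deriv_snd s hs).mul (hq.deriv_fst s hs)).sub
      ((hq.deriv_snd s hs).mul (hp.deriv_fst s hs)) using 1
    ring
  have hW0 : ∀ s : ℝ, 0 < s → p s * g s - q s * h s = 0 := by
    intro s hs
    refine tendsto_nhds_unique (tendsto_const_nhds.congr' ?_) hW
    filter_upwards [eventually_gt_atTop 0] with t ht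
    exact eqOn_const_of_hasDerivAt_zero hWd hs ht
  have hQd : ∀ s : ℝ, S < s → HasDerivAt (fun s => h s / g s) 0 s := by
    intro s hs
    have hs0 : 0 < s := hS.trans hs
    convert! (hp.deriv_fst s hs0).div (hq.deriv_fst s hs0) (hg s hs.le) using 1
    have : p s / (s : ℂ) ^ 2 * g s - h s * (q s / (s : ℂ) ^ 2)
        = (p s * g s - q s * h s) / (s : ℂ) ^ 2 := by ring
    rw [this, hW0 s hs0]
    simp
  refine ⟨h (S + 1) / g (S + 1), fun s hs => ?_⟩
  set C := h (S + 1) / g (S + 1) with hC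
  have hlarge : ∀ s, S < s → h s = C * g s := by
    intro s hs
    have := eqOn_const_of_hasDerivAt_zero hQd hs (show S < S + 1 by linarith)
    rw [hC, ← this, div_mul_cancel₀ _ (hg s hs.le)]
  have hD := hp.sub_const_mul hq C
  by_cases hsS : S < s
  · exact hlarge s hsS
  · have hS1 : (0 : ℝ) < S + 1 := by linarith
    have hz : (fun s => h s - C * g s) =ᶠ[𝓝 (S + 1)] fun _ => 0 := by
      filter_upwards [Ioi_mem_nhds (show S < S + 1 by linarith)] with t ht
      rw [hlarge t ht, sub_self]
    -- The difference vanishes in a neighbourhood of `S + 1`, so its derivative does too; this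
    -- provides both initial values.
    have hpz : p (S + 1) - C * q (S + 1) = 0 := by
      have h1 := (hD.deriv_fst (S + 1) hS1).congr_of_eventuallyEq hz.symm
      have h2 := h1.unique (hasDerivAt_const (S + 1) (0 : ℂ))
      rcases div_eq_zero_iff.mp h2 with h3 | h3
      · exact h3
      · exfalso
        have : ((S + 1 : ℝ) : ℂ) ≠ 0 := by exact_mod_cast hS1.ne'
        exact this (pow_eq_zero_iff (two_ne_zero) |>.mp h3)
    have := hD.eq_zero hz.eq_of_nhds hpz hs (by linarith [not_lt.mp hsS])
    exact sub_eq_zero.mp this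

end
-- Selberg's principle: the eigenvalue of the point-pair invariant is a `K`-Bessel function.
section

/-- The factor `s^(-1/2)` turns the Bessel equation into `(s² h')' = (s² - λ) h` with `λ = 1/4 -
ν²`. The second component is `s² h'`, written with `K_ν' = - L₁ / 2`, where `L₁` is the first
moment. -/
theorem isRadialSolution_besselK {lam : ℝ} {ν : ℂ} (hν : (lam : ℂ) = 1 / 4 - ν ^ 2) :
    IsRadialSolution lam (fun s => ((√s : ℝ) : ℂ)⁻¹ * besselK ν s)
      (fun s => -(s * ((√s : ℝ) : ℂ) *
          (laplaceMoment volume Real.cosh (fun u : ℝ => Complex.exp (ν * u)) 1 s / 2)) -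
        ((√s : ℝ) : ℂ) / 2 * besselK ν s) := by
  set L := fun j => laplaceMoment volume Real.cosh (fun u : ℝ => Complex.exp (ν * u)) j with hL
  have hK : ∀ s : ℝ, 0 < s → HasDerivAt (besselK ν) (-(L 1 s / 2)) s := by
    intro s hs
    have h := (hasDerivAt_besselK_moment ν 0 hs).const_mul (1 / 2 : ℂ)
    have e : besselK ν = fun s => (1 / 2 : ℂ) * L 0 s :=
      funext fun s => besselK_eq_laplaceMoment ν s
    rw [e]
    convert! h using 1
    simp only [hL]
    ring
  have hL1 : ∀ s : ℝ, 0 < s → HasDerivAt (L 1) (-L 2 s) s := fun s hs =>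
    hasDerivAt_besselK_moment ν 1 hs
  have hq : ∀ s : ℝ, 0 < s → HasDerivAt (fun s : ℝ => ((√s : ℝ) : ℂ)) (1 / (2 * (√s : ℝ)) : ℂ) s := by
    intro s hs
    have := (Real.hasDerivAt_sqrt hs.ne').ofReal_comp
    simpa using this
  have hid : ∀ s : ℝ, HasDerivAt (fun s : ℝ => (s : ℂ)) 1 s := fun s => by
    simpa using (hasDerivAt_id s).ofReal_comp
  constructor
  · intro s hs
    have hq0 : ((√s : ℝ) : ℂ) ≠ 0 := by exact_mod_cast (Real.sqrt_pos.mpr hs).ne'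
    have hqq : (s : ℂ) = ((√s : ℝ) : ℂ) ^ 2 := by exact_mod_cast (Real.sq_sqrt hs.le).symm
    convert! ((hq s hs).inv hq0).mul (hK s hs) using 1
    simp only [Pi.inv_apply]
    set q := ((√s : ℝ) : ℂ)
    rw [hqq]
    field_simp
    ring
  · intro s hs
    have hq0 : ((√s : ℝ) : ℂ) ≠ 0 := by exact_mod_cast (Real.sqrt_pos.mpr hs).ne'
    have hqq : (s : ℂ) = ((√s : ℝ) : ℂ) ^ 2 := by exact_mod_cast (Real.sq_sqrt hs.le).symm
    convert! (((hid s).mul (hq s hs)).mul ((hL1 s hs).div_const 2)).neg.sub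
      (((hq s hs).div_const 2).mul (hK s hs)) using 1
    have heq := besselK_moment_equation ν hs
    have e0 : besselK ν s = L 0 s / 2 := by
      rw [besselK_eq_laplaceMoment]
      ring
    have heq' : (s : ℂ) ^ 2 * L 2 s = s * L 1 s + (s ^ 2 + ν ^ 2) * L 0 s := by
      linear_combination heq
    rw [hν, e0]
    simp only [Pi.mul_apply]
    set q := ((√s : ℝ) : ℂ)
    have e2 : L 2 s = (s * L 1 s + (s ^ 2 + ν ^ 2) * L 0 s) / s ^ 2 := by
      rw [← heq', mul_div_cancel_left₀]
      exact pow_ne_zero _ (by exact_mod_cast hs.ne')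
    rw [e2, hqq]
    field_simp
    ring

theorem tendsto_pow_mul_exp_neg_zero {W : ℝ → ℂ} {C : ℝ} (n : ℕ)
    (h : ∀ s : ℝ, 1 ≤ s → ‖W s‖ ≤ C * (s ^ n * Real.exp (-s))) : Tendsto W atTop (𝓝 0) := by
  rw [tendsto_zero_iff_norm_tendsto_zero]
  have := (Real.tendsto_pow_mul_exp_neg_atTop_nhds_zero n).const_mul C
  rw [mul_zero] at this
  refine squeeze_zero' (Eventually.of_forall fun _ => norm_nonneg _) ?_ this
  filter_upwards [eventually_ge_atTop 1] with s hs using h s hs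

/-- **Selberg's lemma** for the point-pair invariant `exp (- s cosh d(z, w))`. -/
theorem integral_exp_neg_mul_coshDist_mul_eigen {Φ : ℂ → ℂ} {lam : ℝ} {r : ℂ}
    (hΦ : ContDiffOn ℝ 2 Φ {z : ℂ | 0 < z.im})
    (hlam : ∀ w : ℂ, 0 < w.im →
      -((w.im : ℂ) ^ 2) * (Laplacian.laplacian Φ : ℂ → ℂ) w = (lam : ℂ) * Φ w)
    {B : ℝ} (hB : ∀ w : ℍ, ‖Φ w‖ ≤ B) (hr : (lam : ℂ) = 1 / 4 + r ^ 2) (z : ℍ) {s : ℝ}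
    (hs : 0 < s) :
    ∫ w : ℍ, ((Real.exp (-(s * Real.cosh (dist z w))) : ℝ) : ℂ) * Φ w
      = ((2 * √(2 * Real.pi / s) : ℝ) : ℂ) * besselK (Complex.I * r) s * Φ z := by
  have hφc : Continuous fun w : ℍ => Φ w :=
    hΦ.continuousOn.comp_continuous UpperHalfPlane.continuous_coe fun w => w.im_pos
  have hcm := measurable_cosh_dist z
  have hint := integrable_exp_neg_mul_coshDist_mul hφc.measurable hB z
  have hc : ∀ w : ℍ, 1 ≤ Real.cosh (dist z w) := fun w => Real.one_le_cosh _
  set L := fun j => laplaceMoment volume (fun w : ℍ => Real.cosh (dist z w)) (fun w => Φ w) j with hL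
  set ν := Complex.I * r with hν
  have hνlam : (lam : ℂ) = 1 / 4 - ν ^ 2 := by
    rw [hr, hν, mul_pow, Complex.I_sq]
    ring
  -- The second component is `s² h'`, since `h' = - L 1`; its derivative is computed by the moment
  -- equation.
  have hsol : IsRadialSolution lam (L 0) (fun s => -((s : ℂ) ^ 2 * L 1 s)) := by
    constructor
    · intro s hs
      have hs0 : (s : ℂ) ≠ 0 := by exact_mod_cast hs.ne'
      convert! hasDerivAt_laplaceMoment hcm hc hint 0 hs using 1
      simp only [hL]
      field_simp
    · intro s hs
      have hid : HasDerivAt (fun s : ℝ => (s : ℂ)) 1 s := by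
        simpa using (hasDerivAt_id s).ofReal_comp
      convert! ((hid.pow 2).mul (hasDerivAt_laplaceMoment hcm hc hint 1 hs)).neg using 1
      have := eigen_moment_equation hΦ hlam hB z hs
      simp only [hL, Pi.pow_apply]
      rw [← this]
      push_cast
      ring
  have hsolK := isRadialSolution_besselK hνlam
  obtain ⟨C0, hC0, hL0⟩ := norm_laplaceMoment_le hcm hc hint 0
  obtain ⟨C1, hC1, hL1⟩ := norm_laplaceMoment_le hcm hc hint 1
  have hccm := Real.continuous_cosh.measurable
  obtain ⟨D0, hD0, hK0⟩ := norm_laplaceMoment_le hccm Real.one_le_cosh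
    (integrable_exp_cosh_mul_cexp ν) 0
  obtain ⟨D1, hD1, hK1⟩ := norm_laplaceMoment_le hccm Real.one_le_cosh
    (integrable_exp_cosh_mul_cexp ν) 1
  have hKb : ∀ s : ℝ, 1 ≤ s → ‖besselK ν s‖ ≤ D0 * Real.exp (-s) := by
    intro s hs
    rw [besselK_eq_laplaceMoment, norm_mul]
    have h2 := hK0 s hs
    have h3 : ‖(1 / 2 : ℂ)‖ = 1 / 2 := by norm_num
    rw [h3]
    linarith [norm_nonneg (laplaceMoment volume Real.cosh (fun u : ℝ => Complex.exp (ν * u)) 0 s)]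
  -- Every product in the Wronskian contains two factors of size `exp (- s)`. One of them is kept,
  -- the other is bounded by `1`, and the powers of `s` are at most `s²`.
  have hW := tendsto_pow_mul_exp_neg_zero (C := C1 * D0 + (D1 + D0) * C0) 2
    (W := fun s => -((s : ℂ) ^ 2 * L 1 s) * (((√s : ℝ) : ℂ)⁻¹ * besselK ν s) -
      (-(s * ((√s : ℝ) : ℂ) *
          (laplaceMoment volume Real.cosh (fun u : ℝ => Complex.exp (ν * u)) 1 s / 2)) -
        ((√s : ℝ) : ℂ) / 2 * besselK ν s) * L 0 s) (fun s hs => by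
    have hs0 : 0 < s := by linarith
    have hq1 : 1 ≤ √s := Real.one_le_sqrt.mpr hs
    have hqs : √s ≤ s := by
      rw [Real.sqrt_le_left hs0.le]
      nlinarith
    have hE := Real.exp_pos (-s)
    have hE1 : Real.exp (-s) ≤ 1 := Real.exp_le_one_iff.mpr (by linarith)
    have a1 : ‖-((s : ℂ) ^ 2 * L 1 s) * (((√s : ℝ) : ℂ)⁻¹ * besselK ν s)‖ ≤
        s ^ 2 * (C1 * Real.exp (-s)) * (1 * (D0 * 1)) := by
      rw [norm_mul, norm_neg, norm_mul, norm_pow, norm_mul, norm_inv, Complex.norm_real,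
        Complex.norm_real, Real.norm_of_nonneg hs0.le, Real.norm_of_nonneg (by positivity)]
      gcongr
      · exact hL1 s hs
      · exact inv_le_one_of_one_le₀ hq1
      · exact (hKb s hs).trans (by gcongr)
    have a2 : ‖(s * ((√s : ℝ) : ℂ) *
          (laplaceMoment volume Real.cosh (fun u : ℝ => Complex.exp (ν * u)) 1 s / 2))‖ ≤
        s * s * (D1 * Real.exp (-s) / 1) := by
      rw [norm_mul, norm_mul, norm_div, Complex.norm_real,
        Complex.norm_real, Real.norm_of_nonneg hs0.le, Real.norm_of_nonneg (Real.sqrt_nonneg _),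
        Complex.norm_ofNat]
      gcongr
      · exact hK1 s hs
      · norm_num
    have a3 : ‖((√s : ℝ) : ℂ) / 2 * besselK ν s‖ ≤ s * s * (D0 * Real.exp (-s)) := by
      rw [norm_mul, norm_div, Complex.norm_real, Real.norm_of_nonneg (Real.sqrt_nonneg _),
        Complex.norm_ofNat]
      have : √s / 2 ≤ s * s := by nlinarith
      gcongr
      exact hKb s hs
    have a4 : ‖L 0 s‖ ≤ C0 * 1 := (hL0 s hs).trans (by gcongr)
    calc _ ≤ ‖-((s : ℂ) ^ 2 * L 1 s) * (((√s : ℝ) : ℂ)⁻¹ * besselK ν s)‖ +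
          (‖(s * ((√s : ℝ) : ℂ) *
          (laplaceMoment volume Real.cosh (fun u : ℝ => Complex.exp (ν * u)) 1 s / 2))‖ +
          ‖((√s : ℝ) : ℂ) / 2 * besselK ν s‖) * ‖L 0 s‖ := by
          refine (norm_sub_le _ _).trans ?_
          rw [norm_mul _ (L 0 s)]
          gcongr
          refine (norm_sub_le _ _).trans ?_
          rw [norm_neg]
      _ ≤ s ^ 2 * (C1 * Real.exp (-s)) * (1 * (D0 * 1)) +
          (s * s * (D1 * Real.exp (-s) / 1) + s * s * (D0 * Real.exp (-s))) * (C0 * 1) := by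
          gcongr
      _ = _ := by ring)
  have hasymp := sqrt_mul_exp_mul_besselK_tendsto ν
  have hpi : 0 < Real.pi := Real.pi_pos
  have hne : ((√(Real.pi / 2) : ℝ) : ℂ) ≠ 0 := by
    exact_mod_cast (Real.sqrt_pos.mpr (by positivity)).ne'
  -- The asymptotics of `K_ν` exclude zeros for large `s`.
  obtain ⟨S, hS⟩ := eventually_atTop.mp (hasymp.eventually_ne hne)
  obtain ⟨C, hC⟩ := hsol.exists_const_mul hsolK hW (S := max S 1) (by positivity) (by
    intro s hs
    have hs0 : 0 < s := lt_of_lt_of_le (by positivity) hs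
    have hq0 : ((√s : ℝ) : ℂ) ≠ 0 := by exact_mod_cast (Real.sqrt_pos.mpr hs0).ne'
    exact mul_ne_zero (inv_ne_zero hq0) (right_ne_zero_of_mul (hS s ((le_max_left _ _).trans hs))))
  have hconc := tendsto_laplaceMoment_div (μ := volume) (c := fun w : ℍ => Real.cosh (dist z w))
    (f := fun w : ℍ => Φ w) hint
    (fun s hs => integrable_exp_neg_mul_coshDist z hs) (κ := 2 * Real.pi) (by positivity)
    (fun s hs => (integral_exp_neg_mul_coshDist z (by linarith)).ge) (f₀ := Φ z) (fun ε hε => by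
      obtain ⟨d, hd, hd'⟩ := Metric.continuousAt_iff.mp (hφc.continuousAt (x := z)) ε hε
      refine ⟨d ^ 2 / 2, by positivity, fun w hw => ?_⟩
      have h1 := one_add_sq_div_two_le_cosh (dist z w)
      have h2 : dist z w < d := lt_of_pow_lt_pow_left₀ 2 hd.le (by linarith)
      rw [dist_comm] at h2
      have := hd' h2
      rw [dist_eq_norm] at this
      exact this.le)
  -- The same quotient, computed from `h = C s^(-1/2) K_ν`, has a limit proportional to `C`;
  -- comparison with the limit `Φ z` from concentration determines `C`.
  have hconc2 : Tendsto (fun s : ℝ => laplaceMoment volume (fun w : ℍ => Real.cosh (dist z w))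
      (fun w => Φ w) 0 s / ((∫ a, Real.exp (-(s * Real.cosh (dist z a))) : ℝ) : ℂ)) atTop
      (𝓝 (C * (1 / (2 * Real.pi)) * ((√(Real.pi / 2) : ℝ) : ℂ))) := by
    refine (hasymp.const_mul (C * (1 / (2 * Real.pi)))).congr' ?_
    filter_upwards [eventually_gt_atTop 0] with s hs
    have hq0 : ((√s : ℝ) : ℂ) ≠ 0 := by exact_mod_cast (Real.sqrt_pos.mpr hs).ne'
    have hqq : (s : ℂ) = ((√s : ℝ) : ℂ) ^ 2 := by exact_mod_cast (Real.sq_sqrt hs.le).symm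
    have h1 := hC s hs
    simp only [hL] at h1
    have hpi' : (Real.pi : ℂ) ≠ 0 := by exact_mod_cast hpi.ne'
    have hexp : ((Real.exp (-s) : ℝ) : ℂ) = ((Real.exp s : ℝ) : ℂ)⁻¹ := by
      rw [Real.exp_neg]
      push_cast
      rfl
    have hE0 : ((Real.exp s : ℝ) : ℂ) ≠ 0 := by exact_mod_cast (Real.exp_pos s).ne'
    rw [h1, integral_exp_neg_mul_coshDist z hs]
    simp only [Complex.ofReal_mul, Complex.ofReal_div, hexp, Complex.ofReal_ofNat]
    set q := ((√s : ℝ) : ℂ)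
    rw [hqq]
    field_simp
  have hCz := tendsto_nhds_unique hconc hconc2
  have e0 : L 0 s = ∫ w : ℍ, ((Real.exp (-(s * Real.cosh (dist z w))) : ℝ) : ℂ) * Φ w := by
    simp [hL, laplaceMoment]
  rw [← e0, hC s hs, hCz]
  have hsq : √(2 * Real.pi / s) * √(Real.pi / 2) = Real.pi / √s := by
    rw [← Real.sqrt_mul (by positivity), show 2 * Real.pi / s * (Real.pi / 2) = Real.pi ^ 2 / s by
      field_simp, Real.sqrt_div (by positivity), Real.sqrt_sq hpi.le]
  have hsq' : ((√(2 * Real.pi / s) : ℝ) : ℂ) * ((√(Real.pi / 2) : ℝ) : ℂ)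
      = Real.pi / ((√s : ℝ) : ℂ) := by exact_mod_cast hsq
  have hpi' : (Real.pi : ℂ) ≠ 0 := by exact_mod_cast hpi.ne'
  rw [Complex.ofReal_mul, Complex.ofReal_ofNat,
    show (2 : ℂ) * ((√(2 * Real.pi / s) : ℝ) : ℂ) * besselK ν s *
      (C * (1 / (2 * Real.pi)) * ((√(Real.pi / 2) : ℝ) : ℂ)) =
      2 * besselK ν s * C * (1 / (2 * Real.pi)) * (((√(2 * Real.pi / s) : ℝ) : ℂ) *
      ((√(Real.pi / 2) : ℝ) : ℂ)) by ring, hsq']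
  field_simp

end
section

/-! ### Unfolding -/

theorem SL_neg_one_smul (z : ℍ) : (-1 : SL(2, ℝ)) • z = z := by
  ext1
  rw [UpperHalfPlane.coe_specialLinearGroup_apply]
  simp

instance : SMulInvariantMeasure SL(2, ℝ) ℍ volume :=
  ⟨fun g _ hs => SMulInvariantMeasure.measure_preimage_smul (g : GL (Fin 2) ℝ) hs⟩

section

variable {Γ : Subgroup SL(2, ℝ)}

theorem dist_smul_smul_subgroup (γ : Γ) (z w : ℍ) : dist (γ • z) (γ • w) = dist z w :=
  dist_smul (γ : SL(2, ℝ)) z w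

theorem dist_smul_left_eq (γ : Γ) (z w : ℍ) : dist (γ • z) w = dist z (γ⁻¹ • w) := by
  rw [← dist_smul_smul_subgroup γ⁻¹, inv_smul_smul]

theorem IsSurfaceGroup.countable (hΓ : IsSurfaceGroup Γ) : Countable Γ := by
  have := hΓ.discrete
  have : SecondCountableTopology (Matrix (Fin 2) (Fin 2) ℝ) :=
    inferInstanceAs (SecondCountableTopology (Fin 2 → Fin 2 → ℝ))
  have h1 : SecondCountableTopology SL(2, ℝ) :=
    Topology.IsInducing.secondCountableTopology (f := fun g : SL(2, ℝ) => g.1) ⟨rfl⟩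
  exact countable_of_Lindelof_of_discrete

/-- The group of isometries of `ℍ` defined by `Γ`. -/
abbrev isometryGroup (Γ : Subgroup SL(2, ℝ)) : Subgroup (Equiv.Perm ℍ) :=
  (MulAction.toPermHom Γ ℍ).range

theorem exists_smul_eq_isometryGroup (p : isometryGroup Γ) : ∃ γ : Γ, ∀ z : ℍ, p • z = γ • z := by
  obtain ⟨p, γ, rfl⟩ := p
  exact ⟨γ, fun z => rfl⟩

theorem smul_eq_of_eq_or_eq_neg {g h : SL(2, ℝ)} (H : g⁻¹ * h = 1 ∨ g⁻¹ * h = -1) (z : ℍ) :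
    h • z = g • z := by
  have : h = g * (g⁻¹ * h) := by group
  rw [this, mul_smul]
  rcases H with H | H
  · rw [H, one_smul]
  · rw [H, SL_neg_one_smul]

/-- Since `-1` acts trivially, uniqueness of the translating element fails in `Γ`. It holds in the
group of isometries, because point stabilizers in `Γ` are contained in `± 1`. -/
theorem IsSurfaceGroup.isFundamentalDomain (hΓ : IsSurfaceGroup Γ) {F : Set ℍ}
    (hF : IsFundamentalSet Γ F) : IsFundamentalDomain (isometryGroup Γ) F volume := by
  refine IsFundamentalDomain.mk' hF.measurableSet.nullMeasurableSet fun z => ?_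
  obtain ⟨w, ⟨hwF, γ, hγ⟩, huniq⟩ := hF.existsUnique z
  refine ⟨⟨MulAction.toPermHom Γ ℍ γ, γ, rfl⟩, ?_, fun p hp => ?_⟩
  · have : γ • z ∈ F := by rw [show γ • z = w from hγ]; exact hwF
    exact this
  · obtain ⟨p, γ', rfl⟩ := p
    have h1 : γ' • z = w := huniq _ ⟨hp, γ', rfl⟩
    have h2 : (γ⁻¹ * γ') • z = z := by
      rw [mul_smul, h1, ← show γ • z = w from hγ, inv_smul_smul]
    have h3 := hΓ.free _ (γ⁻¹ * γ').2 z h2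
    refine Subtype.ext (Equiv.ext fun x => ?_)
    exact smul_eq_of_eq_or_eq_neg h3 x

/-- Each isometry has exactly two preimages `± γ` in `Γ`; this is the source of the factors `2` and
`1 / 2` below. -/
theorem IsSurfaceGroup.tsum_smul_eq (hΓ : IsSurfaceGroup Γ) (f : ℍ → ENNReal) (z : ℍ) :
    ∑' γ : Γ, f (γ • z) = 2 * ∑' p : isometryGroup Γ, f (p • z) := by
  choose σ hσ using exists_smul_eq_isometryGroup (Γ := Γ)
  set ι : Γ := ⟨-1, hΓ.neg_one_mem⟩ with hι
  have hιz : ∀ (γ : Γ) (z : ℍ), (γ * ι) • z = γ • z := by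
    intro γ z
    rw [mul_smul]
    congr 1
    exact SL_neg_one_smul z
  have hbij : Function.Bijective fun x : isometryGroup Γ × Bool =>
      if x.2 then σ x.1 else σ x.1 * ι := by
    constructor
    · rintro ⟨p, b⟩ ⟨q, c⟩ h
      have hz : ∀ (p : isometryGroup Γ) (b : Bool) (z : ℍ),
          (if b then σ p else σ p * ι) • z = p • z := by
        intro p b z
        cases b
        · simp only [Bool.false_eq_true, if_false]
          rw [hιz, hσ]
        · simp only [if_true]
          rw [hσ]
      have hpq : p = q := by
        refine Subtype.ext (Equiv.ext fun z => ?_)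
        have h1 := hz p b z
        simp only at h
        rw [h, hz q c z] at h1
        exact h1.symm
      subst hpq
      have hne : σ p ≠ σ p * ι := by
        intro h
        have h1 : ι = 1 := by simpa using h.symm
        have h2 := congrArg (fun g : Γ => (g : SL(2, ℝ)) 0 0) h1
        simp [hι] at h2
        norm_num at h2
      cases b <;> cases c <;> simp_all
    · intro γ
      set p : isometryGroup Γ := ⟨MulAction.toPermHom Γ ℍ γ, γ, rfl⟩ with hp
      have h1 : (((σ p)⁻¹ * γ : Γ) : SL(2, ℝ)) • UpperHalfPlane.I = UpperHalfPlane.I := by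
        have : ((σ p)⁻¹ * γ) • UpperHalfPlane.I = UpperHalfPlane.I := by
          rw [mul_smul, inv_smul_eq_iff, ← hσ]
          rfl
        exact this
      rcases hΓ.free _ ((σ p)⁻¹ * γ).2 _ h1 with h | h
      · refine ⟨(p, true), ?_⟩
        simp only [if_true]
        have : (σ p)⁻¹ * γ = 1 := Subtype.ext h
        exact inv_mul_eq_one.mp this
      · refine ⟨(p, false), ?_⟩
        simp only [Bool.false_eq_true, if_false]
        have : (σ p)⁻¹ * γ = ι := Subtype.ext h
        rw [← this]
        group
  rw [← (Equiv.ofBijective _ hbij).tsum_eq, ENNReal.tsum_prod', ← ENNReal.tsum_mul_left]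
  refine tsum_congr fun p => ?_
  rw [tsum_bool]
  simp only [Equiv.ofBijective_apply, Bool.false_eq_true, if_false, if_true]
  rw [hιz, ← hσ, two_mul]

theorem IsSurfaceGroup.two_mul_lintegral (hΓ : IsSurfaceGroup Γ) {F : Set ℍ}
    (hF : IsFundamentalSet Γ F) {f : ℍ → ENNReal} (hf : Measurable f) :
    2 * ∫⁻ z : ℍ, f z = ∫⁻ z in F, ∑' γ : Γ, f (γ • z) := by
  have := hΓ.countable
  have hcount : Countable (isometryGroup Γ) := by
    refine Function.Surjective.countable (f := (MulAction.toPermHom Γ ℍ).rangeRestrict) ?_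
    exact MonoidHom.rangeRestrict_surjective _
  have hm : MeasurableConstSMul (isometryGroup Γ) ℍ := ⟨fun p => by
    obtain ⟨γ, hγ⟩ := exists_smul_eq_isometryGroup p
    have : (p • · : ℍ → ℍ) = fun z => γ • z := funext hγ
    rw [this]
    exact measurable_const_smul γ⟩
  have hinv : SMulInvariantMeasure (isometryGroup Γ) ℍ volume := ⟨fun p s hs => by
    obtain ⟨γ, hγ⟩ := exists_smul_eq_isometryGroup p
    have : (p • · : ℍ → ℍ) = fun z => (γ : SL(2, ℝ)) • z := funext hγ
    rw [this]
    exact SMulInvariantMeasure.measure_preimage_smul (γ : SL(2, ℝ)) hs⟩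
  have hfm : ∀ p : isometryGroup Γ, AEMeasurable (fun z => f (p • z)) (volume.restrict F) :=
    fun p => (hf.comp (measurable_const_smul p)).aemeasurable
  rw [(hΓ.isFundamentalDomain hF).lintegral_eq_tsum'' f, ← lintegral_tsum hfm,
    ← lintegral_const_mul']
  · simp only [hΓ.tsum_smul_eq]
  · norm_num

/-! ### The automorphic kernel -/

theorem exp_neg_mul_cosh_le (a b : ℝ) (hb : 0 ≤ b) :
    Real.exp (-b) * Real.cosh (a + b) ≤ Real.cosh a := by
  rw [Real.cosh_eq, Real.cosh_eq, mul_div_assoc', mul_add, ← Real.exp_add, ← Real.exp_add]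
  have h1 : Real.exp (-b + (a + b)) = Real.exp a := by ring_nf
  have h2 : Real.exp (-b + -(a + b)) ≤ Real.exp (-a) := Real.exp_le_exp.mpr (by linarith)
  rw [h1]
  linarith

/-- Moving a point by a distance at most `D` changes `cosh d` by a factor at most `e ^ D`. -/
theorem exp_neg_mul_cosh_dist_le {s D : ℝ} (hs : 0 < s) {x y z w : ℍ}
    (h : dist x y ≤ dist z w + D) (hD : 0 ≤ D) :
    Real.exp (-(s * Real.cosh (dist z w))) ≤
      Real.exp (-(s * Real.exp (-D) * Real.cosh (dist x y))) := by
  apply Real.exp_le_exp.mpr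
  have h1 : Real.cosh (dist x y) ≤ Real.cosh (dist z w + D) := by
    rw [Real.cosh_le_cosh, abs_of_nonneg dist_nonneg, abs_of_nonneg (by positivity)]
    exact h
  have h2 := exp_neg_mul_cosh_le (dist z w) D hD
  have h3 : Real.exp (-D) * Real.cosh (dist x y) ≤ Real.cosh (dist z w) :=
    (mul_le_mul_of_nonneg_left h1 (Real.exp_pos _).le).trans h2
  have := mul_le_mul_of_nonneg_left h3 hs.le
  linarith

/-- By unfolding, the integral over `F` of the sum is twice the finite total mass, so the sum is
finite almost everywhere. Countably many parameters tending to `0` are treated at once, leaving a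
single good point `w`. -/
theorem IsSurfaceGroup.exists_tsum_lt_top (hΓ : IsSurfaceGroup Γ) {F : Set ℍ}
    (hF : IsFundamentalSet Γ F) (z : ℍ) : ∃ w : ℍ, ∀ n : ℕ,
      ∑' γ : Γ, ENNReal.ofReal (Real.exp (-(1 / (n + 1) * Real.cosh (dist z (γ • w))))) < ⊤ := by
  have := hΓ.countable
  have hcm := measurable_cosh_dist z
  -- If `F` were null, unfolding would make the whole half plane null.
  have hF0 : (volume : Measure ℍ).restrict F ≠ 0 := by
    intro h0
    have h1 := hΓ.two_mul_lintegral hF (f := fun _ => 1) measurable_const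
    rw [h0, lintegral_zero_measure, lintegral_one, mul_eq_zero] at h1
    rcases h1 with h1 | h1
    · norm_num at h1
    · have h2 := integral_exp_neg_mul_coshDist z one_pos
      rw [Measure.measure_univ_eq_zero.mp h1, integral_zero_measure] at h2
      have : 0 < 2 * Real.pi / 1 * Real.exp (-1) := by positivity
      exact this.ne h2
  have hae : ∀ᵐ w ∂((volume : Measure ℍ).restrict F), ∀ n : ℕ,
      ∑' γ : Γ, ENNReal.ofReal (Real.exp (-(1 / (n + 1) * Real.cosh (dist z (γ • w))))) < ⊤ := by
    rw [ae_all_iff]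
    intro n
    have hm : Measurable fun w : ℍ =>
        ENNReal.ofReal (Real.exp (-(1 / (n + 1 : ℝ) * Real.cosh (dist z w)))) := by fun_prop
    refine ae_lt_top (Measurable.tsum fun γ => hm.comp (measurable_const_smul γ)) ?_
    rw [← hΓ.two_mul_lintegral hF hm, lintegral_exp_neg_mul_coshDist z (by positivity)]
    exact ENNReal.mul_ne_top (by norm_num) ENNReal.ofReal_ne_top
  have : NeZero ((volume : Measure ℍ).restrict F) := ⟨hF0⟩
  exact hae.exists

/-- Replacing `w` by the good point `w₀` costs the factor `exp (- d(w₀, w))` in the parameter, and a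
good parameter `1 / (n + 1)` lies below the result. -/
theorem IsSurfaceGroup.summable_exp_neg_mul_coshDist (hΓ : IsSurfaceGroup Γ) {F : Set ℍ}
    (hF : IsFundamentalSet Γ F) {s : ℝ} (hs : 0 < s) (z w : ℍ) :
    Summable fun γ : Γ => Real.exp (-(s * Real.cosh (dist z (γ • w)))) := by
  obtain ⟨w₀, hw₀⟩ := hΓ.exists_tsum_lt_top hF z
  obtain ⟨n, hn⟩ := exists_nat_one_div_lt (mul_pos hs (Real.exp_pos (-dist w₀ w)))
  have h1 : Summable fun γ : Γ => Real.exp (-(1 / (n + 1 : ℝ) * Real.cosh (dist z (γ • w₀)))) := by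
    have := ENNReal.summable_toReal (hw₀ n).ne
    refine this.congr fun γ => ?_
    rw [ENNReal.toReal_ofReal (Real.exp_pos _).le]
  refine Summable.of_nonneg_of_le (fun γ => (Real.exp_pos _).le) (fun γ => ?_) h1
  refine (exp_neg_mul_cosh_dist_le hs (x := z) (y := γ • w₀) (D := dist w₀ w) ?_
    dist_nonneg).trans ?_
  · rw [← dist_smul_smul_subgroup γ w₀ w, dist_comm (γ • w₀)]
    exact dist_triangle _ _ _
  · apply Real.exp_le_exp.mpr
    have := Real.cosh_pos (dist z (γ • w₀))
    rw [neg_le_neg_iff]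
    gcongr

/-- The automorphic kernel `∑_γ exp (- s cosh d(z, γ w))`. -/
def autoKernel (Γ : Subgroup SL(2, ℝ)) (s : ℝ) (z w : ℍ) : ℝ :=
  ∑' γ : Γ, Real.exp (-(s * Real.cosh (dist z (γ • w))))

theorem autoKernel_nonneg (s : ℝ) (z w : ℍ) : 0 ≤ autoKernel Γ s z w :=
  tsum_nonneg fun _ => (Real.exp_pos _).le

theorem autoKernel_smul_right (s : ℝ) (z w : ℍ) (γ : Γ) :
    autoKernel Γ s z (γ • w) = autoKernel Γ s z w := by
  unfold autoKernel
  rw [← (Equiv.mulRight γ).tsum_eq fun γ' : Γ => Real.exp (-(s * Real.cosh (dist z (γ' • w))))]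
  simp [mul_smul]

theorem autoKernel_smul_left (s : ℝ) (z w : ℍ) (γ : Γ) :
    autoKernel Γ s (γ • z) w = autoKernel Γ s z w := by
  unfold autoKernel
  rw [← (Equiv.mulLeft γ⁻¹).tsum_eq fun γ' : Γ => Real.exp (-(s * Real.cosh (dist z (γ' • w))))]
  simp [mul_smul, dist_smul_left_eq]

/-- The images of the balls around `z₀` form an increasing open cover of the compact quotient, so
one ball already maps onto it. -/
theorem IsSurfaceGroup.exists_dist_smul_le (hΓ : IsSurfaceGroup Γ) (z₀ : ℍ) :
    ∃ R : ℝ, 0 ≤ R ∧ ∀ z : ℍ, ∃ γ : Γ, dist z₀ (γ • z) ≤ R := by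
  have := hΓ.cocompact
  have hopen : IsOpenMap (Quotient.mk (MulAction.orbitRel Γ ℍ)) := isOpenMap_quotient_mk'_mul
  set V : ℕ → Set (Surface Γ) := fun n => Quotient.mk _ '' Metric.ball z₀ n with hV
  obtain ⟨n, hn⟩ := isCompact_univ.elim_directed_cover V
    (fun n => hopen _ Metric.isOpen_ball) (fun x _ => by
      obtain ⟨z, rfl⟩ := Quotient.exists_rep x
      obtain ⟨n, hn⟩ := exists_nat_gt (dist z z₀)
      exact mem_iUnion.mpr ⟨n, z, hn, rfl⟩)
    (directed_of_isDirected_le fun m n hmn =>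
      image_mono (Metric.ball_subset_ball (by exact_mod_cast hmn)))
  refine ⟨n, by positivity, fun z => ?_⟩
  obtain ⟨w, hw, hwz⟩ := hn (mem_univ (Quotient.mk _ z))
  obtain ⟨γ, hγ⟩ := Quotient.exact hwz
  refine ⟨γ, ?_⟩
  rw [show γ • z = w from hγ, dist_comm]
  exact (Metric.mem_ball.mp hw).le

/-- By invariance both points may be moved to within `R` of `z₀`; replacing them by `z₀` changes
distances by at most `2R`. -/
theorem IsSurfaceGroup.exists_autoKernel_le (hΓ : IsSurfaceGroup Γ) {F : Set ℍ}
    (hF : IsFundamentalSet Γ F) {s : ℝ} (hs : 0 < s) :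
    ∃ C : ℝ, 0 ≤ C ∧ ∀ z w : ℍ, autoKernel Γ s z w ≤ C := by
  set z₀ := UpperHalfPlane.I
  obtain ⟨R, hR0, hR⟩ := hΓ.exists_dist_smul_le z₀
  refine ⟨autoKernel Γ (s * Real.exp (-(R + R))) z₀ z₀, autoKernel_nonneg _ _ _, fun z w => ?_⟩
  obtain ⟨γ, hγ⟩ := hR z
  obtain ⟨γ', hγ'⟩ := hR w
  rw [← autoKernel_smul_left s z w γ, ← autoKernel_smul_right s _ w γ']
  refine (hΓ.summable_exp_neg_mul_coshDist hF hs _ _).tsum_le_tsum (fun g => ?_)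
    (hΓ.summable_exp_neg_mul_coshDist hF (by positivity) _ _)
  refine exp_neg_mul_cosh_dist_le hs ?_ (by positivity)
  have h1 := dist_triangle4 z₀ (γ • z) (g • γ' • w) (g • z₀)
  rw [dist_smul_smul_subgroup g, dist_comm _ z₀] at h1
  linarith

theorem IsSurfaceGroup.continuous_autoKernel (hΓ : IsSurfaceGroup Γ) {F : Set ℍ}
    (hF : IsFundamentalSet Γ F) {s : ℝ} (hs : 0 < s) :
    Continuous fun p : ℍ × ℍ => autoKernel Γ s p.1 p.2 := by
  rw [continuous_iff_continuousAt]
  rintro ⟨z, w⟩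
  have hcont : ContinuousOn (fun p : ℍ × ℍ => autoKernel Γ s p.1 p.2)
      (Metric.ball z 1 ×ˢ Metric.ball w 1) := by
    -- Both points move by less than `1`, hence distances by at most `2`; the series at the
    -- parameter `s exp (- 2)` is a uniform majorant.
    refine continuousOn_tsum (u := fun γ : Γ =>
      Real.exp (-(s * Real.exp (-2) * Real.cosh (dist z (γ • w))))) (fun γ => ?_)
      (hΓ.summable_exp_neg_mul_coshDist hF (by positivity) _ _) ?_
    · refine Continuous.continuousOn ?_
      refine Real.continuous_exp.comp (Continuous.neg (continuous_const.mul
        (Real.continuous_cosh.comp ?_)))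
      exact continuous_fst.dist ((continuous_const_smul γ).comp continuous_snd)
    · rintro γ ⟨z', w'⟩ ⟨hz, hw⟩
      rw [Real.norm_of_nonneg (Real.exp_pos _).le]
      refine exp_neg_mul_cosh_dist_le hs ?_ (by norm_num)
      have h1 := dist_triangle4 z z' (γ • w') (γ • w)
      rw [dist_smul_smul_subgroup γ, dist_comm z z'] at h1
      have h2 := Metric.mem_ball.mp hz
      have h3 := Metric.mem_ball.mp hw
      simp only at h2 h3 ⊢
      linarith
  exact hcont.continuousAt ((Metric.isOpen_ball.prod Metric.isOpen_ball).mem_nhds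
    ⟨Metric.mem_ball_self one_pos, Metric.mem_ball_self one_pos⟩)

/-- Some translate of any `w` is within `R` of `z₀`, so the sum over `Γ` is bounded below by a
positive constant, while its integral over `F` is finite by unfolding. -/
theorem IsSurfaceGroup.volume_lt_top (hΓ : IsSurfaceGroup Γ) {F : Set ℍ}
    (hF : IsFundamentalSet Γ F) : volume F < ⊤ := by
  set z₀ := UpperHalfPlane.I
  obtain ⟨R, hR0, hR⟩ := hΓ.exists_dist_smul_le z₀
  have hm : Measurable fun w : ℍ => ENNReal.ofReal (Real.exp (-(1 * Real.cosh (dist z₀ w)))) := by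
    have := measurable_cosh_dist z₀
    fun_prop
  have h := hΓ.two_mul_lintegral hF hm
  rw [lintegral_exp_neg_mul_coshDist z₀ one_pos] at h
  have hlow : ∀ w : ℍ, ENNReal.ofReal (Real.exp (-(1 * Real.cosh R))) ≤
      ∑' γ : Γ, ENNReal.ofReal (Real.exp (-(1 * Real.cosh (dist z₀ (γ • w))))) := by
    intro w
    obtain ⟨γ, hγ⟩ := hR w
    refine le_trans (ENNReal.ofReal_le_ofReal (Real.exp_le_exp.mpr ?_)) (ENNReal.le_tsum γ)
    have : Real.cosh (dist z₀ (γ • w)) ≤ Real.cosh R := by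
      rw [Real.cosh_le_cosh, abs_of_nonneg dist_nonneg, abs_of_nonneg hR0]
      exact hγ
    linarith
  have h2 : ENNReal.ofReal (Real.exp (-(1 * Real.cosh R))) * volume F ≤
      2 * ENNReal.ofReal (2 * Real.pi / 1 * Real.exp (-1)) := by
    rw [h, ← setLIntegral_const]
    exact lintegral_mono hlow
  by_contra hV
  rw [not_lt, top_le_iff] at hV
  rw [hV, ENNReal.mul_top (by simpa using Real.exp_pos _), top_le_iff] at h2
  exact ENNReal.mul_ne_top (by norm_num) ENNReal.ofReal_ne_top h2

end

end
section

variable {Γ : Subgroup SL(2, ℝ)}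

/-! ### Functions on the surface -/

/-- The quotient carries the largest σ-algebra for which the projection is measurable. -/
theorem measurable_proj : Measurable (proj Γ) := fun _ h => h

theorem measurable_surface {E : Type*} [MeasurableSpace E] {ψ : Surface Γ → E}
    (h : Measurable fun z : ℍ => ψ (proj Γ z)) : Measurable ψ :=
  measurable_from_quotient.mpr h

theorem proj_smul (γ : Γ) (z : ℍ) : proj Γ (γ • z) = proj Γ z :=
  Quotient.sound ⟨γ, rfl⟩

theorem lift_coe (f : Surface Γ → ℂ) (z : ℍ) : lift Γ f z = f (proj Γ z) := by
  simp [lift]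

theorem IsEigenfunction.continuous {f : Surface Γ → ℂ} {lam : ℝ} (hf : IsEigenfunction Γ f lam) :
    Continuous fun z : ℍ => f (proj Γ z) := by
  simp_rw [← lift_coe]
  exact hf.contDiffOn.continuousOn.comp_continuous UpperHalfPlane.continuous_coe
    fun w => w.im_pos

theorem IsEigenfunction.exists_isMax (hΓ : IsSurfaceGroup Γ) {f : Surface Γ → ℂ} {lam : ℝ}
    (hf : IsEigenfunction Γ f lam) :
    ∃ z₀ : ℍ, ∀ z : ℍ, ‖f (proj Γ z)‖ ≤ ‖f (proj Γ z₀)‖ := by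
  have := hΓ.cocompact
  have hfc : Continuous f := (isQuotientMap_quot_mk (r := (MulAction.orbitRel Γ ℍ))).continuous_iff.mpr
    hf.continuous
  have : Nonempty (Surface Γ) := ⟨proj Γ UpperHalfPlane.I⟩
  obtain ⟨x, -, hx⟩ := isCompact_univ.exists_isMaxOn univ_nonempty hfc.norm.continuousOn
  obtain ⟨z₀, rfl⟩ := Quotient.exists_rep x
  exact ⟨z₀, fun z => hx (mem_univ _)⟩

theorem IsEigenfunction.integral_kernel (hΓ : IsSurfaceGroup Γ) {f : Surface Γ → ℂ} {lam : ℝ}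
    (hf : IsEigenfunction Γ f lam) {r : ℂ} (hr : (lam : ℂ) = 1 / 4 + r ^ 2) {s : ℝ} (hs : 0 < s)
    (z : ℍ) :
    ∫ w : ℍ, ((Real.exp (-(s * Real.cosh (dist z w))) : ℝ) : ℂ) * f (proj Γ w)
      = ((2 * √(2 * Real.pi / s) : ℝ) : ℂ) * besselK (Complex.I * r) s * f (proj Γ z) := by
  obtain ⟨z₀, hz₀⟩ := hf.exists_isMax hΓ
  have h := integral_exp_neg_mul_coshDist_mul_eigen hf.contDiffOn (lam := lam) (r := r) (fun w hw => by
      have := hf.eigen ⟨w, hw⟩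
      rw [← lift_coe f ⟨w, hw⟩] at this
      exact this) (B := ‖f (proj Γ z₀)‖) (fun w => by rw [lift_coe]; exact hz₀ w) hr z hs
  simpa only [lift_coe] using h

/-- Evaluating the convolution at a maximum of `|f|` shows that its multiplier cannot exceed the
mass of the kernel. This dominates the whole spectral sum, small eigenvalues included. -/
theorem IsEigenfunction.norm_besselK_le (hΓ : IsSurfaceGroup Γ) {f : Surface Γ → ℂ} {lam : ℝ}
    (hf : IsEigenfunction Γ f lam) (hf0 : ∃ z, f (proj Γ z) ≠ 0) {r : ℂ}
    (hr : (lam : ℂ) = 1 / 4 + r ^ 2) {s : ℝ} (hs : 0 < s) :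
    2 * √(2 * Real.pi / s) * ‖besselK (Complex.I * r) s‖ ≤ 2 * Real.pi / s * Real.exp (-s) := by
  obtain ⟨z₀, hz₀⟩ := hf.exists_isMax hΓ
  obtain ⟨z₁, hz₁⟩ := hf0
  have hpos : 0 < ‖f (proj Γ z₀)‖ := lt_of_lt_of_le (norm_pos_iff.mpr hz₁) (hz₀ z₁)
  have h := congrArg norm (hf.integral_kernel hΓ hr hs z₀)
  have h2 : ‖∫ w : ℍ, ((Real.exp (-(s * Real.cosh (dist z₀ w))) : ℝ) : ℂ) * f (proj Γ w)‖
      ≤ ∫ w : ℍ, Real.exp (-(s * Real.cosh (dist z₀ w))) * ‖f (proj Γ z₀)‖ := by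
    refine norm_integral_le_of_norm_le ((integrable_exp_neg_mul_coshDist z₀ hs).mul_const _)
      (Eventually.of_forall fun w => ?_)
    rw [norm_mul, Complex.norm_real, Real.norm_of_nonneg (Real.exp_pos _).le]
    gcongr
    exact hz₀ w
  rw [h, integral_mul_const, integral_exp_neg_mul_coshDist z₀ hs, norm_mul, norm_mul,
    Complex.norm_real, Real.norm_of_nonneg (by positivity)] at h2
  exact le_of_mul_le_mul_right h2 hpos

/-- Unfolding the automorphic kernel against a function on the surface. -/
theorem IsSurfaceGroup.integral_autoKernel_mul (hΓ : IsSurfaceGroup Γ) {F : Set ℍ}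
    (hF : IsFundamentalSet Γ F) {s : ℝ} (hs : 0 < s) (z : ℍ) {ψ : Surface Γ → ℂ}
    (hψ : Measurable ψ) :
    ∫ w in F, (autoKernel Γ s z w : ℂ) * ψ (proj Γ w) =
      2 * ∫ w : ℍ, ((Real.exp (-(s * Real.cosh (dist z w))) : ℝ) : ℂ) * ψ (proj Γ w) := by
  have := hΓ.countable
  have hcm := measurable_cosh_dist z
  set k : ℍ → ENNReal := fun w => ENNReal.ofReal (Real.exp (-(s * Real.cosh (dist z w)))) with hk
  have hkm : Measurable k := by fun_prop
  have hKm : Measurable fun w => ENNReal.ofReal (autoKernel Γ s z w) :=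
    (ENNReal.measurable_ofReal.comp ((hΓ.continuous_autoKernel hF hs).comp
      (continuous_const.prodMk continuous_id)).measurable)
  have hKk : ∀ w, ENNReal.ofReal (autoKernel Γ s z w) = ∑' γ : Γ, k (γ • w) := by
    intro w
    rw [autoKernel, ENNReal.ofReal_tsum_of_nonneg (fun _ => (Real.exp_pos _).le)
      (hΓ.summable_exp_neg_mul_coshDist hF hs z w)]
  -- Unfolding is done for measures on `X`, by testing on sets; the identity for complex `ψ` then
  -- follows without any integrability argument.
  have hmeas : ((volume.restrict F).withDensity fun w => ENNReal.ofReal (autoKernel Γ s z w)).map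
      (proj Γ) = ((volume : Measure ℍ).withDensity (fun w => 2 * k w)).map (proj Γ) := by
    ext A hA
    have hA' := measurable_proj hA
    rw [Measure.map_apply measurable_proj hA, Measure.map_apply measurable_proj hA,
      withDensity_apply _ hA', withDensity_apply _ hA', ← lintegral_indicator hA',
      ← lintegral_indicator hA']
    have h1 := hΓ.two_mul_lintegral hF (hkm.indicator hA')
    have e1 : ∀ w, (proj Γ ⁻¹' A).indicator (fun w => 2 * k w) w =
        2 * (proj Γ ⁻¹' A).indicator k w := by
      intro w
      by_cases hw : w ∈ proj Γ ⁻¹' A <;> simp [hw]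
    simp_rw [e1]
    rw [lintegral_const_mul _ (hkm.indicator hA'), h1]
    refine lintegral_congr fun w => ?_
    by_cases hw : w ∈ proj Γ ⁻¹' A
    · rw [indicator_of_mem hw, hKk]
      refine tsum_congr fun γ => ?_
      rw [indicator_of_mem]
      rwa [mem_preimage, proj_smul]
    · rw [indicator_of_notMem hw]
      refine (ENNReal.tsum_eq_zero.mpr fun γ => ?_).symm
      rw [indicator_of_notMem]
      rwa [mem_preimage, proj_smul]
  have h2 : ∫ x, ψ x ∂(((volume.restrict F).withDensity
      fun w => ENNReal.ofReal (autoKernel Γ s z w)).map (proj Γ)) =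
      ∫ x, ψ x ∂(((volume : Measure ℍ).withDensity (fun w => 2 * k w)).map (proj Γ)) := by
    rw [hmeas]
  rw [integral_map measurable_proj.aemeasurable hψ.aestronglyMeasurable,
    integral_map measurable_proj.aemeasurable hψ.aestronglyMeasurable,
    integral_withDensity_eq_integral_toReal_smul hKm
      (Eventually.of_forall fun _ => ENNReal.ofReal_lt_top),
    integral_withDensity_eq_integral_toReal_smul (hkm.const_mul 2)
      (Eventually.of_forall fun _ => ENNReal.mul_lt_top (by norm_num) ENNReal.ofReal_lt_top)] at h2
  rw [← integral_const_mul]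
  convert h2 using 1
  · refine integral_congr_ae (Eventually.of_forall fun w => ?_)
    simp only
    rw [ENNReal.toReal_ofReal (autoKernel_nonneg _ _ _), Complex.real_smul]
  · refine integral_congr_ae (Eventually.of_forall fun w => ?_)
    simp only [hk]
    rw [ENNReal.toReal_mul, ENNReal.toReal_ofReal (Real.exp_pos _).le, Complex.real_smul]
    push_cast
    simp only [ENNReal.toReal_ofNat, Complex.ofReal_ofNat]
    ring

/-! ### The kernel integrated along the geodesic -/

theorem continuous_axisPoint : Continuous axisPoint := by
  rw [UpperHalfPlane.isEmbedding_coe.continuous_iff]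
  have : (UpperHalfPlane.coe ∘ axisPoint) = fun u : ℝ => (Real.exp u : ℂ) * Complex.I := rfl
  rw [this]
  fun_prop

/-- Half the integral of the automorphic kernel over the closed geodesic. -/
def geodesicKernel (Γ : Subgroup SL(2, ℝ)) (m s : ℝ) (w : ℍ) : ℝ :=
  1 / 2 * ∫ u in (0 : ℝ)..geodesicLength m, autoKernel Γ s (axisPoint u) w

theorem DiagonalGenerator.geodesicLength_pos {m : ℝ} (hm : DiagonalGenerator Γ m) :
    0 < geodesicLength m := by
  have := Real.log_pos hm.one_lt
  unfold geodesicLength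
  positivity

theorem IsSurfaceGroup.continuous_geodesicKernel (hΓ : IsSurfaceGroup Γ) {F : Set ℍ}
    (hF : IsFundamentalSet Γ F) (m : ℝ) {s : ℝ} (hs : 0 < s) :
    Continuous (geodesicKernel Γ m s) := by
  have h0 : Continuous fun p : ℍ × ℝ => (axisPoint p.2, p.1) :=
    (continuous_axisPoint.comp continuous_snd).prodMk continuous_fst
  have h : Continuous (Function.uncurry fun (w : ℍ) (u : ℝ) => autoKernel Γ s (axisPoint u) w) := by
    have := (hΓ.continuous_autoKernel hF hs).comp h0
    exact this
  have h2 := intervalIntegral.continuous_parametric_intervalIntegral_of_continuous' (μ := volume) h 0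
    (geodesicLength m)
  exact continuous_const.mul h2

theorem geodesicKernel_smul (m s : ℝ) (w : ℍ) (γ : Γ) :
    geodesicKernel Γ m s (γ • w) = geodesicKernel Γ m s w := by
  simp only [geodesicKernel, autoKernel_smul_right]

theorem geodesicKernel_nonneg {m : ℝ} (hm : DiagonalGenerator Γ m) (s : ℝ) (w : ℍ) :
    0 ≤ geodesicKernel Γ m s w := by
  have := intervalIntegral.integral_nonneg (μ := volume) hm.geodesicLength_pos.le
    (f := fun u => autoKernel Γ s (axisPoint u) w) (fun u _ => autoKernel_nonneg _ _ _)
  unfold geodesicKernel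
  positivity

theorem IsSurfaceGroup.geodesicKernel_le (hΓ : IsSurfaceGroup Γ) {F : Set ℍ}
    (hF : IsFundamentalSet Γ F) {m : ℝ} (hm : DiagonalGenerator Γ m) {s C : ℝ} (hs : 0 < s)
    (hC : ∀ z w, autoKernel Γ s z w ≤ C) (w : ℍ) :
    geodesicKernel Γ m s w ≤ 1 / 2 * (geodesicLength m * C) := by
  unfold geodesicKernel
  gcongr ?_ * ?_
  have h := intervalIntegral.integral_mono_on (μ := volume) hm.geodesicLength_pos.le
    (f := fun u => autoKernel Γ s (axisPoint u) w) (g := fun _ => C)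
    (((hΓ.continuous_autoKernel hF hs).comp
      (continuous_axisPoint.prodMk continuous_const)).intervalIntegrable _ _)
    (continuous_const.intervalIntegrable _ _) (fun u _ => hC _ _)
  simpa using h

theorem IsSurfaceGroup.exists_geodesicKernel_le (hΓ : IsSurfaceGroup Γ) {F : Set ℍ}
    (hF : IsFundamentalSet Γ F) {m : ℝ} (hm : DiagonalGenerator Γ m) :
    ∃ C : ℝ, 0 ≤ C ∧ ∀ s, 1 ≤ s → ∀ w, geodesicKernel Γ m s w ≤ C * Real.exp (-s) := by
  obtain ⟨C, hC0, hC⟩ := hΓ.exists_autoKernel_le hF one_pos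
  have hl := hm.geodesicLength_pos
  refine ⟨1 / 2 * (geodesicLength m * (C * Real.exp 1)), by positivity, fun s hs w => ?_⟩
  have hs0 : 0 < s := by linarith
  refine (hΓ.geodesicKernel_le hF hm hs0 (C := Real.exp (-((s - 1) * 1)) * C) (fun z w => ?_)
    w).trans (le_of_eq ?_)
  · refine le_trans ?_ (mul_le_mul_of_nonneg_left (hC z w) (Real.exp_pos _).le)
    unfold autoKernel
    rw [← tsum_mul_left]
    exact (hΓ.summable_exp_neg_mul_coshDist hF hs0 z w).tsum_le_tsum
      (fun γ => exp_neg_mul_le_of_one_le hs (Real.one_le_cosh _))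
      ((hΓ.summable_exp_neg_mul_coshDist hF one_pos z w).mul_left _)
  · rw [show -((s - 1) * 1) = 1 + -s by ring, Real.exp_add]
    ring

/-- Fubini and unfolding; the factor `1 / 2` in the kernel cancels the double count of isometries.
Boundedness of `ψ` justifies the interchange. -/
theorem IsSurfaceGroup.integral_geodesicKernel_mul (hΓ : IsSurfaceGroup Γ) {F : Set ℍ}
    (hF : IsFundamentalSet Γ F) {m : ℝ} (hm : DiagonalGenerator Γ m) {s : ℝ} (hs : 0 < s)
    {ψ : Surface Γ → ℂ} (hψ : Measurable ψ) {B : ℝ} (hB : ∀ z, ‖ψ (proj Γ z)‖ ≤ B) :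
    ∫ w in F, (geodesicKernel Γ m s w : ℂ) * ψ (proj Γ w) =
      ∫ u in (0 : ℝ)..geodesicLength m,
        ∫ w : ℍ, ((Real.exp (-(s * Real.cosh (dist (axisPoint u) w))) : ℝ) : ℂ) * ψ (proj Γ w) := by
  obtain ⟨C, hC0, hC⟩ := hΓ.exists_autoKernel_le hF hs
  have hl := hm.geodesicLength_pos
  have hfin : IsFiniteMeasure (volume.restrict F) :=
    ⟨by rw [Measure.restrict_apply_univ]; exact hΓ.volume_lt_top hF⟩
  have e1 : ∀ w : ℍ, (geodesicKernel Γ m s w : ℂ) * ψ (proj Γ w) =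
      1 / 2 * ∫ u in Ioc 0 (geodesicLength m),
        (autoKernel Γ s (axisPoint u) w : ℂ) * ψ (proj Γ w) := by
    intro w
    rw [geodesicKernel, intervalIntegral.integral_of_le hl.le, integral_mul_const,
      Complex.ofReal_mul, ← integral_complex_ofReal]
    push_cast
    ring
  simp_rw [e1]
  rw [integral_const_mul, integral_integral_swap, intervalIntegral.integral_of_le hl.le,
    ← integral_const_mul]
  · refine integral_congr_ae (Eventually.of_forall fun u => ?_)
    simp only
    rw [hΓ.integral_autoKernel_mul hF hs _ hψ]
    ring
  · have hm : Measurable (Function.uncurry fun (w : ℍ) (u : ℝ) =>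
        (autoKernel Γ s (axisPoint u) w : ℂ) * ψ (proj Γ w)) := by
      refine Measurable.mul ?_ (hψ.comp (measurable_proj.comp measurable_fst))
      exact Complex.measurable_ofReal.comp ((hΓ.continuous_autoKernel hF hs).comp
        ((continuous_axisPoint.comp continuous_snd).prodMk continuous_fst)).measurable
    refine Integrable.of_bound hm.aestronglyMeasurable (C * B) (Eventually.of_forall ?_)
    rintro ⟨w, u⟩
    rw [Function.uncurry_apply_pair, norm_mul, Complex.norm_real,
      Real.norm_of_nonneg (autoKernel_nonneg _ _ _)]
    exact mul_le_mul (hC _ _) (hB w) (norm_nonneg _) hC0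

/-- The function on the surface defined by `geodesicKernel`. -/
def surfaceKernel (Γ : Subgroup SL(2, ℝ)) (m s : ℝ) : Surface Γ → ℂ :=
  Quotient.lift (fun w => (geodesicKernel Γ m s w : ℂ)) fun a b h => by
    obtain ⟨γ, rfl⟩ := h
    simp only
    rw [geodesicKernel_smul]

theorem surfaceKernel_proj (m s : ℝ) (w : ℍ) :
    surfaceKernel Γ m s (proj Γ w) = (geodesicKernel Γ m s w : ℂ) := rfl

theorem IsSurfaceGroup.measurable_surfaceKernel (hΓ : IsSurfaceGroup Γ) {F : Set ℍ}
    (hF : IsFundamentalSet Γ F) (m : ℝ) {s : ℝ} (hs : 0 < s) :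
    Measurable (surfaceKernel Γ m s) :=
  measurable_surface
    (Complex.measurable_ofReal.comp (hΓ.continuous_geodesicKernel hF m hs).measurable)

theorem IsSurfaceGroup.isFiniteMeasure_surfaceArea (hΓ : IsSurfaceGroup Γ) {F : Set ℍ}
    (hF : IsFundamentalSet Γ F) : IsFiniteMeasure (surfaceArea Γ F) := by
  have hfin : IsFiniteMeasure ((volume : Measure ℍ).restrict F) :=
    ⟨by rw [Measure.restrict_apply_univ]; exact hΓ.volume_lt_top hF⟩
  exact Measure.isFiniteMeasure_map _ _

theorem IsSurfaceGroup.norm_surfaceKernel_le (hΓ : IsSurfaceGroup Γ) {F : Set ℍ}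
    (hF : IsFundamentalSet Γ F) {m : ℝ} (hm : DiagonalGenerator Γ m) {s : ℝ} (hs : 0 < s) :
    ∃ B : ℝ, ∀ x, ‖surfaceKernel Γ m s x‖ ≤ B := by
  obtain ⟨C, hC0, hC⟩ := hΓ.exists_autoKernel_le hF hs
  refine ⟨1 / 2 * (geodesicLength m * C), fun x => ?_⟩
  obtain ⟨w, rfl⟩ := Quotient.exists_rep x
  have : surfaceKernel Γ m s (Quotient.mk _ w) = (geodesicKernel Γ m s w : ℂ) := rfl
  rw [this, Complex.norm_real, Real.norm_of_nonneg (geodesicKernel_nonneg hm _ _)]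
  exact hΓ.geodesicKernel_le hF hm hs hC w

theorem IsSurfaceGroup.memLp_surfaceKernel (hΓ : IsSurfaceGroup Γ) {F : Set ℍ}
    (hF : IsFundamentalSet Γ F) {m : ℝ} (hm : DiagonalGenerator Γ m) {s : ℝ} (hs : 0 < s) :
    MemLp (surfaceKernel Γ m s) 2 (surfaceArea Γ F) := by
  have := hΓ.isFiniteMeasure_surfaceArea hF
  obtain ⟨B, hB⟩ := hΓ.norm_surfaceKernel_le hF hm hs
  exact MemLp.of_bound (hΓ.measurable_surfaceKernel hF m hs).aestronglyMeasurable B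
    (Eventually.of_forall hB)

end
section

variable {Γ : Subgroup SL(2, ℝ)}

/-! ### Spectral expansion of the kernel -/

/-- A Hilbert basis of `L²(X)` that is represented by eigenfunctions `φ n` of the Laplacian, with
eigenvalues `1 / 4 + r n ^ 2`. -/
structure IsEigenbasis (Γ : Subgroup SL(2, ℝ)) (F : Set ℍ) (φ : ℕ → Surface Γ → ℂ) (lam : ℕ → ℝ)
    (r : ℕ → ℂ) (b : HilbertBasis ℕ ℂ (Lp ℂ 2 (surfaceArea Γ F))) : Prop where
  ae_eq : ∀ n, (b n : Surface Γ → ℂ) =ᵐ[surfaceArea Γ F] φ n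
  eigen : ∀ n, IsEigenfunction Γ (φ n) (lam n)
  eq_add_sq : ∀ n, (lam n : ℂ) = 1 / 4 + r n ^ 2

/-- The geodesic kernel with parameter `t`, averaged against the kernel with parameter `s` around
the points of the geodesic. -/
def kernelPairing (Γ : Subgroup SL(2, ℝ)) (m s t : ℝ) : ℝ :=
  ∫ u in (0 : ℝ)..geodesicLength m,
    ∫ w : ℍ, Real.exp (-(s * Real.cosh (dist (axisPoint u) w))) * geodesicKernel Γ m t w

/-- The kernel is real, so the conjugation in the inner product disappears. -/
theorem IsSurfaceGroup.inner_surfaceKernel (hΓ : IsSurfaceGroup Γ) {F : Set ℍ}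
    (hF : IsFundamentalSet Γ F) {m : ℝ} (hm : DiagonalGenerator Γ m) {s : ℝ} (hs : 0 < s)
    {ψ : Surface Γ → ℂ} (hψ : Measurable ψ) {B : ℝ} (hB : ∀ z, ‖ψ (proj Γ z)‖ ≤ B)
    {y : Lp ℂ 2 (surfaceArea Γ F)} (hy : (y : Surface Γ → ℂ) =ᵐ[surfaceArea Γ F] ψ) :
    inner ℂ ((hΓ.memLp_surfaceKernel hF hm hs).toLp _) y =
      ∫ u in (0 : ℝ)..geodesicLength m,
        ∫ w : ℍ, ((Real.exp (-(s * Real.cosh (dist (axisPoint u) w))) : ℝ) : ℂ) * ψ (proj Γ w) := by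
  rw [L2.inner_def, ← hΓ.integral_geodesicKernel_mul hF hm hs hψ hB]
  have h1 : ∫ x, inner ℂ (((hΓ.memLp_surfaceKernel hF hm hs).toLp _ :
      Lp ℂ 2 (surfaceArea Γ F)) x) (y x) ∂(surfaceArea Γ F) =
      ∫ x, surfaceKernel Γ m s x * ψ x ∂(surfaceArea Γ F) := by
    refine integral_congr_ae ?_
    filter_upwards [(hΓ.memLp_surfaceKernel hF hm hs).coeFn_toLp, hy] with x hx hyx
    rw [hx, hyx, RCLike.inner_apply]
    obtain ⟨w, rfl⟩ := Quotient.exists_rep x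
    have : surfaceKernel Γ m s (Quotient.mk _ w) = (geodesicKernel Γ m s w : ℂ) := rfl
    rw [this, Complex.conj_ofReal, mul_comm]
  have h2 : Measurable fun x => surfaceKernel Γ m s x * ψ x :=
    (hΓ.measurable_surfaceKernel hF m hs).mul hψ
  rw [h1, surfaceArea, integral_map measurable_proj.aemeasurable h2.aestronglyMeasurable]
  rfl

theorem IsEigenfunction.measurable {f : Surface Γ → ℂ} {lam : ℝ} (hf : IsEigenfunction Γ f lam) :
    Measurable f := measurable_surface hf.continuous.measurable

variable {F : Set ℍ} {m : ℝ} {φ : ℕ → Surface Γ → ℂ} {lam : ℕ → ℝ} {r : ℕ → ℂ}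
  {b : HilbertBasis ℕ ℂ (Lp ℂ 2 (surfaceArea Γ F))}

/-- Selberg's principle pulls the multiplier out at each point of the geodesic and leaves the
period. -/
theorem IsEigenbasis.inner_surfaceKernel (hb : IsEigenbasis Γ F φ lam r b) (hΓ : IsSurfaceGroup Γ)
    (hF : IsFundamentalSet Γ F) (hm : DiagonalGenerator Γ m) {s : ℝ} (hs : 0 < s) (n : ℕ) :
    inner ℂ ((hΓ.memLp_surfaceKernel hF hm hs).toLp _) (b n) =
      ((2 * √(2 * Real.pi / s) : ℝ) : ℂ) * besselK (Complex.I * r n) s * period Γ m (φ n) := by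
  obtain ⟨z₀, hz₀⟩ := (hb.eigen n).exists_isMax hΓ
  rw [hΓ.inner_surfaceKernel hF hm hs (hb.eigen n).measurable hz₀ (hb.ae_eq n), period,
    ← intervalIntegral.integral_const_mul]
  simp_rw [(hb.eigen n).integral_kernel hΓ (hb.eq_add_sq n) hs]

theorem IsEigenbasis.sq_eq (hb : IsEigenbasis Γ F φ lam r b) (n : ℕ) :
    r n ^ 2 = ((lam n - 1 / 4 : ℝ) : ℂ) := by
  push_cast
  rw [hb.eq_add_sq n]
  ring

theorem IsEigenbasis.exists_ne_zero (hb : IsEigenbasis Γ F φ lam r b) (n : ℕ) :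
    ∃ z, φ n (proj Γ z) ≠ 0 := by
  by_contra! h
  have h0 : φ n = 0 := by
    ext x
    obtain ⟨w, rfl⟩ := Quotient.exists_rep x
    exact h w
  have h1 : b n = 0 := by
    rw [Lp.eq_zero_iff_ae_eq_zero]
    exact (hb.ae_eq n).trans (Eventually.of_forall fun x => by rw [h0])
  have := b.orthonormal.1 n
  rw [h1, norm_zero] at this
  exact zero_ne_one this

theorem IsSurfaceGroup.exists_geodesicKernel_bound (hΓ : IsSurfaceGroup Γ)
    (hF : IsFundamentalSet Γ F) (hm : DiagonalGenerator Γ m) {t : ℝ} (ht : 0 < t) :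
    ∃ B, 0 ≤ B ∧ ∀ w, geodesicKernel Γ m t w ≤ B := by
  obtain ⟨C, hC0, hC⟩ := hΓ.exists_autoKernel_le hF ht
  have := hm.geodesicLength_pos
  exact ⟨1 / 2 * (geodesicLength m * C), by positivity, hΓ.geodesicKernel_le hF hm ht hC⟩

theorem IsSurfaceGroup.inner_surfaceKernel_surfaceKernel (hΓ : IsSurfaceGroup Γ)
    (hF : IsFundamentalSet Γ F) (hm : DiagonalGenerator Γ m) {s t : ℝ} (hs : 0 < s) (ht : 0 < t) :
    inner ℂ ((hΓ.memLp_surfaceKernel hF hm hs).toLp _)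
      ((hΓ.memLp_surfaceKernel hF hm ht).toLp _) = (kernelPairing Γ m s t : ℂ) := by
  obtain ⟨B, hB0, hB⟩ := hΓ.exists_geodesicKernel_bound hF hm ht
  rw [hΓ.inner_surfaceKernel hF hm hs (hΓ.measurable_surfaceKernel hF m ht) (B := B) (fun z => by
    rw [surfaceKernel_proj, Complex.norm_real, Real.norm_of_nonneg (geodesicKernel_nonneg hm _ _)]
    exact hB z) (hΓ.memLp_surfaceKernel hF hm ht).coeFn_toLp, kernelPairing,
    ← intervalIntegral.integral_ofReal]
  congr 1
  ext u
  rw [← integral_complex_ofReal]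
  simp_rw [surfaceKernel_proj, Complex.ofReal_mul]

/-- Parseval's formula for the kernels. -/
theorem IsEigenbasis.hasSum_kernelPairing (hb : IsEigenbasis Γ F φ lam r b) (hΓ : IsSurfaceGroup Γ)
    (hF : IsFundamentalSet Γ F) (hm : DiagonalGenerator Γ m) {s t : ℝ} (hs : 0 < s) (ht : 0 < t) :
    HasSum (fun n => (2 * √(2 * Real.pi / s) * (besselK (Complex.I * r n) s).re) *
      ((2 * √(2 * Real.pi / t) * (besselK (Complex.I * r n) t).re) * ‖period Γ m (φ n)‖ ^ 2))
      (kernelPairing Γ m s t) := by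
  have h := b.hasSum_inner_mul_inner ((hΓ.memLp_surfaceKernel hF hm hs).toLp _)
    ((hΓ.memLp_surfaceKernel hF hm ht).toLp _)
  rw [hΓ.inner_surfaceKernel_surfaceKernel hF hm hs ht] at h
  rw [← Complex.hasSum_ofReal]
  refine h.congr_fun fun n => ?_
  rw [← inner_conj_symm (b n), hb.inner_surfaceKernel hΓ hF hm hs, hb.inner_surfaceKernel hΓ hF hm ht,
    map_mul, map_mul, Complex.conj_ofReal]
  have h1 := (besselK_real_and_le (hb.sq_eq n) hs).1
  have h2 := (besselK_real_and_le (hb.sq_eq n) ht).1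
  rw [← h1, ← h2, Complex.conj_ofReal]
  have h3 : period Γ m (φ n) * (starRingEnd ℂ) (period Γ m (φ n)) =
      ((‖period Γ m (φ n)‖ ^ 2 : ℝ) : ℂ) := by
    rw [Complex.mul_conj, Complex.normSq_eq_norm_sq]
  simp only [Complex.ofReal_mul, ← h3, Complex.ofReal_re]
  ring

theorem IsEigenbasis.abs_besselK_le (hb : IsEigenbasis Γ F φ lam r b) (hΓ : IsSurfaceGroup Γ)
    {s : ℝ} (hs : 0 < s) (n : ℕ) :
    2 * √(2 * Real.pi / s) * |(besselK (Complex.I * r n) s).re| ≤ 2 * Real.pi / s * Real.exp (-s) :=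
  (mul_le_mul_of_nonneg_left (Complex.abs_re_le_norm _) (by positivity)).trans
    ((hb.eigen n).norm_besselK_le hΓ (hb.exists_ne_zero n) (hb.eq_add_sq n) hs)

/-! ### Convergence of the spectral side -/

theorem IsSurfaceGroup.integrable_exp_mul_geodesicKernel (hΓ : IsSurfaceGroup Γ)
    (hF : IsFundamentalSet Γ F) (hm : DiagonalGenerator Γ m) {s t : ℝ} (hs : 0 < s) (ht : 0 < t)
    (z : ℍ) :
    Integrable fun w : ℍ => Real.exp (-(s * Real.cosh (dist z w))) * geodesicKernel Γ m t w := by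
  obtain ⟨B, hB0, hB⟩ := hΓ.exists_geodesicKernel_bound hF hm ht
  refine (integrable_exp_neg_mul_coshDist z hs).mul_bdd (c := B)
    (hΓ.continuous_geodesicKernel hF m ht).aestronglyMeasurable
    (Eventually.of_forall fun w => ?_)
  rw [Real.norm_of_nonneg (geodesicKernel_nonneg hm _ _)]
  exact hB w

theorem IsSurfaceGroup.integral_exp_mul_geodesicKernel_le (hΓ : IsSurfaceGroup Γ)
    (hF : IsFundamentalSet Γ F) (hm : DiagonalGenerator Γ m) {s t B : ℝ} (hs : 0 < s) (ht : 0 < t)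
    (hB : ∀ w, geodesicKernel Γ m t w ≤ B) (z : ℍ) :
    ∫ w : ℍ, Real.exp (-(s * Real.cosh (dist z w))) * geodesicKernel Γ m t w ≤
      2 * Real.pi / s * Real.exp (-s) * B := by
  rw [← integral_exp_neg_mul_coshDist z hs, ← integral_mul_const]
  refine integral_mono (hΓ.integrable_exp_mul_geodesicKernel hF hm hs ht z)
    ((integrable_exp_neg_mul_coshDist z hs).mul_const _) fun w => ?_
  exact mul_le_mul_of_nonneg_left (hB w) (Real.exp_pos _).le

theorem integral_exp_mul_geodesicKernel_nonneg (hm : DiagonalGenerator Γ m) (s t : ℝ) (z : ℍ) :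
    0 ≤ ∫ w : ℍ, Real.exp (-(s * Real.cosh (dist z w))) * geodesicKernel Γ m t w :=
  integral_nonneg fun _ => mul_nonneg (Real.exp_pos _).le (geodesicKernel_nonneg hm _ _)

theorem IsSurfaceGroup.norm_average_le (hΓ : IsSurfaceGroup Γ)
    (hF : IsFundamentalSet Γ F) (hm : DiagonalGenerator Γ m) {s t B : ℝ} (hs : 0 < s) (ht : 0 < t)
    (hB : ∀ w, geodesicKernel Γ m t w ≤ B) (z : ℍ) :
    ‖∫ w : ℍ, Real.exp (-(s * Real.cosh (dist z w))) * geodesicKernel Γ m t w‖ ≤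
      2 * Real.pi / s * Real.exp (-s) * B := by
  rw [Real.norm_of_nonneg (integral_exp_mul_geodesicKernel_nonneg hm s t z)]
  exact hΓ.integral_exp_mul_geodesicKernel_le hF hm hs ht hB z

theorem IsSurfaceGroup.kernelPairing_le (hΓ : IsSurfaceGroup Γ)
    (hF : IsFundamentalSet Γ F) (hm : DiagonalGenerator Γ m) {s t B : ℝ} (hs : 0 < s) (ht : 0 < t)
    (hB : ∀ w, geodesicKernel Γ m t w ≤ B) :
    kernelPairing Γ m s t ≤ 2 * Real.pi / s * Real.exp (-s) * B * geodesicLength m := by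
  have h := intervalIntegral.norm_integral_le_of_norm_le_const (a := 0) (b := geodesicLength m)
    (f := fun u => ∫ w : ℍ, Real.exp (-(s * Real.cosh (dist (axisPoint u) w))) *
      geodesicKernel Γ m t w) (fun u _ => hΓ.norm_average_le hF hm hs ht hB (axisPoint u))
  rw [sub_zero, abs_of_pos hm.geodesicLength_pos] at h
  exact (le_abs_self _).trans h

/-- Bessel's inequality for the kernels. -/
theorem IsEigenbasis.exists_tsum_besselK_sq_le (hb : IsEigenbasis Γ F φ lam r b)
    (hΓ : IsSurfaceGroup Γ) (hF : IsFundamentalSet Γ F) (hm : DiagonalGenerator Γ m) :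
    ∃ A : ℝ, 0 ≤ A ∧ ∀ s, 1 ≤ s →
      Summable (fun n => (besselK (Complex.I * r n) s).re ^ 2 * ‖period Γ m (φ n)‖ ^ 2) ∧
      ∑' n, (besselK (Complex.I * r n) s).re ^ 2 * ‖period Γ m (φ n)‖ ^ 2 ≤
        A * Real.exp (-s) ^ 2 := by
  obtain ⟨C, hC0, hC⟩ := hΓ.exists_geodesicKernel_le hF hm
  have hl := hm.geodesicLength_pos
  refine ⟨C * geodesicLength m / 4, by positivity, fun s hs => ?_⟩
  have hs0 : 0 < s := by linarith
  have hpi := Real.pi_pos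
  -- Here `s / (8π)` is the inverse of `(2 √(2π / s))²`.
  have h := (hb.hasSum_kernelPairing hΓ hF hm hs0 hs0).mul_left (s / (8 * Real.pi))
  have h1 : HasSum (fun n => (besselK (Complex.I * r n) s).re ^ 2 * ‖period Γ m (φ n)‖ ^ 2)
      (s / (8 * Real.pi) * kernelPairing Γ m s s) := by
    refine h.congr_fun fun n => ?_
    have hq : √(2 * Real.pi / s) ^ 2 = 2 * Real.pi / s := Real.sq_sqrt (by positivity)
    have : s / (8 * Real.pi) * (4 * √(2 * Real.pi / s) ^ 2) = 1 := by
      rw [hq]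
      field_simp
      norm_num
    linear_combination (-(besselK (Complex.I * r n) s).re ^ 2 * ‖period Γ m (φ n)‖ ^ 2) * this
  refine ⟨h1.summable, ?_⟩
  rw [h1.tsum_eq]
  calc s / (8 * Real.pi) * kernelPairing Γ m s s
      ≤ s / (8 * Real.pi) * (2 * Real.pi / s * Real.exp (-s) * (C * Real.exp (-s)) *
        geodesicLength m) := by
        gcongr
        exact hΓ.kernelPairing_le hF hm hs0 hs0 (hC s hs)
    _ = C * geodesicLength m / 4 * Real.exp (-s) ^ 2 := by
        field_simp
        ring

/-- With `ρ = r²`, eighth power decay in `r` is fourth power decay in `ρ`. The eigenvalues with `ρ ≤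
1`, where `r` may be imaginary, are covered by the bound through the mass of the kernel. -/
theorem IsEigenbasis.exists_abs_besselK_le (hb : IsEigenbasis Γ F φ lam r b)
    (hΓ : IsSurfaceGroup Γ) {t : ℝ} (ht : 0 < t) :
    ∃ C : ℝ, 0 ≤ C ∧ ∀ n, |(besselK (Complex.I * r n) t).re| ≤
      C / (⌈max (lam n - 1 / 4) 1⌉₊ : ℝ) ^ 4 := by
  obtain ⟨C₁, hC₁⟩ := exists_im_pow_mul_norm_besselK_le ht 8 0
  set q := 2 * √(2 * Real.pi / t) with hq
  have hpi := Real.pi_pos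
  have hq0 : 0 < q := by positivity
  set C₀ := 2 * Real.pi / t * Real.exp (-t) / q with hC₀
  have hC₀0 : 0 ≤ C₀ := by positivity
  -- The integer `j = ⌈max ρ 1⌉` is at most `2 max ρ 1`, whence `16 = 2 ^ 4`.
  refine ⟨16 * max C₀ C₁, by positivity, fun n => ?_⟩
  set ρ := lam n - 1 / 4 with hρ
  have hj1 : max ρ 1 ≤ (⌈max ρ 1⌉₊ : ℝ) := Nat.le_ceil _
  have hj2 : (⌈max ρ 1⌉₊ : ℝ) < max ρ 1 + 1 := Nat.ceil_lt_add_one (by positivity)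
  have h1 : (1 : ℝ) ≤ max ρ 1 := le_max_right _ _
  set j : ℝ := (⌈max ρ 1⌉₊ : ℝ)
  have hj : 0 < j := by linarith
  rw [le_div_iff₀ (by positivity)]
  have hj4 : j ^ 4 ≤ 16 * max ρ 1 ^ 4 := by
    calc j ^ 4 ≤ (2 * max ρ 1) ^ 4 := by gcongr; linarith
      _ = _ := by ring
  have h0 : |(besselK (Complex.I * r n) t).re| ≤ C₀ := by
    rw [hC₀, le_div_iff₀ hq0, mul_comm]
    exact hb.abs_besselK_le hΓ ht n
  have key : |(besselK (Complex.I * r n) t).re| * max ρ 1 ^ 4 ≤ max C₀ C₁ := by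
    rcases le_or_gt ρ 1 with h | h
    · rw [max_eq_right h, one_pow, mul_one]
      exact h0.trans (le_max_left _ _)
    · have hr := hb.sq_eq n
      rw [← hρ] at hr
      have e1 := congrArg Complex.re hr
      have e2 := congrArg Complex.im hr
      simp only [pow_two, Complex.mul_im, Complex.mul_re, Complex.ofReal_im,
        Complex.ofReal_re] at e1 e2
      have him : (r n).im = 0 := by
        have : (r n).re * (r n).im = 0 := by linarith
        rcases mul_eq_zero.mp this with h' | h'
        · rw [h'] at e1
          nlinarith [sq_nonneg (r n).im]
        · exact h'
      have hre : |(r n).re| ^ 8 = ρ ^ 4 := by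
        rw [him] at e1
        rw [← e1, show |(r n).re| ^ 8 = (|(r n).re| ^ 2) ^ 4 by ring, sq_abs]
        ring
      have h2 := hC₁ (Complex.I * r n) (by simp [him])
      simp only [Complex.mul_im, Complex.I_re, Complex.I_im, zero_mul, one_mul, zero_add] at h2
      rw [hre] at h2
      rw [max_eq_left h.le]
      refine le_trans ?_ (h2.trans (le_max_right _ _))
      rw [mul_comm]
      gcongr
      exact Complex.abs_re_le_norm _
  calc |(besselK (Complex.I * r n) t).re| * j ^ 4
      ≤ |(besselK (Complex.I * r n) t).re| * (16 * max ρ 1 ^ 4) := by gcongr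
    _ = 16 * (|(besselK (Complex.I * r n) t).re| * max ρ 1 ^ 4) := by ring
    _ ≤ _ := by gcongr

/-- Terms are grouped by `j = ⌈max ρ 1⌉`. Bessel's inequality at the parameter `j`, where `K_{ir}(j)
≥ K_0(j) / 2`, bounds the squared periods in the group by `O(j²)`, and the decay `j^(-4)` of
`K_{ir}(t)` makes the sum over groups converge. -/
theorem IsEigenbasis.summable_besselK_mul (hb : IsEigenbasis Γ F φ lam r b)
    (hΓ : IsSurfaceGroup Γ) (hF : IsFundamentalSet Γ F) (hm : DiagonalGenerator Γ m) {t : ℝ}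
    (ht : 0 < t) :
    Summable fun n => (besselK (Complex.I * r n) t).re * ‖period Γ m (φ n)‖ ^ 2 := by
  obtain ⟨C, hC0, hC⟩ := hb.exists_abs_besselK_le hΓ ht
  obtain ⟨A, hA0, hA⟩ := hb.exists_tsum_besselK_sq_le hΓ hF hm
  -- A majorant over all pairs `(j, n)`, not only those with `j` attached to `n`: the full rows are
  -- what Bessel's inequality controls.
  set f : ℕ × ℕ → ℝ := fun p => C / (p.1 : ℝ) ^ 4 * (4 / besselK₀ p.1 ^ 2) *
    ((besselK (Complex.I * r p.2) p.1).re ^ 2 * ‖period Γ m (φ p.2)‖ ^ 2) with hf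
  have hf0 : 0 ≤ f := fun p => by
    simp only [hf, Pi.zero_apply]
    positivity
  have hfs : Summable f := by
    rw [summable_prod_of_nonneg hf0]
    refine ⟨fun j => ?_, ?_⟩
    · simp only [hf]
      -- The row `j = 0` vanishes, as division by `0 ^ 4` gives `0`.
      rcases Nat.eq_zero_or_pos j with rfl | hj
      · simp
      · exact (hA j (by exact_mod_cast hj)).1.mul_left _
    · refine Summable.of_nonneg_of_le (fun j => tsum_nonneg fun n => hf0 _) (fun j => ?_)
        ((Real.summable_one_div_nat_pow.mpr (by norm_num : 1 < 2)).mul_left (16 * A * C))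
      simp only [hf]
      rw [tsum_mul_left]
      rcases Nat.eq_zero_or_pos j with rfl | hj
      · simp
      have hj1 : (1 : ℝ) ≤ j := by exact_mod_cast hj
      have hj0 : (0 : ℝ) < j := by linarith
      have hk := exp_neg_le_besselK₀ hj1
      have hk0 := besselK₀_pos hj0
      -- This converts the bound `A exp (- 2j)` into `4 A j² K_0(j)²`, so that the row sum is at
      -- most `16 A C / j²`.
      have hk2 : Real.exp (-(j : ℝ)) ^ 2 ≤ 4 * j ^ 2 * besselK₀ j ^ 2 := by
        have : Real.exp (-(j : ℝ)) ≤ 2 * j * besselK₀ j := by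
          calc Real.exp (-(j : ℝ)) = 2 * j * (1 / (2 * j) * Real.exp (-(j : ℝ))) := by
                field_simp
            _ ≤ _ := by gcongr
        calc Real.exp (-(j : ℝ)) ^ 2 ≤ (2 * j * besselK₀ j) ^ 2 := by gcongr
          _ = _ := by ring
      calc C / (j : ℝ) ^ 4 * (4 / besselK₀ j ^ 2) *
            ∑' n, (besselK (Complex.I * r n) j).re ^ 2 * ‖period Γ m (φ n)‖ ^ 2
          ≤ C / (j : ℝ) ^ 4 * (4 / besselK₀ j ^ 2) * (A * (4 * j ^ 2 * besselK₀ j ^ 2)) := by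
            gcongr
            exact (hA j hj1).2.trans (by gcongr)
        _ = 16 * A * C * (1 / (j : ℝ) ^ 2) := by
            field_simp
            ring
  -- The original series is dominated by the majorant along the graph of `n ↦ (j, n)`.
  have hinj : Function.Injective fun n : ℕ => (⌈max (lam n - 1 / 4) 1⌉₊, n) :=
    fun a b h => (Prod.mk.inj h).2
  refine Summable.of_norm_bounded (hfs.comp_injective hinj) fun n => ?_
  simp only [hf, Function.comp_apply]
  have hj1 : max (lam n - 1 / 4) 1 ≤ (⌈max (lam n - 1 / 4) 1⌉₊ : ℝ) := Nat.le_ceil _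
  have hn := hC n
  set ρ := lam n - 1 / 4 with hρ
  set j : ℝ := (⌈max ρ 1⌉₊ : ℝ)
  have h1 : (1 : ℝ) ≤ j := (le_max_right _ _).trans hj1
  have h2 : max ρ 0 ≤ j := max_le ((le_max_left _ _).trans hj1) (by linarith)
  have hj0 : 0 < j := by linarith
  have hk0 := besselK₀_pos hj0
  -- Since `max ρ 0 ≤ j`, the factor `1 - max ρ 0 / (2 j)` is at least `1 / 2`.
  have hlow : 1 / 2 * besselK₀ j ≤ (besselK (Complex.I * r n) j).re := by
    refine le_trans ?_ (besselK_real_and_le (hb.sq_eq n) hj0).2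
    gcongr
    have : max ρ 0 / (2 * j) ≤ 1 / 2 := by
      rw [div_le_iff₀ (by positivity)]
      linarith
    rw [← hρ]
    linarith
  have hone : 1 ≤ 4 / besselK₀ j ^ 2 * (besselK (Complex.I * r n) j).re ^ 2 := by
    rw [div_mul_eq_mul_div, le_div_iff₀ (by positivity), one_mul]
    calc besselK₀ j ^ 2 = 4 * (1 / 2 * besselK₀ j) ^ 2 := by ring
      _ ≤ _ := by gcongr
  rw [norm_mul, Real.norm_eq_abs, Real.norm_of_nonneg (by positivity : 0 ≤ ‖period Γ m (φ n)‖ ^ 2)]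
  calc |(besselK (Complex.I * r n) t).re| * ‖period Γ m (φ n)‖ ^ 2
      ≤ C / j ^ 4 * ‖period Γ m (φ n)‖ ^ 2 * 1 := by rw [mul_one]; gcongr
    _ ≤ C / j ^ 4 * ‖period Γ m (φ n)‖ ^ 2 *
        (4 / besselK₀ j ^ 2 * (besselK (Complex.I * r n) j).re ^ 2) := by gcongr
    _ = _ := by ring

/-! ### The spectral expansion on the geodesic -/

theorem tendsto_besselK_normalized (ν : ℂ) :
    Tendsto (fun s : ℝ => 2 * √(2 * Real.pi / s) * (besselK ν s).re /
      (2 * Real.pi / s * Real.exp (-s))) atTop (𝓝 1) := by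
  have h := (Complex.continuous_re.tendsto _).comp (sqrt_mul_exp_mul_besselK_tendsto ν)
  rw [Complex.ofReal_re] at h
  have hpi := Real.pi_pos
  have h2 := h.const_mul (√(2 / Real.pi))
  rw [← Real.sqrt_mul (by positivity), show 2 / Real.pi * (Real.pi / 2) = 1 by field_simp,
    Real.sqrt_one] at h2
  refine h2.congr' ?_
  filter_upwards [eventually_gt_atTop 0] with s hs
  simp only [Function.comp_apply, Complex.re_ofReal_mul]
  rw [Real.exp_neg, show 2 * Real.pi / s = (2 / Real.pi) * (Real.pi ^ 2 / s) by field_simp,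
    Real.sqrt_mul (by positivity), Real.sqrt_div (sq_nonneg Real.pi) s, Real.sqrt_sq hpi.le]
  have hs2 : √s ^ 2 = s := Real.sq_sqrt hs.le
  have hs0 : 0 < √s := Real.sqrt_pos.mpr hs
  have he := Real.exp_pos s
  rw [eq_div_iff (by positivity)]
  rw [← hs2]
  simp only [Real.sqrt_sq hs0.le]
  field_simp

theorem IsSurfaceGroup.tendsto_average_geodesicKernel (hΓ : IsSurfaceGroup Γ)
    (hF : IsFundamentalSet Γ F) (hm : DiagonalGenerator Γ m) {t : ℝ} (ht : 0 < t) (z : ℍ) :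
    Tendsto (fun s : ℝ => (∫ w : ℍ, Real.exp (-(s * Real.cosh (dist z w))) *
      geodesicKernel Γ m t w) / (2 * Real.pi / s * Real.exp (-s))) atTop
      (𝓝 (geodesicKernel Γ m t z)) := by
  have hcont := hΓ.continuous_geodesicKernel hF m ht
  have hconc := tendsto_laplaceMoment_div (μ := volume) (c := fun w : ℍ => Real.cosh (dist z w))
    (f := fun w : ℍ => (geodesicKernel Γ m t w : ℂ))
    (fun s hs => by
      have := (hΓ.integrable_exp_mul_geodesicKernel hF hm hs ht z).ofReal (𝕜 := ℂ)
      simpa using this)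
    (fun s hs => integrable_exp_neg_mul_coshDist z hs) (κ := 2 * Real.pi) (by positivity)
    (fun s hs => (integral_exp_neg_mul_coshDist z (by linarith)).ge)
    (f₀ := (geodesicKernel Γ m t z : ℂ)) (fun ε hε => by
      obtain ⟨d, hd, hd'⟩ := Metric.continuousAt_iff.mp (hcont.continuousAt (x := z)) ε hε
      refine ⟨d ^ 2 / 2, by positivity, fun w hw => ?_⟩
      have h1 := one_add_sq_div_two_le_cosh (dist z w)
      have h2 : dist z w < d := lt_of_pow_lt_pow_left₀ 2 hd.le (by linarith)
      rw [dist_comm] at h2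
      have := hd' h2
      rw [← Complex.ofReal_sub, Complex.norm_real, ← dist_eq_norm]
      exact this.le)
  have h2 := (Complex.continuous_re.tendsto _).comp hconc
  rw [Complex.ofReal_re] at h2
  refine h2.congr' ?_
  filter_upwards [eventually_gt_atTop 0] with s hs
  rw [Function.comp_apply, integral_exp_neg_mul_coshDist z hs, Complex.div_ofReal_re]
  congr 1
  have : laplaceMoment volume (fun w : ℍ => Real.cosh (dist z w))
      (fun w => (geodesicKernel Γ m t w : ℂ)) 0 s =
      ((∫ w : ℍ, Real.exp (-(s * Real.cosh (dist z w))) * geodesicKernel Γ m t w : ℝ) : ℂ) := by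
    rw [← integral_complex_ofReal]
    simp [laplaceMoment]
  rw [this, Complex.ofReal_re]

/-- The normalized averages stay below the supremum of the geodesic kernel and converge to it
pointwise on the geodesic. -/
theorem IsSurfaceGroup.tendsto_kernelPairing (hΓ : IsSurfaceGroup Γ)
    (hF : IsFundamentalSet Γ F) (hm : DiagonalGenerator Γ m) {t : ℝ} (ht : 0 < t) :
    Tendsto (fun s : ℝ => kernelPairing Γ m s t / (2 * Real.pi / s * Real.exp (-s))) atTop
      (𝓝 (∫ u in (0 : ℝ)..geodesicLength m, geodesicKernel Γ m t (axisPoint u))) := by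
  obtain ⟨B, hB0, hB⟩ := hΓ.exists_geodesicKernel_bound hF hm ht
  have hpi := Real.pi_pos
  have hcont := hΓ.continuous_geodesicKernel hF m ht
  simp only [kernelPairing, ← intervalIntegral.integral_div]
  refine intervalIntegral.tendsto_integral_filter_of_dominated_convergence (fun _ => B) ?_ ?_
    (continuous_const.intervalIntegrable _ _) ?_
  · refine Eventually.of_forall fun s => ?_
    have hc : Continuous fun p : ℝ × ℍ => Real.exp (-(s * Real.cosh (dist (axisPoint p.1) p.2))) *
        geodesicKernel Γ m t p.2 := by
      refine Continuous.mul ?_ (hcont.comp continuous_snd)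
      have := (continuous_axisPoint.comp continuous_fst).dist (continuous_snd (X := ℝ) (Y := ℍ))
      exact Real.continuous_exp.comp ((continuous_const.mul (Real.continuous_cosh.comp this)).neg)
    have := (hc.stronglyMeasurable.integral_prod_right' (ν := (volume : Measure ℍ)))
    exact (this.measurable.div_const _).aestronglyMeasurable
  · filter_upwards [eventually_gt_atTop 0] with s hs
    refine Eventually.of_forall fun u _ => ?_
    have hM : 0 < 2 * Real.pi / s * Real.exp (-s) := by positivity
    rw [norm_div, Real.norm_of_nonneg hM.le, div_le_iff₀ hM, mul_comm B]
    exact hΓ.norm_average_le hF hm hs ht hB (axisPoint u)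
  · exact Eventually.of_forall fun u _ => hΓ.tendsto_average_geodesicKernel hF hm ht _

/-- The spectral side of the trace formula along the geodesic. -/
theorem IsEigenbasis.tsum_besselK_mul (hb : IsEigenbasis Γ F φ lam r b)
    (hΓ : IsSurfaceGroup Γ) (hF : IsFundamentalSet Γ F) (hm : DiagonalGenerator Γ m) {t : ℝ}
    (ht : 0 < t) :
    2 * √(2 * Real.pi / t) *
      ∑' n, (besselK (Complex.I * r n) t).re * ‖period Γ m (φ n)‖ ^ 2 =
      ∫ u in (0 : ℝ)..geodesicLength m, geodesicKernel Γ m t (axisPoint u) := by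
  have hpi := Real.pi_pos
  have hsum := (hb.summable_besselK_mul hΓ hF hm ht).mul_left (2 * √(2 * Real.pi / t))
  refine tendsto_nhds_unique ?_ (hΓ.tendsto_kernelPairing hF hm ht)
  rw [← tsum_mul_left]
  -- The normalized multipliers at `s` are at most `1` in absolute value and tend to `1`; the
  -- absolutely convergent series at `t` dominates.
  have h := tendsto_tsum_of_dominated_convergence (𝓕 := atTop)
    (f := fun (s : ℝ) (n : ℕ) => 2 * √(2 * Real.pi / s) * (besselK (Complex.I * r n) s).re /
      (2 * Real.pi / s * Real.exp (-s)) *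
      (2 * √(2 * Real.pi / t) * ((besselK (Complex.I * r n) t).re * ‖period Γ m (φ n)‖ ^ 2)))
    (g := fun n => 2 * √(2 * Real.pi / t) *
      ((besselK (Complex.I * r n) t).re * ‖period Γ m (φ n)‖ ^ 2))
    hsum.norm (fun n => by
      simpa using (tendsto_besselK_normalized (Complex.I * r n)).mul_const
        (2 * √(2 * Real.pi / t) * ((besselK (Complex.I * r n) t).re * ‖period Γ m (φ n)‖ ^ 2)))
    (by
      filter_upwards [eventually_gt_atTop 0] with s hs n
      have hM : 0 < 2 * Real.pi / s * Real.exp (-s) := by positivity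
      rw [norm_mul]
      refine mul_le_of_le_one_left (norm_nonneg _) ?_
      rw [norm_div, Real.norm_of_nonneg hM.le, div_le_one hM, norm_mul,
        Real.norm_of_nonneg (by positivity)]
      exact hb.abs_besselK_le hΓ hs n)
  refine h.congr' ?_
  filter_upwards [eventually_gt_atTop 0] with s hs
  rw [← (hb.hasSum_kernelPairing hΓ hF hm hs ht).tsum_eq, ← tsum_div_const]
  refine tsum_congr fun n => ?_
  ring

end
section

/-! ### The hyperbolic cosine of the distance between points of two geodesics -/

theorem axisPoint_re (u : ℝ) : (axisPoint u).re = 0 := by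
  change ((Real.exp u : ℂ) * Complex.I).re = 0
  simp [-Complex.ofReal_exp]

theorem axisPoint_im (u : ℝ) : (axisPoint u).im = Real.exp u := by
  change ((Real.exp u : ℂ) * Complex.I).im = Real.exp u
  simp [-Complex.ofReal_exp]

theorem coe_axisPoint (u : ℝ) : (axisPoint u : ℂ) = (Real.exp u : ℂ) * Complex.I := rfl

theorem SL_det_eq (g : SL(2, ℝ)) : g 0 0 * g 1 1 - g 0 1 * g 1 0 = 1 := by
  have := Matrix.det_fin_two g.1
  rw [g.2] at this
  exact this.symm

theorem smul_axisPoint_re_im (g : SL(2, ℝ)) (v : ℝ) :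
    (g • axisPoint v).re = (g 0 0 * g 1 0 * Real.exp v ^ 2 + g 0 1 * g 1 1) /
      (g 1 0 ^ 2 * Real.exp v ^ 2 + g 1 1 ^ 2) ∧
    (g • axisPoint v).im = Real.exp v / (g 1 0 ^ 2 * Real.exp v ^ 2 + g 1 1 ^ 2) := by
  have hdet := SL_det_eq g
  have hY := Real.exp_pos v
  set Y := Real.exp v with hYdef
  have hden : 0 < g 1 0 ^ 2 * Y ^ 2 + g 1 1 ^ 2 := by
    by_contra! h
    have h1 : g 1 0 * Y = 0 := by nlinarith [sq_nonneg (g 1 0 * Y), sq_nonneg (g 1 1)]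
    have h2 : g 1 1 = 0 := by nlinarith [sq_nonneg (g 1 0 * Y), sq_nonneg (g 1 1)]
    have h3 : g 1 0 = 0 := by
      rcases mul_eq_zero.mp h1 with h | h
      · exact h
      · exact absurd h hY.ne'
    rw [h2, h3] at hdet
    norm_num at hdet
  have hc : ((g • axisPoint v : ℍ) : ℂ) =
      ((g 0 0 : ℂ) * (Y * Complex.I) + g 0 1) / ((g 1 0 : ℂ) * (Y * Complex.I) + g 1 1) := by
    rw [UpperHalfPlane.coe_specialLinearGroup_apply, coe_axisPoint]
    rfl
  have hn : Complex.normSq ((g 1 0 : ℂ) * (Y * Complex.I) + g 1 1) =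
      g 1 0 ^ 2 * Y ^ 2 + g 1 1 ^ 2 := by
    simp [Complex.normSq_apply]
    ring
  constructor
  · rw [← UpperHalfPlane.coe_re, hc, Complex.div_re, hn, ← add_div]
    congr 1
    simp
    ring
  · rw [← UpperHalfPlane.coe_im, hc, Complex.div_im, hn, ← sub_div]
    congr 1
    simp
    linear_combination Y * hdet

/-- The separation of `u - v` from `u + v` is what makes the double integral over the two axes a
product. -/
theorem cosh_dist_axisPoint_smul (g : SL(2, ℝ)) (u v : ℝ) :
    Real.cosh (dist (axisPoint u) (g • axisPoint v)) =
      1 / 2 * (g 0 0 ^ 2 * Real.exp (-(u - v)) + g 1 1 ^ 2 * Real.exp (u - v)) +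
      1 / 2 * (g 0 1 ^ 2 * Real.exp (-(u + v)) + g 1 0 ^ 2 * Real.exp (u + v)) := by
  obtain ⟨hre, him⟩ := smul_axisPoint_re_im g v
  have hdet := SL_det_eq g
  have himpos := (g • axisPoint v).im_pos
  rw [UpperHalfPlane.cosh_dist', axisPoint_re, axisPoint_im, hre]
  rw [him] at himpos ⊢
  have hU := Real.exp_pos u
  have hY := Real.exp_pos v
  rw [neg_sub, neg_add, Real.exp_sub, Real.exp_sub, Real.exp_add, Real.exp_add, Real.exp_neg,
    Real.exp_neg]
  set Y := Real.exp v
  set U := Real.exp u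
  have hden : 0 < g 1 0 ^ 2 * Y ^ 2 + g 1 1 ^ 2 := by
    rcases div_pos_iff.mp himpos with h | h
    · exact h.2
    · exact absurd hY (not_lt.mpr h.1.le)
  -- This is `|a z + b|² |c z + d|²` split into the squares of the real and imaginary parts of `(a z
  -- + b)` times the conjugate of `(c z + d)`, at `z = iY`, with determinant `1`.
  have hlag : (g 0 0 * g 1 0 * Y ^ 2 + g 0 1 * g 1 1) ^ 2 + Y ^ 2 =
      (g 0 0 ^ 2 * Y ^ 2 + g 0 1 ^ 2) * (g 1 0 ^ 2 * Y ^ 2 + g 1 1 ^ 2) := by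
    linear_combination (-(g 0 0 * g 1 1 - g 0 1 * g 1 0) - 1) * Y ^ 2 * hdet
  set D := g 1 0 ^ 2 * Y ^ 2 + g 1 1 ^ 2 with hD
  set N := g 0 0 * g 1 0 * Y ^ 2 + g 0 1 * g 1 1
  have : (0 - N / D) ^ 2 + U ^ 2 + (Y / D) ^ 2 = (g 0 0 ^ 2 * Y ^ 2 + g 0 1 ^ 2) / D + U ^ 2 := by
    field_simp
    linear_combination hlag
  rw [this]
  field_simp
  rw [hD]
  ring

/-! ### Integrals over the full geodesics -/

theorem lintegral_comp_two_mul_add {B : ℝ → ENNReal} (hB : Measurable B) (p : ℝ) :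
    ∫⁻ v, B (p + 2 * v) = ENNReal.ofReal (1 / 2) * ∫⁻ v, B v := by
  have h := Real.map_volume_mul_left (a := 2) (by norm_num)
  have h2 : ∫⁻ v, B (p + 2 * v) = ∫⁻ x, B (p + x) ∂(Measure.map (fun v : ℝ => 2 * v) volume) :=
    (lintegral_map (hB.comp (measurable_const_add p)) (measurable_const_mul 2)).symm
  rw [h2, h, lintegral_smul_measure, lintegral_add_left_eq_self]
  norm_num

/-- The change of variables `p = u - v`, `q = u + v` has Jacobian `1 / 2`; it is carried out one
variable at a time, as `u = p + v` and then `q = p + 2v`. -/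
theorem lintegral_lintegral_sub_add {A B : ℝ → ENNReal} (hA : Measurable A) (hB : Measurable B) :
    ∫⁻ u, ∫⁻ v, A (u - v) * B (u + v) = ENNReal.ofReal (1 / 2) * ((∫⁻ p, A p) * ∫⁻ q, B q) := by
  have hm : Measurable (Function.uncurry fun u v : ℝ => A (u - v) * B (u + v)) := by
    change Measurable fun p : ℝ × ℝ => A (p.1 - p.2) * B (p.1 + p.2)
    fun_prop
  rw [lintegral_lintegral_swap hm.aemeasurable]
  have e1 : ∀ v : ℝ, ∫⁻ u, A (u - v) * B (u + v) = ∫⁻ p, A p * B (p + 2 * v) := by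
    intro v
    rw [← lintegral_add_right_eq_self _ v]
    refine lintegral_congr fun p => ?_
    congr 2 <;> ring
  simp_rw [e1]
  have hm2 : Measurable (Function.uncurry fun v p : ℝ => A p * B (p + 2 * v)) := by
    change Measurable fun p : ℝ × ℝ => A p.2 * B (p.2 + 2 * p.1)
    fun_prop
  rw [lintegral_lintegral_swap hm2.aemeasurable]
  have e2 : ∀ p : ℝ, ∫⁻ v, A p * B (p + 2 * v) = A p * (ENNReal.ofReal (1 / 2) * ∫⁻ q, B q) := by
    intro p
    rw [lintegral_const_mul _ (by fun_prop), lintegral_comp_two_mul_add hB]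
  simp_rw [e2]
  rw [lintegral_mul_const _ hA]
  ring

theorem lintegral_exp_cosh {x : ℝ} (hx : 0 < x) :
    ∫⁻ u, ENNReal.ofReal (Real.exp (-(x * Real.cosh u))) = ENNReal.ofReal (2 * besselK₀ x) := by
  rw [← ofReal_integral_eq_lintegral_ofReal (integrable_exp_cosh hx)
    (Eventually.of_forall fun _ => (Real.exp_pos _).le), besselK₀]
  congr 1
  ring

/-- The shift by `log (|α| / |β|)` balances the two exponentials, turning the exponent into `s |α β|
cosh p`. -/
theorem lintegral_exp_two_exp {s α β : ℝ} (hs : 0 < s) (hα : α ≠ 0) (hβ : β ≠ 0) :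
    ∫⁻ p, ENNReal.ofReal (Real.exp (-(s * (1 / 2 * (α ^ 2 * Real.exp (-p) + β ^ 2 * Real.exp p))))) =
      ENNReal.ofReal (2 * besselK₀ (s * |α * β|)) := by
  have hα0 := abs_pos.mpr hα
  have hβ0 := abs_pos.mpr hβ
  rw [← lintegral_exp_cosh (by positivity), ← lintegral_add_right_eq_self _ (Real.log (|α| / |β|))]
  refine lintegral_congr fun p => ?_
  congr 3
  rw [neg_add, Real.exp_add, Real.exp_add, Real.exp_neg (Real.log _), Real.exp_log (by positivity),
    Real.cosh_eq, abs_mul, ← sq_abs α, ← sq_abs β]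
  field_simp
  ring

theorem lintegral_exp_coshDist_axisPoint {s : ℝ} (hs : 0 < s) {g : SL(2, ℝ)} (h00 : g 0 0 ≠ 0)
    (h01 : g 0 1 ≠ 0) (h10 : g 1 0 ≠ 0) (h11 : g 1 1 ≠ 0) :
    ∫⁻ u, ∫⁻ v, ENNReal.ofReal (Real.exp (-(s * Real.cosh (dist (axisPoint u) (g • axisPoint v))))) =
      ENNReal.ofReal (2 * besselK₀ (s * |g 0 0 * g 1 1|) * besselK₀ (s * |g 0 1 * g 1 0|)) := by
  have h := lintegral_lintegral_sub_add
    (A := fun p => ENNReal.ofReal (Real.exp (-(s * (1 / 2 * (g 0 0 ^ 2 * Real.exp (-p) +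
      g 1 1 ^ 2 * Real.exp p))))))
    (B := fun p => ENNReal.ofReal (Real.exp (-(s * (1 / 2 * (g 0 1 ^ 2 * Real.exp (-p) +
      g 1 0 ^ 2 * Real.exp p)))))) (by fun_prop) (by fun_prop)
  rw [lintegral_exp_two_exp hs h00 h11, lintegral_exp_two_exp hs h01 h10,
    ← ENNReal.ofReal_mul (mul_nonneg zero_le_two (besselK₀_pos (by positivity)).le),
    ← ENNReal.ofReal_mul (by norm_num)] at h
  rw [show 1 / 2 * (2 * besselK₀ (s * |g 0 0 * g 1 1|) * (2 * besselK₀ (s * |g 0 1 * g 1 0|))) =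
    2 * besselK₀ (s * |g 0 0 * g 1 1|) * besselK₀ (s * |g 0 1 * g 1 0|) by ring] at h
  rw [← h]
  refine lintegral_congr fun u => lintegral_congr fun v => ?_
  rw [cosh_dist_axisPoint_smul, ← ENNReal.ofReal_mul (Real.exp_pos _).le, ← Real.exp_add]
  congr 2
  ring

theorem lintegral_exp_coshDist_axisPoint_same {s : ℝ} (hs : 0 < s) (u : ℝ) :
    ∫⁻ v, ENNReal.ofReal (Real.exp (-(s * Real.cosh (dist (axisPoint u) (axisPoint v))))) =
      ENNReal.ofReal (2 * besselK₀ s) := by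
  rw [← lintegral_exp_cosh hs, ← lintegral_sub_left_eq_self _ u]
  refine lintegral_congr fun v => ?_
  have h := cosh_dist_axisPoint_smul 1 u (u - v)
  rw [one_smul] at h
  rw [h, Real.cosh_eq, sub_sub_cancel]
  congr 3
  simp
  left
  ring

theorem tsum_setLIntegral_add_zsmul {ℓ : ℝ} (hℓ : 0 < ℓ) (f : ℝ → ENNReal) :
    ∑' j : ℤ, ∫⁻ u in Ioc 0 ℓ, f (u + j * ℓ) = ∫⁻ u, f u := by
  have h := lintegral_iUnion (μ := volume) (s := fun j : ℤ => Ioc (j • ℓ) ((j + 1) • ℓ))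
    (fun _ => measurableSet_Ioc) (pairwise_disjoint_Ioc_zsmul ℓ) f
  rw [iUnion_Ioc_zsmul hℓ, Measure.restrict_univ] at h
  rw [h]
  refine tsum_congr fun j => ?_
  have hmp := (measurePreserving_add_right volume ((j : ℝ) * ℓ))
  have h2 := hmp.setLIntegral_comp_preimage_emb (measurableEmbedding_addRight _) f
    (Ioc (j • ℓ) ((j + 1) • ℓ))
  rw [← h2]
  congr 2
  ext x
  simp only [mem_preimage, mem_Ioc, zsmul_eq_mul, Int.cast_add, Int.cast_one]
  constructor <;> rintro ⟨h1, h2⟩ <;> constructor <;> linarith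

end
section

variable {Γ : Subgroup SL(2, ℝ)} {F : Set ℍ} {m : ℝ}

/-! ### The diagonal subgroup -/

/-- The matrix `± diag (m ^ k, m ^ (-k))`, with the sign `-` if `ε` is true. -/
def diagonalMatrix (m : ℝ) (hm : m ≠ 0) (k : ℤ) (ε : Bool) : SL(2, ℝ) :=
  ⟨!![cond ε (-1) 1 * m ^ k, 0; 0, cond ε (-1) 1 * m ^ (-k)], by
    rw [Matrix.det_fin_two_of, zpow_neg]
    have : m ^ k ≠ 0 := zpow_ne_zero _ hm
    cases ε <;> simp [this]⟩

theorem DiagonalGenerator.pos (hm : DiagonalGenerator Γ m) : 0 < m := by linarith [hm.one_lt]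

theorem DiagonalGenerator.diagonalMatrix_mem (hm : DiagonalGenerator Γ m) (k : ℤ) (ε : Bool) :
    diagonalMatrix m hm.pos.ne' k ε ∈ Γ := by
  refine (hm.mem_iff _ (by simp [diagonalMatrix]) (by simp [diagonalMatrix])).mpr ⟨k, ?_⟩
  have : 0 < m ^ k := zpow_pos hm.pos k
  cases ε <;> simp [diagonalMatrix, abs_of_pos this]

/-- The elements of the diagonal subgroup of `Γ`. -/
def DiagonalGenerator.elt (hm : DiagonalGenerator Γ m) (k : ℤ) (ε : Bool) : Γ :=
  ⟨diagonalMatrix m hm.pos.ne' k ε, hm.diagonalMatrix_mem k ε⟩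

theorem DiagonalGenerator.elt_apply (hm : DiagonalGenerator Γ m) (k : ℤ) (ε : Bool) :
    (hm.elt k ε : SL(2, ℝ)) 0 0 = cond ε (-1) 1 * m ^ k ∧ (hm.elt k ε : SL(2, ℝ)) 0 1 = 0 ∧
      (hm.elt k ε : SL(2, ℝ)) 1 0 = 0 ∧
      (hm.elt k ε : SL(2, ℝ)) 1 1 = cond ε (-1) 1 * m ^ (-k) := by
  simp [DiagonalGenerator.elt, diagonalMatrix]

theorem SL_mul_apply (x y : SL(2, ℝ)) (i j : Fin 2) :
    (x * y) i j = x i 0 * y 0 j + x i 1 * y 1 j := by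
  rw [Matrix.SpecialLinearGroup.coe_mul, Matrix.mul_apply, Fin.sum_univ_two]

theorem SL_inv_apply (x : SL(2, ℝ)) : x⁻¹ 0 0 = x 1 1 ∧ x⁻¹ 0 1 = -x 0 1 ∧ x⁻¹ 1 0 = -x 1 0 ∧
    x⁻¹ 1 1 = x 0 0 := by
  simp [Matrix.SpecialLinearGroup.coe_inv, Matrix.adjugate_fin_two]

theorem DiagonalGenerator.elt_mem (hm : DiagonalGenerator Γ m) (k : ℤ) (ε : Bool) :
    hm.elt k ε ∈ diagonalSubgroup Γ :=
  ⟨by simp [DiagonalGenerator.elt, diagonalMatrix], by simp [DiagonalGenerator.elt, diagonalMatrix]⟩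

theorem DiagonalGenerator.elt_smul_axisPoint (hm : DiagonalGenerator Γ m) (k : ℤ) (ε : Bool)
    (u : ℝ) : hm.elt k ε • axisPoint u = axisPoint (u + k * geodesicLength m) := by
  obtain ⟨hre, him⟩ := smul_axisPoint_re_im (hm.elt k ε : SL(2, ℝ)) u
  have hmk : (0 : ℝ) < m ^ k := zpow_pos hm.pos k
  change ((hm.elt k ε : SL(2, ℝ)) • axisPoint u) = _
  have h00 : (hm.elt k ε : SL(2, ℝ)) 0 0 ^ 2 = (m ^ k) ^ 2 := by
    cases ε <;> simp [DiagonalGenerator.elt, diagonalMatrix]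
  have h11 : (hm.elt k ε : SL(2, ℝ)) 1 1 ^ 2 = ((m ^ k) ^ 2)⁻¹ := by
    cases ε <;> simp [DiagonalGenerator.elt, diagonalMatrix]
  have hlen : Real.exp (k * geodesicLength m) = (m ^ k) ^ 2 := by
    rw [geodesicLength, show (k : ℝ) * (2 * Real.log m) = Real.log m * (k * 2) by ring, Real.exp_mul,
      Real.exp_log hm.pos, Real.rpow_mul hm.pos.le, Real.rpow_intCast, Real.rpow_two]
  rw [(hm.elt_mem k ε).1, (hm.elt_mem k ε).2] at hre
  rw [(hm.elt_mem k ε).2, h11] at him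
  refine UpperHalfPlane.ext (Complex.ext ?_ ?_)
  · rw [UpperHalfPlane.coe_re, UpperHalfPlane.coe_re, hre, axisPoint_re]
    simp
  · rw [UpperHalfPlane.coe_im, UpperHalfPlane.coe_im, him, axisPoint_im, Real.exp_add, hlen]
    field_simp
    ring

theorem DiagonalGenerator.zpow_injective (hm : DiagonalGenerator Γ m) :
    Function.Injective fun k : ℤ => m ^ k :=
  zpow_right_injective₀ hm.pos hm.one_lt.ne'

/-- The parametrization of the diagonal subgroup. -/
def DiagonalGenerator.equiv (hm : DiagonalGenerator Γ m) : ℤ × Bool ≃ diagonalSubgroup Γ :=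
  Equiv.ofBijective (fun p => ⟨hm.elt p.1 p.2, hm.elt_mem p.1 p.2⟩) (by
    constructor
    · rintro ⟨k, ε⟩ ⟨k', ε'⟩ h
      have h0 : hm.elt k ε = hm.elt k' ε' := congrArg Subtype.val h
      have h1 : (hm.elt k ε : SL(2, ℝ)) 0 0 = (hm.elt k' ε' : SL(2, ℝ)) 0 0 := by rw [h0]
      have hk : (0 : ℝ) < m ^ k := zpow_pos hm.pos k
      have hk' : (0 : ℝ) < m ^ k' := zpow_pos hm.pos k'
      cases ε <;> cases ε' <;> simp [DiagonalGenerator.elt, diagonalMatrix] at h1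
      · rw [hm.zpow_injective h1]
      · linarith
      · linarith
      · rw [hm.zpow_injective h1]
    · rintro ⟨g, h01, h10⟩
      obtain ⟨k, hk⟩ := (hm.mem_iff g h01 h10).mp g.2
      have hdet := SL_det_eq (g : SL(2, ℝ))
      rw [h01, zero_mul, sub_zero] at hdet
      have hmk : (0 : ℝ) < m ^ k := zpow_pos hm.pos k
      rcases abs_choice ((g : SL(2, ℝ)) 0 0) with h | h
      · rw [hk] at h
        refine ⟨(k, false), Subtype.ext (Subtype.ext ?_)⟩
        have h11 : (g : SL(2, ℝ)) 1 1 = (m ^ k)⁻¹ := by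
          rw [← h] at hdet
          exact eq_inv_of_mul_eq_one_right hdet
        ext i j
        fin_cases i <;> fin_cases j <;>
          simp [DiagonalGenerator.elt, diagonalMatrix, h01, h10, ← h, h11]
      · rw [hk] at h
        refine ⟨(k, true), Subtype.ext (Subtype.ext ?_)⟩
        have h00 : (g : SL(2, ℝ)) 0 0 = -m ^ k := by linarith
        have h11 : (g : SL(2, ℝ)) 1 1 = -(m ^ k)⁻¹ := by
          rw [h00] at hdet
          have : -(g : SL(2, ℝ)) 1 1 = (m ^ k)⁻¹ := eq_inv_of_mul_eq_one_right (by linarith)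
          linarith
        ext i j
        fin_cases i <;> fin_cases j <;>
          simp [DiagonalGenerator.elt, diagonalMatrix, h01, h10, h00, h11])

theorem DiagonalGenerator.elt_mul_mul_elt_apply (hm : DiagonalGenerator Γ m) (j k : ℤ) (ε : Bool)
    (g : Γ) : ((hm.elt j ε * g * hm.elt k false : Γ) : SL(2, ℝ)) 0 0 =
        cond ε (-1) 1 * m ^ (j + k) * (g : SL(2, ℝ)) 0 0 ∧
      ((hm.elt j ε * g * hm.elt k false : Γ) : SL(2, ℝ)) 0 1 =
        cond ε (-1) 1 * m ^ (j - k) * (g : SL(2, ℝ)) 0 1 ∧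
      ((hm.elt j ε * g * hm.elt k false : Γ) : SL(2, ℝ)) 1 0 =
        cond ε (-1) 1 * m ^ (k - j) * (g : SL(2, ℝ)) 1 0 ∧
      ((hm.elt j ε * g * hm.elt k false : Γ) : SL(2, ℝ)) 1 1 =
        cond ε (-1) 1 * m ^ (-(j + k)) * (g : SL(2, ℝ)) 1 1 := by
  have hm0 := hm.pos.ne'
  obtain ⟨a1, a2, a3, a4⟩ := hm.elt_apply j ε
  obtain ⟨b1, b2, b3, b4⟩ := hm.elt_apply k false
  simp only [Subgroup.coe_mul, SL_mul_apply, a1, a2, a3, a4, b1, b2, b3, b4, cond_false,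
    zpow_add₀ hm0, zpow_sub₀ hm0, zpow_neg, mul_inv]
  refine ⟨?_, ?_, ?_, ?_⟩ <;> ring

/-! ### Matrices off the diagonal subgroup have no zero entries -/

/-- A triangular element that is not diagonal has pairwise distinct conjugates by powers of the
generator, whose one off-diagonal entry shrinks. Infinitely many elements of `Γ` would then move `i`
by a bounded distance, against discreteness. -/
theorem IsSurfaceGroup.mem_diagonalSubgroup_of_mul_eq_zero (hΓ : IsSurfaceGroup Γ)
    (hF : IsFundamentalSet Γ F) (hm : DiagonalGenerator Γ m) {g : Γ}
    (h : (g : SL(2, ℝ)) 0 1 * (g : SL(2, ℝ)) 1 0 = 0) : g ∈ diagonalSubgroup Γ := by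
  by_contra hg
  -- conjugate by powers of the generator in the contracting direction
  obtain ⟨σ, hσ⟩ : ∃ σ : ℤ, (σ = 1 ∨ σ = -1) ∧ ∀ n : ℕ,
      (m ^ (-(2 * σ * n)) * (g : SL(2, ℝ)) 0 1) ^ 2 + (m ^ (2 * σ * n) * (g : SL(2, ℝ)) 1 0) ^ 2 ≤
        (g : SL(2, ℝ)) 0 1 ^ 2 + (g : SL(2, ℝ)) 1 0 ^ 2 := by
    have hle : ∀ n : ℕ, m ^ (-(2 * (n : ℤ))) ≤ 1 := fun n =>
      zpow_le_one_of_nonpos₀ hm.one_lt.le (by omega)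
    have hpos : ∀ n : ℕ, 0 < m ^ (-(2 * (n : ℤ))) := fun n => zpow_pos hm.pos _
    rcases mul_eq_zero.mp h with h | h
    · refine ⟨-1, Or.inr rfl, fun n => ?_⟩
      rw [h, show 2 * (-1 : ℤ) * n = -(2 * n) by ring]
      have := mul_le_mul_of_nonneg_right (pow_le_one₀ (n := 2) (hpos n).le (hle n))
        (sq_nonneg ((g : SL(2, ℝ)) 1 0))
      rw [mul_pow, mul_pow]
      linarith
    · refine ⟨1, Or.inl rfl, fun n => ?_⟩
      rw [h, show 2 * (1 : ℤ) * n = (2 * n) by ring]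
      have := mul_le_mul_of_nonneg_right (pow_le_one₀ (n := 2) (hpos n).le (hle n))
        (sq_nonneg ((g : SL(2, ℝ)) 0 1))
      rw [mul_pow, mul_pow]
      linarith
  set x : ℕ → Γ := fun n => hm.elt (-(σ * n)) false * g * hm.elt (σ * n) false with hx
  have hent := fun n : ℕ => hm.elt_mul_mul_elt_apply (-(σ * n)) (σ * n) false g
  have hinj : Function.Injective x := by
    intro n n' hnn
    have h1 := (hent n).2.1
    have h2 := (hent n).2.2.1
    have h1' := (hent n').2.1
    have h2' := (hent n').2.2.1
    have hnn' : hm.elt (-(σ * n)) false * g * hm.elt (σ * n) false =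
      hm.elt (-(σ * n')) false * g * hm.elt (σ * n') false := hnn
    rw [hnn'] at h1 h2
    rw [h1] at h1'
    rw [h2] at h2'
    simp only [cond_false, one_mul] at h1' h2'
    have : m ^ (-(σ * n) - σ * (n : ℤ)) = m ^ (-(σ * n') - σ * (n' : ℤ)) ∨
        m ^ (σ * n - -(σ * (n : ℤ))) = m ^ (σ * n' - -(σ * (n' : ℤ))) := by
      by_cases h01 : (g : SL(2, ℝ)) 0 1 = 0
      · right
        exact mul_right_cancel₀ (fun h10 => hg ⟨h01, h10⟩) h2'
      · left
        exact mul_right_cancel₀ h01 h1'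
    have h3 : σ * n = σ * n' := by
      rcases this with h | h <;> have := hm.zpow_injective h <;> linarith
    rcases hσ.1 with rfl | rfl <;> omega
  -- Discreteness enters through summability of the kernel: its terms tend to `0` along the
  -- infinitely many conjugates, yet all are at least `exp (- S / 2)`.
  have hsum := (hΓ.summable_exp_neg_mul_coshDist hF one_pos (axisPoint 0) (axisPoint 0))
  have htend := (hsum.tendsto_cofinite_zero.comp hinj.tendsto_cofinite)
  set S := (g : SL(2, ℝ)) 0 0 ^ 2 + (g : SL(2, ℝ)) 1 1 ^ 2 + ((g : SL(2, ℝ)) 0 1 ^ 2 +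
    (g : SL(2, ℝ)) 1 0 ^ 2) with hS
  have hev := htend.eventually (gt_mem_nhds (Real.exp_pos (-(1 * (1 / 2 * S)))))
  obtain ⟨n, hn⟩ := hev.exists
  refine absurd hn (not_lt.mpr ?_)
  rw [Function.comp_apply]
  gcongr
  have := cosh_dist_axisPoint_smul (x n : SL(2, ℝ)) 0 0
  change Real.cosh (dist (axisPoint 0) ((x n : SL(2, ℝ)) • axisPoint 0)) ≤ _
  obtain ⟨e1, e2, e3, e4⟩ := hent n
  rw [this, hx]
  simp only [sub_zero, add_zero, neg_zero, Real.exp_zero, mul_one]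
  rw [e1, e2, e3, e4]
  have := hσ.2 n
  simp only [cond_false, one_mul, neg_add_cancel, neg_zero, zpow_zero]
  rw [show -(σ * (n : ℤ)) - σ * n = -(2 * σ * n) by ring,
    show σ * (n : ℤ) - -(σ * n) = 2 * σ * n by ring]
  linarith

/-- Off-diagonal zeros are excluded by the triangular case. One zero on the diagonal yields a
triangular conjugate of the generator, and two yield an elliptic element of order two in `PSL(2,
ℝ)`, against freeness. -/
theorem IsSurfaceGroup.apply_ne_zero (hΓ : IsSurfaceGroup Γ) (hF : IsFundamentalSet Γ F)
    (hm : DiagonalGenerator Γ m) {g : Γ} (hg : g ∉ diagonalSubgroup Γ) :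
    (g : SL(2, ℝ)) 0 0 ≠ 0 ∧ (g : SL(2, ℝ)) 0 1 ≠ 0 ∧ (g : SL(2, ℝ)) 1 0 ≠ 0 ∧
      (g : SL(2, ℝ)) 1 1 ≠ 0 := by
  have hbc : ∀ {g : Γ}, g ∉ diagonalSubgroup Γ → (g : SL(2, ℝ)) 0 1 ≠ 0 ∧ (g : SL(2, ℝ)) 1 0 ≠ 0 :=
    fun {g} hg => mul_ne_zero_iff.mp fun h => hg (hΓ.mem_diagonalSubgroup_of_mul_eq_zero hF hm h)
  -- a matrix with exactly one zero entry on the diagonal conjugates the generator to a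
  -- triangular matrix
  have key : ∀ {g : Γ}, g ∉ diagonalSubgroup Γ → (g : SL(2, ℝ)) 0 0 = 0 →
      (g : SL(2, ℝ)) 1 1 = 0 := by
    intro g hg h00
    by_contra h11
    obtain ⟨h01, h10⟩ := hbc hg
    have hm1 := hm.one_lt
    obtain ⟨a1, a2, a3, a4⟩ := hm.elt_apply 1 false
    obtain ⟨i1, i2, i3, i4⟩ := SL_inv_apply (g : SL(2, ℝ))
    have hx01 : ((g * hm.elt 1 false * g⁻¹ : Γ) : SL(2, ℝ)) 0 1 = 0 := by
      simp only [Subgroup.coe_mul, Subgroup.coe_inv, SL_mul_apply, a1, a2, a3, a4, i2, i4, h00]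
      ring
    have hx10 : ((g * hm.elt 1 false * g⁻¹ : Γ) : SL(2, ℝ)) 1 0 =
        (g : SL(2, ℝ)) 1 0 * (g : SL(2, ℝ)) 1 1 * (m - m⁻¹) := by
      simp only [Subgroup.coe_mul, Subgroup.coe_inv, SL_mul_apply, a1, a2, a3, a4, i1, i3,
        cond_false, zpow_neg, zpow_one]
      ring
    have hmem := hΓ.mem_diagonalSubgroup_of_mul_eq_zero hF hm (g := g * hm.elt 1 false * g⁻¹)
      (by rw [hx01, zero_mul])
    have h0 := hmem.2
    rw [hx10] at h0
    have : m - m⁻¹ ≠ 0 := by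
      have := inv_lt_one_of_one_lt₀ hm1
      exact ne_of_gt (by linarith)
    exact mul_ne_zero (mul_ne_zero h10 h11) this h0
  have hnot : ¬((g : SL(2, ℝ)) 0 0 = 0 ∧ (g : SL(2, ℝ)) 1 1 = 0) := by
    rintro ⟨h00, h11⟩
    obtain ⟨h01, h10⟩ := hbc hg
    have hdet := SL_det_eq (g : SL(2, ℝ))
    rw [h00, h11] at hdet
    set β := (g : SL(2, ℝ)) 0 1
    set γ := (g : SL(2, ℝ)) 1 0
    have hβ : 0 < |β| := abs_pos.mpr h01
    obtain ⟨hre, him⟩ := smul_axisPoint_re_im (g : SL(2, ℝ)) (Real.log |β|)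
    rw [h00, h11] at hre
    rw [h11] at him
    -- With zero diagonal and `bc = -1`, the matrix acts by `z ↦ - b² / z` and fixes `i |b|`.
    have hfix : (g : SL(2, ℝ)) • axisPoint (Real.log |β|) = axisPoint (Real.log |β|) := by
      refine UpperHalfPlane.ext (Complex.ext ?_ ?_)
      · rw [UpperHalfPlane.coe_re, UpperHalfPlane.coe_re, hre, axisPoint_re]
        simp
      · rw [UpperHalfPlane.coe_im, UpperHalfPlane.coe_im, him, axisPoint_im, Real.exp_log hβ]
        have : γ ^ 2 * |β| ^ 2 = 1 := by
          rw [sq_abs]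
          nlinarith
        change |β| / (γ ^ 2 * |β| ^ 2 + 0 ^ 2) = |β|
        rw [this]
        norm_num
    rcases hΓ.free g g.2 _ hfix with h | h
    · rw [h] at h00
      simp at h00
    · rw [h] at h00
      simp at h00
  obtain ⟨h01, h10⟩ := hbc hg
  refine ⟨fun h => hnot ⟨h, key hg h⟩, h01, h10, fun h => hnot ⟨?_, h⟩⟩
  -- Inversion exchanges the two diagonal entries and reduces `d = 0` to `a = 0`.
  have hg' : g⁻¹ ∉ diagonalSubgroup Γ := fun h => hg (inv_mem_iff.mp h)
  have := key hg' (by simp [Matrix.SpecialLinearGroup.coe_inv, Matrix.adjugate_fin_two, h])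
  simpa [Matrix.SpecialLinearGroup.coe_inv, Matrix.adjugate_fin_two] using this

end
section

variable {Γ : Subgroup SL(2, ℝ)} {F : Set ℍ} {m : ℝ}

/-! ### Parametrization of the double cosets -/

/-- The double coset of an element. -/
abbrev doubleCosetMk (Γ : Subgroup SL(2, ℝ)) (g : Γ) : DoubleCosets Γ :=
  DoubleCoset.mk (diagonalSubgroup Γ) (diagonalSubgroup Γ) g

theorem doubleCosetMk_out (q : DoubleCosets Γ) : doubleCosetMk Γ q.out = q :=
  DoubleCoset.out_eq' _ _ q

theorem doubleCosetMk_eq_one_iff (g : Γ) :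
    doubleCosetMk Γ g = doubleCosetMk Γ 1 ↔ g ∈ diagonalSubgroup Γ := by
  rw [eq_comm, DoubleCoset.eq]
  constructor
  · rintro ⟨h, hh, k, hk, rfl⟩
    rw [mul_one]
    exact mul_mem hh hk
  · intro h
    exact ⟨g, h, 1, one_mem _, by simp⟩

theorem out_notMem_diagonalSubgroup {q : DoubleCosets Γ} (hq : q ≠ doubleCosetMk Γ 1) :
    q.out ∉ diagonalSubgroup Γ := fun h =>
  hq (by rw [← doubleCosetMk_out q]; exact (doubleCosetMk_eq_one_iff _).mpr h)

theorem DiagonalGenerator.elt_mul_mul_elt_true (hm : DiagonalGenerator Γ m) (j k : ℤ) (ε : Bool)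
    (g : Γ) : hm.elt j ε * g * hm.elt k true = hm.elt j (!ε) * g * hm.elt k false := by
  obtain ⟨a1, a2, a3, a4⟩ := hm.elt_apply j ε
  obtain ⟨a1', a2', a3', a4'⟩ := hm.elt_apply j (!ε)
  obtain ⟨b1, b2, b3, b4⟩ := hm.elt_apply k true
  obtain ⟨b1', b2', b3', b4'⟩ := hm.elt_apply k false
  refine Subtype.ext ?_
  ext i i'
  simp only [Subgroup.coe_mul, SL_mul_apply]
  fin_cases i <;> fin_cases i' <;>
    simp only [Fin.zero_eta, Fin.mk_one, a1, a2, a3, a4, b1, b2, b3, b4, a1', a2', a3', a4', b1', b2',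
      b3', b4'] <;>
    cases ε <;> simp

/-- The parametrization of a double coset which is not the trivial one. -/
def IsSurfaceGroup.fiberEquiv (hΓ : IsSurfaceGroup Γ) (hF : IsFundamentalSet Γ F)
    (hm : DiagonalGenerator Γ m) {q : DoubleCosets Γ} (hq : q ≠ doubleCosetMk Γ 1) :
    (ℤ × Bool) × ℤ ≃ {g : Γ // doubleCosetMk Γ g = q} :=
  Equiv.ofBijective (fun p => ⟨hm.elt p.1.1 p.1.2 * q.out * hm.elt p.2 false, by
    conv_rhs => rw [← doubleCosetMk_out q]
    rw [eq_comm, DoubleCoset.eq]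
    exact ⟨_, hm.elt_mem _ _, _, hm.elt_mem _ _, rfl⟩⟩) (by
    obtain ⟨h00, h01, h10, h11⟩ := hΓ.apply_ne_zero hF hm (out_notMem_diagonalSubgroup hq)
    constructor
    · rintro ⟨⟨j, ε⟩, k⟩ ⟨⟨j', ε'⟩, k'⟩ h
      have h0 : hm.elt j ε * q.out * hm.elt k false = hm.elt j' ε' * q.out * hm.elt k' false :=
        congrArg Subtype.val h
      obtain ⟨e1, e2, -, -⟩ := hm.elt_mul_mul_elt_apply j k ε q.out
      obtain ⟨f1, f2, -, -⟩ := hm.elt_mul_mul_elt_apply j' k' ε' q.out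
      rw [h0, f1] at e1
      rw [h0, f2] at e2
      have e1 := mul_right_cancel₀ h00 e1
      have e2 := mul_right_cancel₀ h01 e2
      have p1 : (0 : ℝ) < m ^ (j + k) := zpow_pos hm.pos _
      have p2 : (0 : ℝ) < m ^ (j' + k') := zpow_pos hm.pos _
      have hε : ε = ε' := by
        cases ε <;> cases ε' <;> simp at e1 ⊢ <;> linarith
      subst hε
      have hc : (cond ε (-1) 1 : ℝ) ≠ 0 := by cases ε <;> simp
      have i1 := hm.zpow_injective (mul_left_cancel₀ hc e1)
      have i2 := hm.zpow_injective (mul_left_cancel₀ hc e2)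
      -- The entries `a` and `b` are nonzero, so they determine the sign and the exponents `j + k`
      -- and `j - k`.
      have hj : j = j' := by omega
      have hk : k = k' := by omega
      rw [hj, hk]
    · rintro ⟨x, hx⟩
      rw [← doubleCosetMk_out q, eq_comm, DoubleCoset.eq] at hx
      obtain ⟨h, hh, k, hk, rfl⟩ := hx
      obtain ⟨⟨j, ε⟩, hj⟩ := hm.equiv.surjective ⟨h, hh⟩
      obtain ⟨⟨k', ε'⟩, hk'⟩ := hm.equiv.surjective ⟨k, hk⟩
      have hj : hm.elt j ε = h := congrArg Subtype.val hj
      have hk' : hm.elt k' ε' = k := congrArg Subtype.val hk'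
      subst hj hk'
      cases ε'
      · exact ⟨((j, ε), k'), rfl⟩
      -- The sign of the right factor is moved to the left factor, so only one sign is counted.
      · exact ⟨((j, !ε), k'), Subtype.ext (hm.elt_mul_mul_elt_true j k' ε q.out).symm⟩)

/-! ### The geometric side -/

/-- The contribution of the element `g` to the geometric side, before the factor `1 / 2`. -/
def geodesicPairing (m s : ℝ) (g : Γ) : ENNReal :=
  ∫⁻ v in Ioc 0 (geodesicLength m), ∫⁻ u in Ioc 0 (geodesicLength m),
    ENNReal.ofReal (Real.exp (-(s * Real.cosh (dist (axisPoint u) (g • axisPoint v)))))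

theorem continuous_exp_coshDist (s : ℝ) (g : Γ) : Continuous fun p : ℝ × ℝ =>
    Real.exp (-(s * Real.cosh (dist (axisPoint p.1) (g • axisPoint p.2)))) := by
  have h1 : Continuous fun p : ℝ × ℝ => g • axisPoint p.2 := by
    have : Continuous fun z : ℍ => (g : SL(2, ℝ)) • z := continuous_const_smul _
    exact this.comp (continuous_axisPoint.comp continuous_snd)
  have h2 : Continuous fun p : ℝ × ℝ => dist (axisPoint p.1) (g • axisPoint p.2) :=
    (continuous_axisPoint.comp continuous_fst).dist h1
  exact Real.continuous_exp.comp ((continuous_const.mul (Real.continuous_cosh.comp h2)).neg)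

theorem measurable_exp_coshDist (s : ℝ) (g : Γ) : Measurable fun p : ℝ × ℝ =>
    ENNReal.ofReal (Real.exp (-(s * Real.cosh (dist (axisPoint p.1) (g • axisPoint p.2))))) :=
  ENNReal.measurable_ofReal.comp (continuous_exp_coshDist s g).measurable

/-- The factor `2` cancels the one half in `geodesicKernel`. With values in `[0, ∞]`, sums and
integrals may be exchanged freely. -/
theorem IsSurfaceGroup.ofReal_integral_geodesicKernel (hΓ : IsSurfaceGroup Γ)
    (hF : IsFundamentalSet Γ F) (hm : DiagonalGenerator Γ m) {s : ℝ} (hs : 0 < s) :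
    ENNReal.ofReal (2 * ∫ v in (0 : ℝ)..geodesicLength m, geodesicKernel Γ m s (axisPoint v)) =
      ∑' g : Γ, geodesicPairing m s g := by
  have := hΓ.countable
  have hl := hm.geodesicLength_pos
  have hcont : Continuous fun p : ℝ × ℝ => autoKernel Γ s (axisPoint p.1) (axisPoint p.2) := by
    have h0 : Continuous fun p : ℝ × ℝ => (axisPoint p.1, axisPoint p.2) :=
      (continuous_axisPoint.comp continuous_fst).prodMk (continuous_axisPoint.comp continuous_snd)
    have := (hΓ.continuous_autoKernel hF hs).comp h0
    exact this
  have e1 : ∀ v, ENNReal.ofReal (2 * geodesicKernel Γ m s (axisPoint v)) =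
      ∑' g : Γ, ∫⁻ u in Ioc 0 (geodesicLength m),
        ENNReal.ofReal (Real.exp (-(s * Real.cosh (dist (axisPoint u) (g • axisPoint v))))) := by
    intro v
    have hc : Continuous fun u : ℝ => autoKernel Γ s (axisPoint u) (axisPoint v) := by
      have h0 : Continuous fun u : ℝ => (u, v) := by fun_prop
      have := hcont.comp h0
      exact this
    rw [geodesicKernel, ← mul_assoc, show (2 : ℝ) * (1 / 2) = 1 by norm_num, one_mul,
      intervalIntegral.integral_of_le hl.le, ofReal_integral_eq_lintegral_ofReal
      ((hc.intervalIntegrable 0 (geodesicLength m)).1)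
      (Eventually.of_forall fun _ => autoKernel_nonneg _ _ _), ← lintegral_tsum]
    · refine lintegral_congr fun u => ?_
      rw [autoKernel, ENNReal.ofReal_tsum_of_nonneg (fun _ => (Real.exp_pos _).le)
        (hΓ.summable_exp_neg_mul_coshDist hF hs _ _)]
    · intro g
      exact ((measurable_exp_coshDist s g).comp (measurable_id.prodMk measurable_const)).aemeasurable
  have hgc : Continuous fun v : ℝ => 2 * geodesicKernel Γ m s (axisPoint v) :=
    continuous_const.mul ((hΓ.continuous_geodesicKernel hF m hs).comp continuous_axisPoint)
  rw [← intervalIntegral.integral_const_mul, intervalIntegral.integral_of_le hl.le,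
    ofReal_integral_eq_lintegral_ofReal ((hgc.intervalIntegrable 0 (geodesicLength m)).1)
    (Eventually.of_forall fun _ => mul_nonneg zero_le_two (geodesicKernel_nonneg hm _ _))]
  simp_rw [e1]
  rw [lintegral_tsum]
  · rfl
  · intro g
    exact (Measurable.lintegral_prod_left' (measurable_exp_coshDist s g)).aemeasurable

/-- The translates of the square of side `ℓ` tile the plane. -/
theorem tsum_tsum_setLIntegral {ℓ : ℝ} (hℓ : 0 < ℓ) {f : ℝ × ℝ → ENNReal} (hf : Measurable f) :
    ∑' (j : ℤ) (k : ℤ), ∫⁻ v in Ioc 0 ℓ, ∫⁻ u in Ioc 0 ℓ, f (u + j * ℓ, v + k * ℓ) =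
      ∫⁻ u, ∫⁻ v, f (u, v) := by
  have e1 : ∀ j : ℤ, ∑' k : ℤ, ∫⁻ v in Ioc 0 ℓ, ∫⁻ u in Ioc 0 ℓ, f (u + j * ℓ, v + k * ℓ) =
      ∫⁻ v, ∫⁻ u in Ioc 0 ℓ, f (u + j * ℓ, v) := fun j =>
    tsum_setLIntegral_add_zsmul hℓ fun v => ∫⁻ u in Ioc 0 ℓ, f (u + j * ℓ, v)
  simp_rw [e1]
  rw [← lintegral_tsum, lintegral_lintegral_swap (f := fun u v => f (u, v)) hf.aemeasurable]
  · refine lintegral_congr fun v => ?_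
    exact tsum_setLIntegral_add_zsmul hℓ fun u => f (u, v)
  · intro j
    have : Measurable fun p : ℝ × ℝ => f (p.1 + j * ℓ, p.2) := by fun_prop
    exact (Measurable.lintegral_prod_left' this).aemeasurable

theorem DiagonalGenerator.geodesicPairing_mul_mul (hm : DiagonalGenerator Γ m) (s : ℝ) (j k : ℤ)
    (ε : Bool) (g : Γ) : geodesicPairing m s (hm.elt j ε * g * hm.elt k false) =
      ∫⁻ v in Ioc 0 (geodesicLength m), ∫⁻ u in Ioc 0 (geodesicLength m),
        ENNReal.ofReal (Real.exp (-(s * Real.cosh (dist (axisPoint (u + (-j : ℤ) * geodesicLength m))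
          (g • axisPoint (v + k * geodesicLength m)))))) := by
  refine lintegral_congr fun v => lintegral_congr fun u => ?_
  have hu : axisPoint u = hm.elt j ε • axisPoint (u + (-j : ℤ) * geodesicLength m) := by
    rw [hm.elt_smul_axisPoint]
    congr 1
    push_cast
    ring
  rw [mul_smul, mul_smul, hm.elt_smul_axisPoint]
  conv_lhs => rw [hu]
  rw [dist_smul_smul_subgroup]

/-- The contribution of a double coset to the geometric side. -/
def doubleCosetTerm (Γ : Subgroup SL(2, ℝ)) (m s : ℝ) (q : DoubleCosets Γ) : ℝ :=
  open scoped Classical in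
  if q = doubleCosetMk Γ 1 then 2 * geodesicLength m * besselK₀ s
  else 2 * besselK₀ (s * |(q.out : SL(2, ℝ)) 0 0 * (q.out : SL(2, ℝ)) 1 1|) *
    besselK₀ (s * |(q.out : SL(2, ℝ)) 0 1 * (q.out : SL(2, ℝ)) 1 0|)

/-- The exponents `(j, k)` unfold the square to the plane, where the integral is a product of two
`K_0`; the sign accounts for the factor `2`. -/
theorem IsSurfaceGroup.tsum_fiber (hΓ : IsSurfaceGroup Γ)
    (hF : IsFundamentalSet Γ F) (hm : DiagonalGenerator Γ m) {s : ℝ} (hs : 0 < s)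
    {q : DoubleCosets Γ} (hq : q ≠ doubleCosetMk Γ 1) :
    ∑' g : {g : Γ // doubleCosetMk Γ g = q}, geodesicPairing m s (g : Γ) =
      ENNReal.ofReal (2 * doubleCosetTerm Γ m s q) := by
  obtain ⟨h00, h01, h10, h11⟩ := hΓ.apply_ne_zero hF hm (out_notMem_diagonalSubgroup hq)
  rw [doubleCosetTerm, if_neg hq, ENNReal.ofReal_mul zero_le_two,
    ← lintegral_exp_coshDist_axisPoint hs h00 h01 h10 h11,
    ← (hΓ.fiberEquiv hF hm hq).tsum_eq, ENNReal.tsum_prod', ENNReal.tsum_prod']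
  have e1 : ∀ (j k : ℤ) (ε : Bool), geodesicPairing m s
      ((hΓ.fiberEquiv hF hm hq ((j, ε), k) : {g : Γ // doubleCosetMk Γ g = q}) : Γ) =
      ∫⁻ v in Ioc 0 (geodesicLength m), ∫⁻ u in Ioc 0 (geodesicLength m),
        ENNReal.ofReal (Real.exp (-(s * Real.cosh (dist (axisPoint (u + (-j : ℤ) * geodesicLength m))
          (q.out • axisPoint (v + k * geodesicLength m)))))) :=
    fun j k ε => hm.geodesicPairing_mul_mul s j k ε q.out
  simp_rw [e1, tsum_bool, ← two_mul]
  rw [ENNReal.tsum_mul_left]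
  have h2 := tsum_tsum_setLIntegral hm.geodesicLength_pos (measurable_exp_coshDist s q.out)
  -- The left factor was moved across the distance by an isometry, so its exponent appears as `- j`.
  rw [← (Equiv.neg ℤ).tsum_eq] at h2
  simp only [Equiv.neg_apply] at h2
  rw [h2]
  norm_num
  rfl

/-- Here left and right multiplication coincide, so there is only one sum over `ℤ`: it unfolds one
of the two integrals, and the other, over a period, produces the length. -/
theorem IsSurfaceGroup.tsum_fiber_one (hm : DiagonalGenerator Γ m) {s : ℝ} (hs : 0 < s) :
    ∑' g : {g : Γ // doubleCosetMk Γ g = doubleCosetMk Γ 1}, geodesicPairing m s (g : Γ) =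
      ENNReal.ofReal (2 * doubleCosetTerm Γ m s (doubleCosetMk Γ 1)) := by
  have hl := hm.geodesicLength_pos
  have hk := besselK₀_pos hs
  rw [doubleCosetTerm, if_pos rfl]
  let e : ℤ × Bool ≃ {g : Γ // doubleCosetMk Γ g = doubleCosetMk Γ 1} :=
    hm.equiv.trans (Equiv.subtypeEquivRight fun g => (doubleCosetMk_eq_one_iff g).symm)
  have he : ∀ j ε, ((e (j, ε) : {g : Γ // doubleCosetMk Γ g = doubleCosetMk Γ 1}) : Γ) =
    hm.elt j ε := fun j ε => rfl
  rw [← e.tsum_eq, ENNReal.tsum_prod']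
  have e1 : ∀ (j : ℤ) (ε : Bool), geodesicPairing m s (hm.elt j ε) =
      ∫⁻ v in Ioc 0 (geodesicLength m), ∫⁻ u in Ioc 0 (geodesicLength m),
        ENNReal.ofReal (Real.exp (-(s * Real.cosh (dist (axisPoint u)
          (axisPoint (v + j * geodesicLength m)))))) := by
    intro j ε
    refine lintegral_congr fun v => lintegral_congr fun u => ?_
    rw [hm.elt_smul_axisPoint]
  simp_rw [he, e1, tsum_bool, ← two_mul]
  rw [ENNReal.tsum_mul_left, tsum_setLIntegral_add_zsmul hl fun v =>
    ∫⁻ u in Ioc 0 (geodesicLength m), ENNReal.ofReal (Real.exp (-(s * Real.cosh (dist (axisPoint u)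
          (axisPoint v)))))]
  have hmeas : Measurable fun p : ℝ × ℝ => ENNReal.ofReal (Real.exp (-(s * Real.cosh (dist
      (axisPoint p.1) (axisPoint p.2))))) := by
    simpa using measurable_exp_coshDist s (1 : Γ)
  rw [← lintegral_lintegral_swap (f := fun u v => ENNReal.ofReal (Real.exp (-(s * Real.cosh (dist
      (axisPoint u) (axisPoint v)))))) hmeas.aemeasurable]
  simp_rw [lintegral_exp_coshDist_axisPoint_same hs]
  rw [lintegral_const, Measure.restrict_apply_univ, Real.volume_Ioc, sub_zero,
    ← ENNReal.ofReal_mul (by positivity), ENNReal.ofReal_mul zero_le_two]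
  norm_num
  congr 2
  ring

theorem DiagonalGenerator.doubleCosetTerm_nonneg (hΓ : IsSurfaceGroup Γ)
    (hF : IsFundamentalSet Γ F) (hm : DiagonalGenerator Γ m) {s : ℝ} (hs : 0 < s)
    (q : DoubleCosets Γ) : 0 ≤ doubleCosetTerm Γ m s q := by
  have hl := hm.geodesicLength_pos
  have hk := besselK₀_pos hs
  unfold doubleCosetTerm
  split_ifs with hq
  · positivity
  · obtain ⟨h00, h01, h10, h11⟩ := hΓ.apply_ne_zero hF hm (out_notMem_diagonalSubgroup hq)
    have h1 := besselK₀_pos (mul_pos hs (abs_pos.mpr (mul_ne_zero h00 h11)))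
    have h2 := besselK₀_pos (mul_pos hs (abs_pos.mpr (mul_ne_zero h01 h10)))
    positivity

/-- The geometric side of the trace formula along the geodesic. -/
theorem IsSurfaceGroup.hasSum_doubleCosetTerm (hΓ : IsSurfaceGroup Γ)
    (hF : IsFundamentalSet Γ F) (hm : DiagonalGenerator Γ m) {s : ℝ} (hs : 0 < s) :
    HasSum (doubleCosetTerm Γ m s)
      (∫ v in (0 : ℝ)..geodesicLength m, geodesicKernel Γ m s (axisPoint v)) := by
  have hnn := hm.doubleCosetTerm_nonneg hΓ hF hs
  have h1 := hΓ.ofReal_integral_geodesicKernel hF hm hs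
  rw [← (Equiv.sigmaFiberEquiv (doubleCosetMk Γ)).tsum_eq, ENNReal.tsum_sigma'] at h1
  have h2 : ∀ q : DoubleCosets Γ, ∑' g : {g : Γ // doubleCosetMk Γ g = q},
      geodesicPairing m s (g : Γ) = ENNReal.ofReal (2 * doubleCosetTerm Γ m s q) := by
    intro q
    by_cases hq : q = doubleCosetMk Γ 1
    · subst hq
      exact tsum_fiber_one hm hs
    · exact hΓ.tsum_fiber hF hm hs hq
  simp only [Equiv.sigmaFiberEquiv_apply] at h1
  simp_rw [h2] at h1
  have hsum : Summable fun q => 2 * doubleCosetTerm Γ m s q := by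
    have := ENNReal.summable_toReal (h1 ▸ ENNReal.ofReal_ne_top)
    refine this.congr fun q => ?_
    rw [ENNReal.toReal_ofReal (by have := hnn q; positivity)]
  rw [← ENNReal.ofReal_tsum_of_nonneg (fun q => by have := hnn q; positivity) hsum,
    ENNReal.ofReal_eq_ofReal_iff (mul_nonneg zero_le_two
      (intervalIntegral.integral_nonneg hm.geodesicLength_pos.le
        fun v _ => geodesicKernel_nonneg hm _ _))
    (tsum_nonneg fun q => by have := hnn q; positivity)] at h1
  have h3 := hsum.hasSum
  rw [← h1] at h3
  have := h3.mul_left (1 / 2)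
  simpa using this

end
section

variable {Γ : Subgroup SL(2, ℝ)} {F : Set ℍ} {m : ℝ}

/-! ### The invariants of a double coset -/

/-- The number `|a d|` for a representative of the double coset. -/
def absDiag (q : DoubleCosets Γ) : ℝ := |(q.out : SL(2, ℝ)) 0 0 * (q.out : SL(2, ℝ)) 1 1|

/-- The number `|b c|` for a representative of the double coset. -/
def absOffDiag (q : DoubleCosets Γ) : ℝ := |(q.out : SL(2, ℝ)) 0 1 * (q.out : SL(2, ℝ)) 1 0|

theorem doubleCosetTerm_of_ne {q : DoubleCosets Γ} (hq : q ≠ doubleCosetMk Γ 1) (m s : ℝ) :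
    doubleCosetTerm Γ m s q = 2 * besselK₀ (s * absDiag q) * besselK₀ (s * absOffDiag q) :=
  if_neg hq

theorem doubleCosetTerm_one (m s : ℝ) :
    doubleCosetTerm Γ m s (doubleCosetMk Γ 1) = 2 * geodesicLength m * besselK₀ s :=
  if_pos rfl

theorem delta_eq (q : DoubleCosets Γ) : delta Γ q = matrixDelta (q.out : SL(2, ℝ)) := by
  conv_lhs => rw [← doubleCosetMk_out q]
  rfl

theorem delta_one : delta Γ (doubleCosetMk Γ 1) = 2 := by
  change matrixDelta ((1 : Γ) : SL(2, ℝ)) = 2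
  simp [matrixDelta]

theorem delta_nonneg (q : DoubleCosets Γ) : 0 ≤ delta Γ q := by
  rw [delta_eq, matrixDelta]
  positivity

theorem IsSurfaceGroup.absDiag_pos (hΓ : IsSurfaceGroup Γ) (hF : IsFundamentalSet Γ F)
    (hm : DiagonalGenerator Γ m) {q : DoubleCosets Γ} (hq : q ≠ doubleCosetMk Γ 1) :
    0 < absDiag q ∧ 0 < absOffDiag q := by
  obtain ⟨h00, h01, h10, h11⟩ := hΓ.apply_ne_zero hF hm (out_notMem_diagonalSubgroup hq)
  exact ⟨abs_pos.mpr (mul_ne_zero h00 h11), abs_pos.mpr (mul_ne_zero h01 h10)⟩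

/-- Take `σ = ad + bc`; then `ad - bc = 1` gives `ad = (1 + σ) / 2` and `bc = (σ - 1) / 2`. -/
theorem exists_delta_eq (q : DoubleCosets Γ) : ∃ σ : ℝ, delta Γ q = 2 * |σ| ∧
    absDiag q = |1 + σ| / 2 ∧ absOffDiag q = |σ - 1| / 2 := by
  have hdet := SL_det_eq (q.out : SL(2, ℝ))
  refine ⟨(q.out : SL(2, ℝ)) 0 0 * (q.out : SL(2, ℝ)) 1 1 +
    (q.out : SL(2, ℝ)) 0 1 * (q.out : SL(2, ℝ)) 1 0, ?_, ?_, ?_⟩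
  · rw [delta_eq, matrixDelta]
  · rw [absDiag, eq_div_iff two_ne_zero, ← abs_two, ← abs_mul]
    congr 1
    linarith
  · rw [absOffDiag, eq_div_iff two_ne_zero, ← abs_two, ← abs_mul]
    congr 1
    linarith

theorem half_delta_le (q : DoubleCosets Γ) : delta Γ q / 2 ≤ absDiag q + absOffDiag q := by
  obtain ⟨σ, h1, h2, h3⟩ := exists_delta_eq q
  rw [h1, h2, h3]
  have := abs_add_le (1 + σ) (σ - 1)
  rw [show 1 + σ + (σ - 1) = 2 * σ by ring, abs_mul, abs_two] at this
  linarith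

theorem absDiag_le (q : DoubleCosets Γ) :
    absDiag q ≤ 1 / 2 + delta Γ q / 4 ∧ absOffDiag q ≤ 1 / 2 + delta Γ q / 4 := by
  obtain ⟨σ, h1, h2, h3⟩ := exists_delta_eq q
  rw [h1, h2, h3]
  have e1 := abs_add_le 1 σ
  have e2 := abs_sub σ 1
  rw [abs_one] at e1 e2
  constructor <;> linarith

/-- If `|σ| < 1` then `ad > 0 > bc`, so `|ad| + |bc| = ad - bc = 1`: these cosets decay at the same
exponential rate as the trivial one. -/
theorem absDiag_of_delta_lt {q : DoubleCosets Γ} (hq : delta Γ q < 2) :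
    absDiag q + absOffDiag q = 1 ∧ √(absDiag q * absOffDiag q) = √(4 - delta Γ q ^ 2) / 4 := by
  obtain ⟨σ, h1, h2, h3⟩ := exists_delta_eq q
  have hσ : |σ| < 1 := by linarith
  obtain ⟨ha, hb⟩ := abs_lt.mp hσ
  rw [h1, h2, h3, abs_of_pos (by linarith : 0 < 1 + σ), abs_of_neg (by linarith : σ - 1 < 0)]
  refine ⟨by ring, ?_⟩
  rw [mul_pow, sq_abs, show (1 + σ) / 2 * (-(σ - 1) / 2) = (4 - 2 ^ 2 * σ ^ 2) / 4 ^ 2 by ring,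
    Real.sqrt_div' _ (by norm_num), Real.sqrt_sq (by norm_num)]

/-- `σ = ± 1` would force `bc = 0` or `ad = 0`. -/
theorem IsSurfaceGroup.delta_ne_two (hΓ : IsSurfaceGroup Γ) (hF : IsFundamentalSet Γ F)
    (hm : DiagonalGenerator Γ m) {q : DoubleCosets Γ} (hq : q ≠ doubleCosetMk Γ 1) :
    delta Γ q ≠ 2 := by
  obtain ⟨σ, h1, h2, h3⟩ := exists_delta_eq q
  obtain ⟨hpos1, hpos2⟩ := hΓ.absDiag_pos hF hm hq
  rw [h1]
  intro h
  have : |σ| = 1 := by linarith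
  rcases eq_or_eq_neg_of_abs_eq this with rfl | rfl
  · rw [h3] at hpos2
    norm_num at hpos2
  · rw [h2] at hpos1
    norm_num at hpos1

/-- A bound on `δ` bounds `|ad|` and `|bc|`, hence bounds the terms of the convergent geometric
series at `s = 1` from below; only finitely many can be that large. -/
theorem IsSurfaceGroup.finite_delta_le (hΓ : IsSurfaceGroup Γ) (hF : IsFundamentalSet Γ F)
    (hm : DiagonalGenerator Γ m) (D : ℝ) : {q : DoubleCosets Γ | delta Γ q ≤ D}.Finite := by
  have hsum := (hΓ.hasSum_doubleCosetTerm hF hm one_pos).summable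
  set x := max (1 / 2 + D / 4) 1 with hx
  have hx0 : 0 < x := by positivity
  have hk := besselK₀_pos hx0
  have hev := hsum.tendsto_cofinite_zero.eventually
    (gt_mem_nhds (show 0 < 2 * besselK₀ x * besselK₀ x by positivity))
  rw [eventually_cofinite] at hev
  refine (hev.insert (doubleCosetMk Γ 1)).subset fun q hqD => ?_
  rw [mem_insert_iff, or_iff_not_imp_left]
  intro hq
  rw [mem_ofPred_eq, not_lt, doubleCosetTerm_of_ne hq, one_mul, one_mul]
  obtain ⟨hpos1, hpos2⟩ := hΓ.absDiag_pos hF hm hq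
  obtain ⟨h1, h2⟩ := absDiag_le q
  have hqD : delta Γ q ≤ D := hqD
  have e1 : besselK₀ x ≤ besselK₀ (absDiag q) :=
    besselK₀_anti hpos1 (by rw [hx]; exact le_max_of_le_left (by linarith))
  have e2 : besselK₀ x ≤ besselK₀ (absOffDiag q) :=
    besselK₀_anti hpos2 (by rw [hx]; exact le_max_of_le_left (by linarith))
  have hpos := besselK₀_pos hpos1
  gcongr

theorem IsSurfaceGroup.finite_delta_lt (hΓ : IsSurfaceGroup Γ) (hF : IsFundamentalSet Γ F)
    (hm : DiagonalGenerator Γ m) : {q : DoubleCosets Γ | delta Γ q < 2}.Finite :=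
  (hΓ.finite_delta_le hF hm 2).subset fun _ (hq : delta Γ _ < 2) => hq.le

/-- Only finitely many double cosets have `2 < δ ≤ 4`, so the values above `2` have a gap, which
makes the tail exponentially small. -/
theorem IsSurfaceGroup.exists_le_delta (hΓ : IsSurfaceGroup Γ) (hF : IsFundamentalSet Γ F)
    (hm : DiagonalGenerator Γ m) : ∃ η : ℝ, 1 < η ∧ ∀ q : DoubleCosets Γ, 2 < delta Γ q →
      η ≤ delta Γ q / 2 := by
  have hfin := (hΓ.finite_delta_le hF hm 4).subset
    (fun q (hq : 2 < delta Γ q ∧ delta Γ q ≤ 4) => hq.2)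
  rcases Set.eq_empty_or_nonempty {q : DoubleCosets Γ | 2 < delta Γ q ∧ delta Γ q ≤ 4} with he | hne
  · refine ⟨2, one_lt_two, fun q hq => ?_⟩
    by_contra! h
    have : q ∈ {q : DoubleCosets Γ | 2 < delta Γ q ∧ delta Γ q ≤ 4} := ⟨hq, by linarith⟩
    rw [he] at this
    exact this
  · obtain ⟨q₀, hq₀, hmin⟩ := Set.exists_min_image _ (delta Γ) hfin hne
    refine ⟨delta Γ q₀ / 2, by linarith [hq₀.1], fun q hq => ?_⟩
    rcases le_or_gt (delta Γ q) 4 with h | h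
    · linarith [hmin q ⟨hq, h⟩]
    · linarith [hq₀.2]

/-! ### Asymptotics -/

theorem besselK₀_mul_le {s x : ℝ} (hs : 1 ≤ s) (hx : 0 < x) :
    besselK₀ (s * x) ≤ Real.exp (-((s - 1) * x)) * besselK₀ x := by
  unfold besselK₀
  rw [mul_left_comm, ← integral_const_mul (Real.exp _)]
  gcongr ?_ * ?_
  refine integral_mono (integrable_exp_cosh (by positivity)) ((integrable_exp_cosh hx).const_mul _)
    fun u => ?_
  have h := exp_neg_mul_le_of_one_le (x := x * Real.cosh u) hs
    (le_mul_of_one_le_right hx.le (Real.one_le_cosh u))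
  simpa only [mul_assoc, one_mul] using h

theorem one_div_sq_isBigO : (fun s : ℝ => 1 / s ^ 2) =O[atTop] fun s => 1 / (s * √s) := by
  refine Asymptotics.IsBigO.of_bound 1 ?_
  filter_upwards [eventually_ge_atTop 1] with s hs
  have hs0 : 0 < s := by linarith
  have h1 : √s ≤ s := Real.sqrt_le_iff.mpr ⟨hs0.le, by nlinarith⟩
  rw [Real.norm_of_nonneg (by positivity), Real.norm_of_nonneg (by positivity), one_mul, pow_two]
  gcongr

theorem exp_mul_besselK₀_sub_isBigO : (fun s : ℝ => Real.exp s * (2 * besselK₀ s) - √(2 * Real.pi / s))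
    =O[atTop] fun s => 1 / (s * √s) := by
  refine Asymptotics.IsBigO.of_bound (√(2 * Real.pi) / 8) ?_
  filter_upwards [eventually_gt_atTop 0] with s hs
  have h1 := exp_mul_besselK₀_le hs
  have h2 := le_exp_mul_besselK₀ hs
  rw [Real.norm_of_nonneg (by positivity : 0 ≤ 1 / (s * √s)), Real.norm_eq_abs,
    abs_of_nonpos (by linarith)]
  have h3 : √(2 * Real.pi) / 8 * (1 / (s * √s)) = √(2 * Real.pi / s) * (1 / (8 * s)) := by
    rw [Real.sqrt_div (by positivity)]
    have : 0 < √s := Real.sqrt_pos.mpr hs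
    field_simp
  rw [h3]
  linarith

/-- Each factor is `√(2π / (s x)) (1 + O(1 / s))`, so the relative error of the product is `O(1 /
s)` and the absolute one `O(1 / s²)`, better than required. -/
theorem exp_mul_besselK₀_mul_sub_isBigO {x y : ℝ} (hx : 0 < x) (hy : 0 < y) :
    (fun s : ℝ => Real.exp (s * (x + y)) * (2 * besselK₀ (s * x) * besselK₀ (s * y)) -
      Real.pi / (s * √(x * y))) =O[atTop] fun s => 1 / (s * √s) := by
  have hpi := Real.pi_pos
  refine Asymptotics.IsBigO.trans (g := fun s : ℝ => 1 / s ^ 2) ?_ one_div_sq_isBigO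
  refine Asymptotics.IsBigO.of_bound (Real.pi / √(x * y) * (1 / (8 * x) + 1 / (8 * y))) ?_
  filter_upwards [eventually_ge_atTop (1 / x), eventually_ge_atTop (1 / y),
    eventually_gt_atTop 0] with s hsx hsy hs
  rw [div_le_iff₀ hx] at hsx
  rw [div_le_iff₀ hy] at hsy
  have hsx0 : 0 < s * x := by positivity
  have hsy0 : 0 < s * y := by positivity
  have u1 := exp_mul_besselK₀_le hsx0
  have u2 := exp_mul_besselK₀_le hsy0
  have l1 := le_exp_mul_besselK₀ hsx0
  have l2 := le_exp_mul_besselK₀ hsy0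
  have kx := besselK₀_pos hsx0
  have ky := besselK₀_pos hsy0
  set U := Real.exp (s * x) * (2 * besselK₀ (s * x)) with hU
  set V := Real.exp (s * y) * (2 * besselK₀ (s * y)) with hV
  set A := √(2 * Real.pi / (s * x)) with hA
  set B := √(2 * Real.pi / (s * y)) with hB
  have hU0 : 0 < U := by positivity
  have hV0 : 0 < V := by positivity
  have hA0 : 0 ≤ A := Real.sqrt_nonneg _
  have hB0 : 0 ≤ B := Real.sqrt_nonneg _
  have hAB : A * B = 2 * (Real.pi / (s * √(x * y))) := by
    rw [hA, hB, ← Real.sqrt_mul (by positivity),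
      show 2 * Real.pi / (s * x) * (2 * Real.pi / (s * y)) = (2 * Real.pi / s) ^ 2 / (x * y) by
        field_simp,
      Real.sqrt_div (by positivity), Real.sqrt_sq (by positivity)]
    have : 0 < √(x * y) := Real.sqrt_pos.mpr (by positivity)
    field_simp
  have e1 : 0 ≤ 1 - 1 / (8 * (s * x)) := by
    rw [sub_nonneg, div_le_one (by positivity)]
    linarith
  have e2 : 0 ≤ 1 - 1 / (8 * (s * y)) := by
    rw [sub_nonneg, div_le_one (by positivity)]
    linarith
  have hUV : U * V ≤ A * B := mul_le_mul u1 u2 hV0.le hA0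
  have hUV2 : A * (1 - 1 / (8 * (s * x))) * (B * (1 - 1 / (8 * (s * y)))) ≤ U * V :=
    mul_le_mul l1 l2 (by positivity) hU0.le
  have hmain : Real.exp (s * (x + y)) * (2 * besselK₀ (s * x) * besselK₀ (s * y)) = 1 / 2 * (U * V) := by
    rw [hU, hV, mul_add, Real.exp_add]
    ring
  -- The product of the two corrections exceeds `1` minus their sum by a nonnegative quantity.
  have hprod : A * (1 - 1 / (8 * (s * x))) * (B * (1 - 1 / (8 * (s * y)))) ≥
      A * B - A * B * (1 / (8 * (s * x)) + 1 / (8 * (s * y))) := by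
    have : 0 ≤ A * B * (1 / (8 * (s * x)) * (1 / (8 * (s * y)))) := by positivity
    nlinarith
  rw [hmain, Real.norm_of_nonneg (by positivity : 0 ≤ 1 / s ^ 2), Real.norm_eq_abs,
    abs_of_nonpos (by linarith)]
  have hfin : Real.pi / √(x * y) * (1 / (8 * x) + 1 / (8 * y)) * (1 / s ^ 2) =
      Real.pi / (s * √(x * y)) * (1 / (8 * (s * x)) + 1 / (8 * (s * y))) := by
    have : 0 < √(x * y) := Real.sqrt_pos.mpr (by positivity)
    field_simp
  rw [hfin]
  rw [hAB] at hprod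
  linarith

theorem exp_neg_mul_isBigO {c : ℝ} (hc : 0 < c) :
    (fun s : ℝ => Real.exp (-c * s)) =O[atTop] fun s => 1 / (s * √s) := by
  refine ((isLittleO_exp_neg_mul_rpow_atTop hc (-2)).isBigO.congr' EventuallyEq.rfl ?_).trans
    one_div_sq_isBigO
  filter_upwards [eventually_gt_atTop 0] with s hs
  rw [Real.rpow_neg hs.le, Real.rpow_two, one_div]

/-- The asymptotic expansion of the geometric side. -/
theorem IsSurfaceGroup.exp_mul_tsum_doubleCosetTerm_isBigO (hΓ : IsSurfaceGroup Γ)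
    (hF : IsFundamentalSet Γ F) (hm : DiagonalGenerator Γ m)
    (hfin : {q : DoubleCosets Γ | delta Γ q < 2}.Finite) :
    (fun s : ℝ => Real.exp s * ∑' q, doubleCosetTerm Γ m s q -
      (geodesicLength m * √(2 * Real.pi / s) +
        (∑ q ∈ hfin.toFinset, 2 / √(4 - delta Γ q ^ 2)) * (2 * Real.pi / s)))
      =O[atTop] fun s => 1 / (s * √s) := by
  classical
  obtain ⟨η, hη, hη'⟩ := hΓ.exists_le_delta hF hm
  have hone : doubleCosetMk Γ 1 ∉ hfin.toFinset := by simp [delta_one]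
  set W := insert (doubleCosetMk Γ 1) hfin.toFinset with hW
  have hA : (fun s : ℝ => geodesicLength m * (Real.exp s * (2 * besselK₀ s) - √(2 * Real.pi / s)))
      =O[atTop] fun s => 1 / (s * √s) := exp_mul_besselK₀_sub_isBigO.const_mul_left _
  have hB : (fun s : ℝ => ∑ q ∈ hfin.toFinset,
      (Real.exp (s * (absDiag q + absOffDiag q)) *
        (2 * besselK₀ (s * absDiag q) * besselK₀ (s * absOffDiag q)) -
        Real.pi / (s * √(absDiag q * absOffDiag q)))) =O[atTop] fun s => 1 / (s * √s) := by
    refine Asymptotics.IsBigO.fun_sum fun q hq => ?_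
    have hq1 : q ≠ doubleCosetMk Γ 1 := fun h => hone (h ▸ hq)
    obtain ⟨h1, h2⟩ := hΓ.absDiag_pos hF hm hq1
    exact exp_mul_besselK₀_mul_sub_isBigO h1 h2
  -- Outside `W` one has `|ad| + |bc| ≥ δ / 2 ≥ η > 1`, so a term at `s` is at most `exp (- (s - 1)
  -- η)` times the term at `1`, and the series at `1` converges.
  have hC : (fun s : ℝ => Real.exp s * ∑' q : ((W : Set (DoubleCosets Γ))ᶜ : Set (DoubleCosets Γ)),
      doubleCosetTerm Γ m s q) =O[atTop] fun s => 1 / (s * √s) := by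
    refine Asymptotics.IsBigO.trans ?_ (exp_neg_mul_isBigO (sub_pos.mpr hη))
    refine Asymptotics.IsBigO.of_bound (Real.exp η * ∑' q, doubleCosetTerm Γ m 1 q) ?_
    filter_upwards [eventually_ge_atTop 1] with s hs
    have hs0 : 0 < s := by linarith
    have hsum1 := (hΓ.hasSum_doubleCosetTerm hF hm one_pos).summable
    have hsums := (hΓ.hasSum_doubleCosetTerm hF hm hs0).summable
    have hn1 := hm.doubleCosetTerm_nonneg hΓ hF one_pos
    have hns := hm.doubleCosetTerm_nonneg hΓ hF hs0
    have htn : 0 ≤ ∑' q : ((W : Set (DoubleCosets Γ))ᶜ : Set (DoubleCosets Γ)),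
        doubleCosetTerm Γ m s q := tsum_nonneg fun q => hns q
    rw [Real.norm_of_nonneg (mul_nonneg (Real.exp_pos _).le htn),
      Real.norm_of_nonneg (Real.exp_pos _).le]
    have hle : ∑' q : ((W : Set (DoubleCosets Γ))ᶜ : Set (DoubleCosets Γ)), doubleCosetTerm Γ m s q
        ≤ Real.exp (-((s - 1) * η)) * ∑' q, doubleCosetTerm Γ m 1 q := by
      calc ∑' q : ((W : Set (DoubleCosets Γ))ᶜ : Set (DoubleCosets Γ)), doubleCosetTerm Γ m s q
          ≤ ∑' q : ((W : Set (DoubleCosets Γ))ᶜ : Set (DoubleCosets Γ)),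
            Real.exp (-((s - 1) * η)) * doubleCosetTerm Γ m 1 q := by
            refine (hsums.subtype _).tsum_le_tsum (fun q => ?_) ((hsum1.subtype _).mul_left _)
            obtain ⟨q, hq⟩ := q
            have hq' : q ∉ W := hq
            rw [hW, Finset.mem_insert, not_or, Set.Finite.mem_toFinset, mem_ofPred_eq, not_lt] at hq'
            obtain ⟨hq1, hq2⟩ := hq'
            have hgt : 2 < delta Γ q := lt_of_le_of_ne hq2 (hΓ.delta_ne_two hF hm hq1).symm
            obtain ⟨p1, p2⟩ := hΓ.absDiag_pos hF hm hq1
            have k1 := besselK₀_mul_le hs p1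
            have k2 := besselK₀_mul_le hs p2
            have b1 := besselK₀_pos p1
            have b2 := besselK₀_pos p2
            have b2' := besselK₀_pos (mul_pos hs0 p2)
            simp only
            rw [doubleCosetTerm_of_ne hq1, doubleCosetTerm_of_ne hq1, one_mul, one_mul]
            calc 2 * besselK₀ (s * absDiag q) * besselK₀ (s * absOffDiag q)
                ≤ 2 * (Real.exp (-((s - 1) * absDiag q)) * besselK₀ (absDiag q)) *
                  (Real.exp (-((s - 1) * absOffDiag q)) * besselK₀ (absOffDiag q)) := by gcongr
              _ = Real.exp (-((s - 1) * (absDiag q + absOffDiag q))) *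
                  (2 * besselK₀ (absDiag q) * besselK₀ (absOffDiag q)) := by
                  rw [mul_add, neg_add, Real.exp_add]
                  ring
              _ ≤ _ := by
                  gcongr
                  exact (hη' q hgt).trans (half_delta_le q)
        _ ≤ _ := by
            rw [tsum_mul_left]
            gcongr
            exact hsum1.tsum_subtype_le _ _ hn1
    calc _ ≤ Real.exp s * (Real.exp (-((s - 1) * η)) * ∑' q, doubleCosetTerm Γ m 1 q) := by gcongr
      _ = _ := by
        have : Real.exp s * Real.exp (-((s - 1) * η)) = Real.exp η * Real.exp (-(η - 1) * s) := by
          rw [← Real.exp_add, ← Real.exp_add]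
          congr 1
          ring
        linear_combination (∑' q, doubleCosetTerm Γ m 1 q) * this
  refine ((hA.add hB).add hC).congr' ?_ EventuallyEq.rfl
  filter_upwards [eventually_gt_atTop 0] with s hs
  have hsums := (hΓ.hasSum_doubleCosetTerm hF hm hs).summable
  rw [← hsums.sum_add_tsum_compl (s := W), hW, Finset.sum_insert hone, doubleCosetTerm_one,
    Finset.sum_sub_distrib, mul_add, mul_add, Finset.mul_sum, Finset.sum_mul]
  have s1 : ∑ q ∈ hfin.toFinset, Real.exp (s * (absDiag q + absOffDiag q)) *
        (2 * besselK₀ (s * absDiag q) * besselK₀ (s * absOffDiag q)) =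
      ∑ q ∈ hfin.toFinset, Real.exp s * doubleCosetTerm Γ m s q := by
    refine Finset.sum_congr rfl fun q hq => ?_
    have hq1 : q ≠ doubleCosetMk Γ 1 := fun h => hone (h ▸ hq)
    rw [(absDiag_of_delta_lt (hfin.mem_toFinset.mp hq)).1, mul_one,
      doubleCosetTerm_of_ne hq1]
  -- By `√(|ad| |bc|) = √(4 - δ²) / 4`, each summand is `4π / (s √(4 - δ²))`.
  have s2 : ∑ q ∈ hfin.toFinset, Real.pi / (s * √(absDiag q * absOffDiag q)) =
      ∑ q ∈ hfin.toFinset, 2 / √(4 - delta Γ q ^ 2) * (2 * Real.pi / s) := by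
    refine Finset.sum_congr rfl fun q hq => ?_
    have hlt : delta Γ q < 2 := hfin.mem_toFinset.mp hq
    have h0 := delta_nonneg q
    have hpos : 0 < √(4 - delta Γ q ^ 2) := Real.sqrt_pos.mpr (by nlinarith)
    rw [(absDiag_of_delta_lt hlt).2]
    field_simp
    norm_num
  rw [s1, s2]
  ring

end
section

variable {Γ : Subgroup SL(2, ℝ)} {F : Set ℍ} {m : ℝ} {φ : ℕ → Surface Γ → ℂ} {lam : ℕ → ℝ}
  {r : ℕ → ℂ} {b : HilbertBasis ℕ ℂ (Lp ℂ 2 (surfaceArea Γ F))}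

/-! ### Sums over the spectrum -/

/-- The sum of the squares of the periods, weighted by the `K`-Bessel function. -/
def periodSum (Γ : Subgroup SL(2, ℝ)) (m : ℝ) (φ : ℕ → Surface Γ → ℂ) (r : ℕ → ℂ) (t : ℝ) : ℝ :=
  ∑' n, (besselK (Complex.I * r n) t).re * ‖period Γ m (φ n)‖ ^ 2

theorem IsEigenbasis.besselK_mul_eq (hb : IsEigenbasis Γ F φ lam r b) {t : ℝ} (ht : 0 < t) (n : ℕ) :
    besselK (Complex.I * r n) t * ((‖period Γ m (φ n)‖ ^ 2 : ℝ) : ℂ) =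
      (((besselK (Complex.I * r n) t).re * ‖period Γ m (φ n)‖ ^ 2 : ℝ) : ℂ) := by
  rw [Complex.ofReal_mul, (besselK_real_and_le (hb.sq_eq n) ht).1]

theorem IsEigenbasis.tsum_eq_periodSum (hb : IsEigenbasis Γ F φ lam r b) {t : ℝ} (ht : 0 < t) :
    ∑' n, besselK (Complex.I * r n) t * ((‖period Γ m (φ n)‖ ^ 2 : ℝ) : ℂ) =
      (periodSum Γ m φ r t : ℂ) := by
  simp_rw [hb.besselK_mul_eq ht]
  rw [periodSum, Complex.ofReal_tsum]

/-- The trace formula along the geodesic. -/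
theorem IsEigenbasis.mul_periodSum (hb : IsEigenbasis Γ F φ lam r b) (hΓ : IsSurfaceGroup Γ)
    (hF : IsFundamentalSet Γ F) (hm : DiagonalGenerator Γ m) {t : ℝ} (ht : 0 < t) :
    2 * √(2 * Real.pi / t) * periodSum Γ m φ r t = ∑' q, doubleCosetTerm Γ m t q := by
  rw [periodSum, hb.tsum_besselK_mul hΓ hF hm ht, (hΓ.hasSum_doubleCosetTerm hF hm ht).tsum_eq]

theorem IsEigenbasis.periodSum_isBigO (hb : IsEigenbasis Γ F φ lam r b) (hΓ : IsSurfaceGroup Γ)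
    (hF : IsFundamentalSet Γ F) (hm : DiagonalGenerator Γ m)
    (hfin : {q : DoubleCosets Γ | delta Γ q < 2}.Finite) :
    (fun s : ℝ => Real.exp s * (2 * √(2 * Real.pi / s) * periodSum Γ m φ r s) -
      (geodesicLength m * √(2 * Real.pi / s) +
        (∑ q ∈ hfin.toFinset, 2 / √(4 - delta Γ q ^ 2)) * (2 * Real.pi / s)))
      =O[atTop] fun s => 1 / (s * √s) := by
  refine (hΓ.exp_mul_tsum_doubleCosetTerm_isBigO hF hm hfin).congr' ?_ EventuallyEq.rfl
  filter_upwards [eventually_gt_atTop 0] with s hs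
  rw [hb.mul_periodSum hΓ hF hm hs]

theorem IsEigenbasis.periodSum_two_mul_isBigO (hb : IsEigenbasis Γ F φ lam r b)
    (hΓ : IsSurfaceGroup Γ) (hF : IsFundamentalSet Γ F) (hm : DiagonalGenerator Γ m)
    (hfin : {q : DoubleCosets Γ | delta Γ q < 2}.Finite) :
    (fun t : ℝ => 2 * Real.exp (2 * t) * √(Real.pi / t) * periodSum Γ m φ r (2 * t) -
      (geodesicLength m * √(Real.pi / t) +
        (∑ q ∈ hfin.toFinset, 2 / √(4 - delta Γ q ^ 2)) * (Real.pi / t)))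
      =O[atTop] fun t => 1 / (t * √t) := by
  have htend : Tendsto (fun t : ℝ => 2 * t) atTop atTop :=
    tendsto_id.const_mul_atTop two_pos
  have h := (hb.periodSum_isBigO hΓ hF hm hfin).comp_tendsto htend
  refine (h.congr_left fun t => ?_).trans ?_
  · simp only [Function.comp_apply]
    rw [mul_div_mul_left _ _ two_ne_zero]
    ring
  · refine Asymptotics.IsBigO.of_bound 1 ?_
    filter_upwards [eventually_gt_atTop 0] with t ht
    have hs : 0 < √t := Real.sqrt_pos.mpr ht
    have h2 : √t ≤ √(2 * t) := Real.sqrt_le_sqrt (by linarith)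
    have h3 : 0 < √(2 * t) := hs.trans_le h2
    simp only [Function.comp_apply]
    rw [Real.norm_of_nonneg (by positivity), Real.norm_of_nonneg (by positivity), one_mul]
    gcongr
    linarith

/-- After multiplication by `√s` the second term is `O(s^(-1/2))` and the error `O(1 / s)`; dividing
by `2 √(2π)` leaves half of the length. -/
theorem IsEigenbasis.tendsto_exp_mul_periodSum (hb : IsEigenbasis Γ F φ lam r b)
    (hΓ : IsSurfaceGroup Γ) (hF : IsFundamentalSet Γ F) (hm : DiagonalGenerator Γ m) :
    Tendsto (fun t : ℝ => Real.exp t * periodSum Γ m φ r t) atTop (𝓝 (geodesicLength m / 2)) := by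
  have hfin := hΓ.finite_delta_lt hF hm
  have hpi := Real.pi_pos
  set c := ∑ q ∈ hfin.toFinset, 2 / √(4 - delta Γ q ^ 2)
  have h := hb.periodSum_isBigO hΓ hF hm hfin
  have hinv : Tendsto (fun s : ℝ => s⁻¹) atTop (𝓝 0) := tendsto_inv_atTop_zero
  have hsq : Tendsto (fun s : ℝ => (√s)⁻¹) atTop (𝓝 0) :=
    tendsto_inv_atTop_zero.comp Real.tendsto_sqrt_atTop
  have h1 : Tendsto (fun s : ℝ => √s * (Real.exp s * (2 * √(2 * Real.pi / s) *
      periodSum Γ m φ r s) - (geodesicLength m * √(2 * Real.pi / s) + c * (2 * Real.pi / s))))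
      atTop (𝓝 0) := by
    refine ((Asymptotics.isBigO_refl (fun s : ℝ => √s) atTop).mul h).trans_tendsto ?_
    refine hinv.congr' ?_
    filter_upwards [eventually_gt_atTop 0] with s hs
    have : 0 < √s := Real.sqrt_pos.mpr hs
    field_simp
  have h2 := (h1.add (hsq.const_mul (c * (2 * Real.pi)))).add_const
    (geodesicLength m * √(2 * Real.pi))
  have h3 := h2.mul_const (1 / (2 * √(2 * Real.pi)))
  have hq : 0 < √(2 * Real.pi) := Real.sqrt_pos.mpr (by positivity)
  convert h3.congr' ?_ using 2
  · rw [mul_zero, add_zero, zero_add]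
    field_simp
  · filter_upwards [eventually_gt_atTop 0] with s hs
    have hs0 : 0 < √s := Real.sqrt_pos.mpr hs
    have hss : s = √s ^ 2 := (Real.sq_sqrt hs.le).symm
    rw [Real.sqrt_div (by positivity)]
    have : √s * (c * (2 * Real.pi / s)) = c * (2 * Real.pi) * (√s)⁻¹ := by
      conv_lhs => rw [hss, Real.sqrt_sq hs0.le]
      field_simp
    rw [mul_sub, mul_add, this]
    field_simp
    ring

theorem IsEigenbasis.tendsto_exp_mul_tsum (hb : IsEigenbasis Γ F φ lam r b)
    (hΓ : IsSurfaceGroup Γ) (hF : IsFundamentalSet Γ F) (hm : DiagonalGenerator Γ m) :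
    Tendsto (fun t : ℝ => (Real.exp t : ℂ) *
      ∑' n, besselK (Complex.I * r n) t * ((‖period Γ m (φ n)‖ ^ 2 : ℝ) : ℂ)) atTop
      (𝓝 ((geodesicLength m / 2 : ℝ) : ℂ)) := by
  refine ((Complex.continuous_ofReal.tendsto _).comp
    (hb.tendsto_exp_mul_periodSum hΓ hF hm)).congr' ?_
  filter_upwards [eventually_gt_atTop 0] with t ht
  rw [hb.tsum_eq_periodSum ht, Function.comp_apply, Complex.ofReal_mul]

theorem IsEigenbasis.summable (hb : IsEigenbasis Γ F φ lam r b)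
    (hΓ : IsSurfaceGroup Γ) (hF : IsFundamentalSet Γ F) (hm : DiagonalGenerator Γ m) {t : ℝ}
    (ht : 0 < t) :
    Summable fun n => besselK (Complex.I * r n) t * ((‖period Γ m (φ n)‖ ^ 2 : ℝ) : ℂ) := by
  simp_rw [hb.besselK_mul_eq ht]
  exact Complex.summable_ofReal.mpr (hb.summable_besselK_mul hΓ hF hm ht)

/-- A single term is of size `exp (- t) / √t`, so omitting the index `0` does not affect the limit,
whatever eigenfunction it carries. -/
theorem tendsto_exp_mul_besselK (ν : ℂ) :
    Tendsto (fun t : ℝ => (Real.exp t : ℂ) * besselK ν t) atTop (𝓝 0) := by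
  have hsq : Tendsto (fun s : ℝ => (((√s)⁻¹ : ℝ) : ℂ)) atTop (𝓝 ((0 : ℝ) : ℂ)) :=
    (Complex.continuous_ofReal.tendsto _).comp
      (tendsto_inv_atTop_zero.comp Real.tendsto_sqrt_atTop)
  have h := hsq.mul (sqrt_mul_exp_mul_besselK_tendsto ν)
  rw [Complex.ofReal_zero, zero_mul] at h
  refine h.congr' ?_
  filter_upwards [eventually_gt_atTop 0] with s hs
  have : (√s)⁻¹ * √s = 1 := inv_mul_cancel₀ (Real.sqrt_pos.mpr hs).ne'
  rw [← mul_assoc, ← Complex.ofReal_mul, ← mul_assoc, this, one_mul]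

theorem IsEigenbasis.tendsto_exp_mul_tsum_succ (hb : IsEigenbasis Γ F φ lam r b)
    (hΓ : IsSurfaceGroup Γ) (hF : IsFundamentalSet Γ F) (hm : DiagonalGenerator Γ m) :
    Tendsto (fun t : ℝ => (Real.exp t : ℂ) *
      ∑' n, besselK (Complex.I * r (n + 1)) t * ((‖period Γ m (φ (n + 1))‖ ^ 2 : ℝ) : ℂ)) atTop
      (𝓝 ((geodesicLength m / 2 : ℝ) : ℂ)) := by
  have h := (hb.tendsto_exp_mul_tsum hΓ hF hm).sub ((tendsto_exp_mul_besselK (Complex.I * r 0)).mul_const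
    ((‖period Γ m (φ 0)‖ ^ 2 : ℝ) : ℂ))
  rw [zero_mul, sub_zero] at h
  refine h.congr' ?_
  filter_upwards [eventually_gt_atTop 0] with t ht
  rw [(hb.summable hΓ hF hm ht).tsum_eq_zero_add]
  ring

end
end GeodesicPeriods

end

/-! ### The theorem, assembled from the trace formula and its asymptotics. -/

theorem proposition3p2 (Γ : Subgroup SL(2, ℝ)) (hΓ : GeodesicPeriods.IsSurfaceGroup Γ)
    (m : ℝ) (hm : GeodesicPeriods.DiagonalGenerator Γ m)
    (F : Set ℍ) (hF : GeodesicPeriods.IsFundamentalSet Γ F)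
    (φ : ℕ → GeodesicPeriods.Surface Γ → ℂ) (lam : ℕ → ℝ) (r : ℕ → ℂ)
    (b : HilbertBasis ℕ ℂ (MeasureTheory.Lp ℂ 2 (GeodesicPeriods.surfaceArea Γ F)))
    (hb : ∀ n, (b n : GeodesicPeriods.Surface Γ → ℂ) =ᵐ[GeodesicPeriods.surfaceArea Γ F] φ n)
    (hφ : ∀ n, GeodesicPeriods.IsEigenfunction Γ (φ n) (lam n))
    (hr : ∀ n, (lam n : ℂ) = 1 / 4 + r n ^ 2) :
    (∀ t : ℝ, 0 < t → Summable fun n : ℕ =>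
      GeodesicPeriods.besselK (Complex.I * r n) t *
        (‖GeodesicPeriods.period Γ m (φ n)‖ ^ 2 : ℝ)) ∧
    {q : GeodesicPeriods.DoubleCosets Γ | GeodesicPeriods.delta Γ q < 2}.Finite ∧
    ((fun t : ℝ =>
        ((2 * Real.exp (2 * t) * √(Real.pi / t) : ℝ) : ℂ) *
            (∑' n : ℕ, GeodesicPeriods.besselK (Complex.I * r n) (2 * t) *
              (‖GeodesicPeriods.period Γ m (φ n)‖ ^ 2 : ℝ))
          - ((GeodesicPeriods.geodesicLength m * √(Real.pi / t)
            + (∑ᶠ q ∈ {q : GeodesicPeriods.DoubleCosets Γ | GeodesicPeriods.delta Γ q < 2},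
                2 / √(4 - GeodesicPeriods.delta Γ q ^ 2)) * (Real.pi / t) : ℝ) : ℂ))
      =O[Filter.atTop] fun t : ℝ => 1 / (t * √t)) ∧
    Filter.Tendsto
      (fun t : ℝ => (Real.exp t : ℂ) *
        ∑' n : ℕ, GeodesicPeriods.besselK (Complex.I * r n) t *
          (‖GeodesicPeriods.period Γ m (φ n)‖ ^ 2 : ℝ))
      Filter.atTop (nhds ((GeodesicPeriods.geodesicLength m / 2 : ℝ) : ℂ)) ∧
    Filter.Tendsto
      (fun t : ℝ => (Real.exp t : ℂ) *
        ∑' n : ℕ, GeodesicPeriods.besselK (Complex.I * r (n + 1)) t *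
          (‖GeodesicPeriods.period Γ m (φ (n + 1))‖ ^ 2 : ℝ))
      Filter.atTop (nhds ((GeodesicPeriods.geodesicLength m / 2 : ℝ) : ℂ)) := by
  have hB : GeodesicPeriods.IsEigenbasis Γ F φ lam r b := ⟨hb, hφ, hr⟩
  have hfin := hΓ.finite_delta_lt hF hm
  refine ⟨fun t ht => hB.summable hΓ hF hm ht, hfin, ?_, hB.tendsto_exp_mul_tsum hΓ hF hm,
    hB.tendsto_exp_mul_tsum_succ hΓ hF hm⟩
  rw [finsum_mem_eq_finite_toFinset_sum _ hfin]
  refine Asymptotics.IsBigO.congr'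
    (Complex.isBigO_ofReal_left.mpr (hB.periodSum_two_mul_isBigO hΓ hF hm hfin)) ?_
    Filter.EventuallyEq.rfl
  -- For `t > 0` the complex series is the cast of the real `periodSum`; for other `t` this
  -- identification is not available, hence the eventual congruence.
  filter_upwards [Filter.eventually_gt_atTop 0] with t ht
  rw [hB.tsum_eq_periodSum (by positivity), ← Complex.ofReal_mul, ← Complex.ofReal_sub]
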